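/- **Setting.** There are $K$ arms; arm $a$ has Bernoulli rewards of mean $\mu_a\in[0,1]$. Put $\mu^*=\max_a\mu_a$ and $\Delta_a=\mu^*-\mu_a$. For $p,q\in[0,1]$ let $d(p,q)=p\log\frac pq+(1-p)\log\frac{1-p}{1-q}\in[0,\infty]$ be the Bernoulli relative entropy, with the usual conventions (in particular $d(p,0)=\infty$ for $p\ne 0$ and $d(p,1)=\infty$ for $p\neq1$). A randomised policy that is fed rewards $r^T=(r_1,\dots,r_T)$ plays the action sequence $a^T$ with probability $\pi(a^T\mid r^T)$. It is *$\epsilon$-global DP* if $\pi(a^T\mid r^T)\le e^{\epsilon}\,\pi(a^T\mid r'^T)$ for every $a^T\in[K]^T$ and all $r^T,r'^T\in[0,1]^T$ that differ in exactly one round. In the environment, the history $(a^T,r^T)$ has probability $\pi(a^T\mid r^T)\prod_{t}\nu_{a_t}(r_t)$, where $\nu_a$ is the Bernoulli law of mean $\mu_a$, and the regret is $\mathrm{Reg}_T=T\mu^*-\mathbb E\big[\sum_{t=1}^T R_t\big]$. **AdaP-KLUCB** with parameters $\epsilon>0$ and $\alpha>0$. Play every arm once, in order. Then proceed in episodes $\ell=1,2,\dots$.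 Let $t_\ell$ be the first round of episode $\ell$ and $N_a=N_a(t_\ell-1)$ the number of earlier plays of arm $a$. The episode plays one arm $A_\ell$ maximising the index $I_a$ below (ties are broken by any fixed measurable rule) until the number of plays of that arm has doubled. The index is $$I_a=\max\Big\{q\in[0,1]:\ d(\breve\mu_a,q)\le \frac{\alpha\log t_\ell}{\frac12N_a}\Big\},\qquad \breve\mu_a=\min\Big\{1,\max\Big\{0,\ \tilde\mu_a+\frac{\alpha\log t_\ell}{\epsilon\,\frac12N_a}\Big\}\Big\},$$ where $\tilde\mu_a=\hat\mu_a+\mathrm{Lap}\big(\frac{2}{\epsilon N_a}\big)$, $\hat\mu_a$ is the mean of the rewards of arm $a$ collected in the last episode in which it was played (the initial play, if there is none), and the Laplace noise is drawn once for each such episode, independently of everything else, and reused until the arm is played again. **Theorem.** (i) For all $\epsilon>0$, $\alpha>0$ and every horizon $T$, AdaP-KLUCB is $\epsilon$-global DP. (ii) There are an absolute constant $C_2>0$ and, for every $\alpha>3$, a constant $C_1(\alpha)>0$ depending on $\alpha$ only, such that for all $K$, all $\epsilon>0$, all means $\mu\in[0,1]^K$ and all horizons $T$, $$\mathrm{Reg}_T\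 \le\ \sum_{a:\Delta_a>0}\left(\frac{C_1(\alpha)\,\Delta_a}{\min\{d(\mu_a,\mu^*),\,C_2\,\epsilon\,\Delta_a\}}\log T+\frac{3\alpha}{\alpha-3}\right)$$ (with $\log 0$ read as $0$ when $T=0$). (iii) Consequently the regret has, up to a constant, the form $\sum_{a:\Delta_a>0}\Delta_a/\min\{d(\mu_a,\mu^*),6\epsilon\Delta_a\}$ of the problem-dependent lower bound for Bernoulli bandits: for every $\alpha>3$ there is a constant $C_3(\alpha)>0$ depending on $\alpha$ only such that, for all $K$, $\epsilon>0$ and $\mu\in[0,1]^K$, $$\limsup_{T\to\infty}\frac{\mathrm{Reg}_T}{\log T}\ \le\ C_3(\alpha)\sum_{a:\Delta_a>0}\frac{\Delta_a}{\min\{d(\mu_a,\mu^*),\,6\,\epsilon\,\Delta_a\}} .$$ -/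

import Mathlib

noncomputable section

open MeasureTheory

namespace PrivateBandit

/-! ### Bernoulli relative entropy and Laplace noise -/

/-- Relative entropy `d(p, q)` between the Bernoulli distributions of means `p, q ∈ [0,1]`, with
values in the extended reals: `d(p, 0) = ∞` for `p ≠ 0` and `d(p, 1) = ∞` for `p ≠ 1`. In the
remaining cases the conventions `log 0 = 0` and `x / 0 = 0` give the usual limits. -/
def klBer (p q : ℝ) : EReal :=
  if (q = 0 ∧ p ≠ 0) ∨ (q = 1 ∧ p ≠ 1) then ⊤
  else ((p * Real.log (p / q) + (1 - p) * Real.log ((1 - p) / (1 - q)) : ℝ) : EReal)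

/-- The centred Laplace distribution of scale `b` (variance `2 b ^ 2`). -/
def laplace (b : ℝ) : Measure ℝ :=
  volume.withDensity fun x => ENNReal.ofReal (Real.exp (-|x| / b) / (2 * b))

theorem isProbabilityMeasure_laplace {b : ℝ} (hb : 0 < b) : IsProbabilityMeasure (laplace b) := by
  have hI : ∫ x : ℝ, Real.exp (-|x| / b) / (2 * b) = 1 := by
    rw [integral_comp_abs (f := fun x : ℝ => Real.exp (-x / b) / (2 * b)), integral_div]
    have h1 : (fun x : ℝ => Real.exp (-x / b)) = fun x => Real.exp (-b⁻¹ * x) := by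
      funext x
      congr 1
      ring
    rw [h1, integral_exp_mul_Ioi (neg_lt_zero.mpr (inv_pos.mpr hb))]
    simp only [mul_zero, Real.exp_zero]
    field_simp
  refine ⟨?_⟩
  rw [laplace, withDensity_apply _ MeasurableSet.univ, Measure.restrict_univ,
    ← ofReal_integral_eq_lintegral_ofReal (integrable_of_integral_eq_one hI)
      (Filter.Eventually.of_forall fun x => by positivity), hI, ENNReal.ofReal_one]

/-! ### Bandit policies, global differential privacy, regret

Rounds are numbered `0, …, T - 1` and arms are `Fin K`. -/

/-- The action law of a policy over `T` rounds: `π a r` is the probability that the policy plays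
the action sequence `a` when it is fed the reward sequence `r`, i.e. `π(a^T ∣ r^T)`. -/
abbrev ActionLaw (K T : ℕ) := (Fin T → Fin K) → (Fin T → ℝ) → ℝ

/-- Two reward sequences that differ in exactly one round. -/
def Neighbouring {T : ℕ} (r r' : Fin T → ℝ) : Prop :=
  ∃ j, r j ≠ r' j ∧ ∀ t, t ≠ j → r t = r' t

/-- `ε`-global differential privacy, for rewards in `[0, 1]`. -/
def IsGlobalDP {K T : ℕ} (ε : ℝ) (π : ActionLaw K T) : Prop :=
  ∀ (a : Fin T → Fin K) (r r' : Fin T → ℝ),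
    (∀ t, r t ∈ Set.Icc (0 : ℝ) 1) → (∀ t, r' t ∈ Set.Icc (0 : ℝ) 1) →
    Neighbouring r r' → π a r ≤ Real.exp ε * π a r'

/-- The value of a binary reward. -/
def rewardValue (b : Bool) : ℝ := if b then 1 else 0

/-- The mass that the Bernoulli distribution of mean `p` gives to the reward `b`. -/
def bernoulliMass (p : ℝ) (b : Bool) : ℝ := if b then p else 1 - p

/-- Canonical bandit model for the Bernoulli environment with means `μ`: the probability of the
history with actions `a` and rewards `b` is `π(a^T ∣ b^T) ∏ₜ ν_{a_t}(b_t)`. -/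
def historyProb {K T : ℕ} (π : ActionLaw K T) (μ : Fin K → ℝ)
    (a : Fin T → Fin K) (b : Fin T → Bool) : ℝ :=
  π a (fun t => rewardValue (b t)) * ∏ t, bernoulliMass (μ (a t)) (b t)

/-- The largest mean `μ*`. -/
def bestMean {K : ℕ} (μ : Fin K → ℝ) : ℝ := ⨆ a, μ a

/-- The suboptimality gap `Δ_a = μ* - μ_a`. -/
def gap {K : ℕ} (μ : Fin K → ℝ) (a : Fin K) : ℝ := bestMean μ - μ a

/-- The regret `T μ* - 𝔼[∑ₜ R_t]`. -/
def regret {K T : ℕ} (π : ActionLaw K T) (μ : Fin K → ℝ) : ℝ :=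
  T * bestMean μ -
    ∑ a : Fin T → Fin K, ∑ b : Fin T → Bool, historyProb π μ a b * ∑ t, rewardValue (b t)

/-! ### The algorithm AdaP-KLUCB -/

/-- Memory of the algorithm between two rounds. -/
structure State (K : ℕ) where
  /-- `N_a`: number of times that arm `a` has been played -/
  pulls : Fin K → ℕ
  /-- value of `N_a` just before the last active episode of arm `a` -/
  start : Fin K → ℕ
  /-- sum of the rewards collected in the last active episode of arm `a` -/
  sum : Fin K → ℝ
  /-- the arm of the running episode, `none` if the next round opens a new episode -/
  current : Option (Fin K)

def initialState (K : ℕ) : State K := ⟨fun _ => 0, fun _ => 0, fun _ => 0, none⟩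

/-- Clipping to `[0, 1]`. -/
def clip (x : ℝ) : ℝ := min (max 0 x) 1

/-- The KL-UCB index at round `t` of an arm that was played `N` times and whose private mean is
`m`. -/
def klIndex (ε α : ℝ) (t N : ℕ) (m : ℝ) : ℝ :=
  sSup {q : ℝ | q ∈ Set.Icc (0 : ℝ) 1 ∧
    klBer (clip (m + α * Real.log t / (ε * (1 / 2 * N)))) q
      ≤ ((α * Real.log t / (1 / 2 * N) : ℝ) : EReal)}

/-- Private mean of arm `a`: the empirical mean over its last active episode plus the noise drawn
for that episode. Outside a running episode `N_a` is a power `2 ^ k` of two, and `Z (a, k)` is the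
noise drawn once, when `N_a` reaches this value. -/
def privateMean {K : ℕ} (Z : Fin K × ℕ → ℝ) (s : State K) (a : Fin K) : ℝ :=
  s.sum a / ((s.pulls a : ℝ) - s.start a) + Z (a, Nat.log 2 (s.pulls a))

/-- The arm played after `t` completed rounds, i.e. in round number `t + 1`: first every arm once,
then the arm of the running episode, or, at the opening of an episode, an arm of largest index. -/
def chooseArm {K : ℕ} (ε α : ℝ) (sel : (Fin K → ℝ) → Fin K) (Z : Fin K × ℕ → ℝ)
    (s : State K) (t : ℕ) : Fin K :=
  if h : t < K then ⟨t, h⟩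
  else match s.current with
    | some b => b
    | none => sel fun a => klIndex ε α (t + 1) (s.pulls a) (privateMean Z s a)

/-- Update after arm `b` was played with reward `x`. The episode goes on until the number of pulls
of `b` is twice what it was when the episode was opened. -/
def updateState {K : ℕ} (s : State K) (b : Fin K) (x : ℝ) : State K :=
  let start' : Fin K → ℕ :=
    if s.current = none then Function.update s.start b (s.pulls b) else s.start
  let sum' : Fin K → ℝ := if s.current = none then Function.update s.sum b 0 else s.sum
  { pulls := Function.update s.pulls b (s.pulls b + 1)
    start := start'
    sum := Function.update sum' b (sum' b + x)
    current := if s.pulls b + 1 < 2 * start' b then some b else none }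

/-- The memory after `t` rounds, for noise `Z` and rewards `r 0, …, r (t - 1)`. -/
def runState {K : ℕ} (ε α : ℝ) (sel : (Fin K → ℝ) → Fin K) (Z : Fin K × ℕ → ℝ) (r : ℕ → ℝ) :
    ℕ → State K
  | 0 => initialState K
  | t + 1 =>
    let s := runState ε α sel Z r t
    updateState s (chooseArm ε α sel Z s t) (r t)

/-- The arm played after `t` completed rounds. -/
def runAction {K : ℕ} (ε α : ℝ) (sel : (Fin K → ℝ) → Fin K) (Z : Fin K × ℕ → ℝ) (r : ℕ → ℝ)
    (t : ℕ) : Fin K :=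
  chooseArm ε α sel Z (runState ε α sel Z r t) t

/-- Law of the noise: independent, with `Z (a, k)` of law `Lap(2 / (ε N))` for `N = 2 ^ k`. -/
def noiseLaw (K : ℕ) (ε : ℝ) : Measure (Fin K × ℕ → ℝ) :=
  Measure.infinitePi fun p => laplace (2 / (ε * 2 ^ p.2))

/-- `sel` returns an arm of largest index, ties being broken in a measurable way. -/
def IsArgmaxRule {K : ℕ} (sel : (Fin K → ℝ) → Fin K) : Prop :=
  Measurable sel ∧ ∀ (x : Fin K → ℝ) (a : Fin K), x a ≤ x (sel x)

/-- The action law of AdaP-KLUCB over `T` rounds. -/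
def adaPKLUCB (K : ℕ) (ε α : ℝ) (sel : (Fin K → ℝ) → Fin K) (T : ℕ) : ActionLaw K T :=
  fun a r => (noiseLaw K ε).real
    {Z | ∀ t : Fin T,
      runAction ε α sel Z (fun n => if h : n < T then r ⟨n, h⟩ else 0) t = a t}

end PrivateBandit

end

noncomputable section

open MeasureTheory

namespace PrivateBandit

/-! ### Bernoulli relative entropy -/

/-! Privacy. Once the actions are fixed, play counts and episode boundaries depend on them alone;
rewards reach a decision only through the mean over an episode, masked by one Laplace variable. The
reward of a given round lies in exactly one episode. If that episode ends after `2 ^ k` plays, it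
has at least `2 ^ k / 2` of them, so altering the reward moves one private mean by at most `2 / 2 ^
k`. This has the effect of shifting one noise variable (`Admissible.chooseArm_of_neighbouring`),
which by the Laplace scale changes probabilities by a factor of at most `exp ε`
(`noiseLaw_real_le_shift`).

Regret. The regret is the sum of gaps times expected play counts (`regret_eq_sum_gap`), and
histories are realised on a product space of noise and an independent reward table
(`tableLaw_real_tableEvent`), so that events about one episode involve fixed, independent entries.
Dyadically, an expected play count is at most `1 + ∑ 2 ^ k P(N > 2 ^ k)`. Play number `2 ^ k + 1` of
a suboptimal arm `c` opens an episode, so at that moment either the index of an optimal arm `o` is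
below `μ o`, or that of `c` is at least `μ o` (`mem_underEvent_or_overEvent`). If `o` then has `2 ^
j` plays, the time is at least `2 ^ j + 2 ^ k + 1`; the tail `n ^ (-α)` with `α ≥ 3` makes the first
failure summable, with an absolute bound.

For the second failure let `q = μ c`, `m = μ o` and `D = min (d(q, m)) (6 ε (m - q))`. As soon as `2
^ k ≥ 96 α log T / D`, failure needs a large noise or a large empirical mean
(`overEvent_subset_of_le`). Both have exponential tails, but the rate of the empirical mean is
comparable with `D` only while `m` is not much closer to 1 than `q` (`rate_lower_bound`); otherwise
it is only of the order of `1 - q`. This suffices if `D ≤ 96 α (1 - q) log T`. In the opposite case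
`ε` is huge and `m` is extremely close to 1, so failure forces, up to a tiny noise probability, an
entire episode of rewards 1 (`overEvent_subset_of_lt`). Two consecutive such episodes give a
geometric sum of order `1 / (1 - q)`, and since the gap is at most `1 - q`, the arm costs at most 3
in total. -/

/-- The real-valued formula of the Bernoulli relative entropy. -/
def klReal (p q : ℝ) : ℝ := p * Real.log (p / q) + (1 - p) * Real.log ((1 - p) / (1 - q))

theorem klBer_eq_klReal {p q : ℝ} (hq : 0 < q) (hq' : q < 1) : klBer p q = (klReal p q : EReal) := by
  rw [klBer, if_neg, klReal]
  rintro (h | h)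
  · exact hq.ne' h.1
  · exact hq'.ne h.1

theorem klBer_one {p : ℝ} (hp : p ≠ 1) : klBer p 1 = ⊤ := by
  rw [klBer, if_pos (Or.inr ⟨rfl, hp⟩)]

theorem klBer_self (p : ℝ) : klBer p p = 0 := by
  rw [klBer, if_neg]
  · have h : ∀ x : ℝ, x * Real.log (x / x) = 0 := by
      intro x
      rcases eq_or_ne x 0 with rfl | hx
      · simp
      · simp [div_self hx]
    rw [h, h]
    simp
  · rintro (h | h)
    · exact h.2 h.1
    · exact h.2 h.1

theorem sub_le_mul_log_div {p q : ℝ} (hp : 0 ≤ p) (hq : 0 < q) : p - q ≤ p * Real.log (p / q) := by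
  rcases hp.eq_or_lt with rfl | hp
  · simpa using hq.le
  · have h := Real.one_sub_inv_le_log_of_pos (div_pos hp hq)
    calc p - q = p * (1 - (p / q)⁻¹) := by field_simp
      _ ≤ _ := mul_le_mul_of_nonneg_left h hp.le

theorem mul_log_div_le {p q : ℝ} (hp : 0 ≤ p) (hq : 0 < q) :
    p * Real.log (p / q) ≤ p * (p / q - 1) := by
  rcases hp.eq_or_lt with rfl | hp
  · simp
  · exact mul_le_mul_of_nonneg_left (Real.log_le_sub_one_of_pos (div_pos hp hq)) hp.le

theorem mul_log_div_sub {p q q' : ℝ} (hp : 0 ≤ p) (hq : 0 < q) (hq' : 0 < q') :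
    p * Real.log (p / q') - p * Real.log (p / q) = p * Real.log (q / q') := by
  rcases hp.eq_or_lt with rfl | hp
  · simp
  · rw [Real.log_div hp.ne' hq'.ne', Real.log_div hp.ne' hq.ne', Real.log_div hq.ne' hq'.ne']
    ring

theorem klReal_nonneg {p q : ℝ} (hp : 0 ≤ p) (hp' : p ≤ 1) (hq : 0 < q) (hq' : q < 1) :
    0 ≤ klReal p q := by
  have h1 := sub_le_mul_log_div hp hq
  have h2 := sub_le_mul_log_div (sub_nonneg.2 hp') (sub_pos.2 hq')
  rw [klReal]
  linarith

/-- Three-point identity: the difference of two relative entropies is affine in the first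
argument. -/
theorem klReal_sub_klReal {p q q' : ℝ} (hp : 0 ≤ p) (hp' : p ≤ 1) (hq : 0 < q) (hq1 : q < 1)
    (hq' : 0 < q') (hq1' : q' < 1) :
    klReal p q' - klReal p q = p * Real.log (q / q') + (1 - p) * Real.log ((1 - q) / (1 - q')) := by
  rw [← mul_log_div_sub hp hq hq',
    ← mul_log_div_sub (sub_nonneg.2 hp') (sub_pos.2 hq1) (sub_pos.2 hq1'), klReal, klReal]
  ring

theorem klReal_self {p : ℝ} : klReal p p = 0 := by
  have h : ∀ x : ℝ, x * Real.log (x / x) = 0 := by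
    intro x
    rcases eq_or_ne x 0 with rfl | hx
    · simp
    · simp [div_self hx]
  rw [klReal, h, h, add_zero]

/-- Moving from `q` up to `q'` raises the relative entropy more for smaller first arguments. -/
theorem klReal_sub_anti {p p' q q' : ℝ} (hp : 0 ≤ p) (hpp : p ≤ p') (hp1 : p' ≤ 1) (hq : 0 < q)
    (hqq : q ≤ q') (hq1 : q' < 1) :
    klReal p' q' - klReal p' q ≤ klReal p q' - klReal p q := by
  have hq0' : 0 < q' := hq.trans_le hqq
  rw [klReal_sub_klReal (hp.trans hpp) hp1 hq (hqq.trans_lt hq1) hq0' hq1,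
    klReal_sub_klReal hp (hpp.trans hp1) hq (hqq.trans_lt hq1) hq0' hq1]
  have h1 : Real.log (q / q') ≤ 0 := Real.log_nonpos (by positivity) ((div_le_one hq0').2 hqq)
  have h2 : 0 ≤ Real.log ((1 - q) / (1 - q')) :=
    Real.log_nonneg ((one_le_div (by linarith)).2 (by linarith))
  nlinarith

/-- No calculus is needed: compare in `klReal_sub_anti` with first argument `q`, where the increment
is `klReal q q' ≥ 0`. The monotonicity in the first argument comes from the same lemma. -/
theorem klReal_mono_right {p q q' : ℝ} (hp : 0 ≤ p) (hpq : p ≤ q) (hq : 0 < q)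
    (hqq : q ≤ q') (hq1 : q' < 1) : klReal p q ≤ klReal p q' := by
  have h := klReal_sub_anti hp hpq (hqq.trans hq1.le) hq hqq hq1
  have h2 := klReal_nonneg hq.le (hqq.trans hq1.le) (hq.trans_le hqq) hq1
  rw [klReal_self] at h
  linarith

theorem klReal_anti_left {p p' q : ℝ} (hp : 0 ≤ p) (hpp : p ≤ p') (hpq : p' ≤ q)
    (hq1 : q < 1) : klReal p' q ≤ klReal p q := by
  rcases (hp.trans hpp).eq_or_lt with h0 | h0
  · rw [← h0] at hpp ⊢
    rw [le_antisymm hpp hp]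
  · have h := klReal_sub_anti hp hpp (hpq.trans hq1.le) h0 hpq hq1
    have h2 := klReal_nonneg hp (hpp.trans (hpq.trans hq1.le)) h0 (hpq.trans_lt hq1)
    rw [klReal_self] at h
    linarith

theorem klBer_nonneg {p q : ℝ} (hp : 0 ≤ p) (hp' : p ≤ 1) (hq : 0 ≤ q) (hq' : q ≤ 1) :
    0 ≤ klBer p q := by
  rcases hq.eq_or_lt with rfl | hq
  · rcases eq_or_ne p 0 with rfl | h
    · rw [klBer_self]
    · rw [klBer, if_pos (Or.inl ⟨rfl, h⟩)]
      exact le_top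
  rcases hq'.eq_or_lt with rfl | hq'
  · rcases eq_or_ne p 1 with rfl | h
    · rw [klBer_self]
    · rw [klBer_one h]
      exact le_top
  rw [klBer_eq_klReal hq hq']
  exact_mod_cast klReal_nonneg hp hp' hq hq'

theorem klBer_anti_left {p p' q : ℝ} (hp : 0 ≤ p) (hpp : p ≤ p') (hpq : p' ≤ q) (hq1 : q ≤ 1) :
    klBer p' q ≤ klBer p q := by
  rcases (hp.trans (hpp.trans hpq)).eq_or_lt with h0 | h0
  · rw [← h0] at hpq
    rw [le_antisymm (hpp.trans hpq) hp, le_antisymm hpq (hp.trans hpp)]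
  rcases hq1.eq_or_lt with rfl | hq1
  · rcases eq_or_ne p 1 with rfl | h
    · rw [le_antisymm hpq hpp]
    · rw [klBer_one h]
      exact le_top
  rw [klBer_eq_klReal h0 hq1, klBer_eq_klReal h0 hq1]
  exact_mod_cast klReal_anti_left hp hpp hpq hq1

theorem klBer_mono_right {p q q' : ℝ} (hp : 0 ≤ p) (hpq : p ≤ q) (hqq : q ≤ q') (hq1 : q' ≤ 1) :
    klBer p q ≤ klBer p q' := by
  rcases (hp.trans hpq).eq_or_lt with h0 | h0
  · rw [← h0] at hpq ⊢
    rw [le_antisymm hpq hp, klBer_self]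
    exact klBer_nonneg le_rfl zero_le_one (h0.le.trans hqq) hq1
  rcases hq1.eq_or_lt with rfl | hq1
  · rcases eq_or_ne p 1 with rfl | h
    · rw [le_antisymm hqq hpq]
    · rw [klBer_one h]
      exact le_top
  rw [klBer_eq_klReal h0 (hqq.trans_lt hq1), klBer_eq_klReal (h0.trans_le hqq) hq1]
  exact_mod_cast klReal_mono_right hp hpq h0 hqq hq1

/-- Left continuity in the second argument, including blow-up at 1. It lets the index be treated as
a supremum without showing that it is attained. -/
theorem klBer_le_of_forall_lt {m q b : ℝ} (hm : 0 ≤ m) (hmq : m < q) (hq : q ≤ 1)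
    (h : ∀ q' ∈ Set.Ioo m q, klBer m q' ≤ (b : EReal)) : klBer m q ≤ (b : EReal) := by
  have h' : ∀ q' ∈ Set.Ioo m q, klReal m q' ≤ b := by
    intro q' hq'
    have h1 := h q' hq'
    rw [klBer_eq_klReal (hm.trans_lt hq'.1) (hq'.2.trans_le hq)] at h1
    exact_mod_cast h1
  rcases hq.eq_or_lt with rfl | hq
  · exfalso
    have hm1 : 0 < 1 - m := by linarith
    -- At `q' = 1 - (1 - m) e` the second term of the entropy equals `|b| + 2`, while the first is
    -- at least `m - q' ≥ -1`; together they exceed `b`.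
    set e := Real.exp (-((|b| + 2) / (1 - m))) with he
    have he0 : 0 < e := Real.exp_pos _
    have he1 : e < 1 := by
      rw [he, Real.exp_lt_one_iff, neg_lt_zero]
      positivity
    have h1 := h' (1 - (1 - m) * e) ⟨by nlinarith, by nlinarith⟩
    have h2 : (1 - m) / (1 - (1 - (1 - m) * e)) = e⁻¹ := by
      field_simp
      ring
    have h3 := sub_le_mul_log_div hm (q := 1 - (1 - m) * e) (by nlinarith)
    rw [klReal, h2, Real.log_inv, he, Real.log_exp, neg_neg, mul_div_cancel₀ _ hm1.ne', ← he] at h1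
    have h4 := le_abs_self b
    nlinarith
  · have hq0 : 0 < q := hm.trans_lt hmq
    rw [klBer_eq_klReal hq0 hq]
    have hc : ContinuousAt (fun q' => klReal m q') q := by
      have hq1 : 1 - q ≠ 0 := by linarith
      have e : ∀ᶠ z in nhds q, klReal m z =
          (m * Real.log m + (1 - m) * Real.log (1 - m)) - m * Real.log z
            - (1 - m) * Real.log (1 - z) := by
        filter_upwards [Ioo_mem_nhds hq0 hq] with z hz
        rw [klReal]
        have a1 : m * Real.log (m / z) = m * Real.log m - m * Real.log z := by
          rcases hm.eq_or_lt with h0 | h0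
          · simp [← h0]
          · rw [Real.log_div h0.ne' hz.1.ne']
            ring
        rw [a1, Real.log_div (by linarith) (by linarith [hz.2])]
        ring
      refine ContinuousAt.congr ?_ (e.mono fun _ hz => hz.symm)
      have c1 : ContinuousAt Real.log q := Real.continuousAt_log hq0.ne'
      have c2 : ContinuousAt (fun z => Real.log (1 - z)) q :=
        ContinuousAt.log (by fun_prop) hq1
      fun_prop
    have ht : Filter.Tendsto (fun q' => klReal m q') (nhdsWithin q (Set.Iio q))
        (nhds (klReal m q)) := hc.tendsto.mono_left nhdsWithin_le_nhds
    have : klReal m q ≤ b := by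
      refine le_of_tendsto ht ?_
      filter_upwards [Ioo_mem_nhdsLT hmq] with z hz using h' z hz
    exact_mod_cast this

/-- The relative entropy from the midpoint is comparable with the one from the left endpoint. -/
theorem klReal_le_klReal_midpoint {p q : ℝ} (hp : 0 ≤ p) (hpq : p < q) (hq1 : q < 1) :
    klReal p q ≤ 12 * klReal ((p + q) / 2) q := by
  -- The function `f x = klReal x q - klReal x w` is affine. Concavity of the logarithm gives `f p ≥
  -- klReal p q / 4`, and `f w = klReal w q ≥ 0`. Since the midpoint is `(p + 2 w) / 3`, `f` is at
  -- least `klReal p q / 12` there.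
  set w := (p + 3 * q) / 4 with hw
  set m := (p + q) / 2 with hm
  have hw0 : 0 < w := by linarith
  have hwq : w < q := by linarith
  have hq0 : 0 < q := by linarith
  have e1 := klReal_sub_klReal hp (by linarith) hw0 (by linarith) hq0 hq1
  have e2 := klReal_sub_klReal (p := m) (by linarith) (by linarith) hw0 (by linarith) hq0 hq1
  have e3 := klReal_sub_klReal (p := w) hw0.le (by linarith) hw0 (by linarith) hq0 hq1
  rw [klReal_self] at e3
  have n1 := klReal_nonneg (p := w) (q := q) hw0.le (by linarith) hq0 hq1
  have n2 := klReal_nonneg (p := m) (q := w) (by linarith) (by linarith) hw0 (by linarith)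
  have hconv : klReal p w ≤ 3 / 4 * klReal p q := by
    have hlog : ∀ x y : ℝ, 0 < x → 0 < y →
        1 / 4 * Real.log x + 3 / 4 * Real.log y ≤ Real.log ((x + 3 * y) / 4) := by
      intro x y hx hy
      have := strictConcaveOn_log_Ioi.concaveOn.2 (Set.mem_Ioi.2 hx) (Set.mem_Ioi.2 hy)
        (show (0 : ℝ) ≤ 1 / 4 by norm_num) (show (0 : ℝ) ≤ 3 / 4 by norm_num) (by norm_num)
      simp only [smul_eq_mul] at this
      refine this.trans (le_of_eq ?_)
      congr 1
      ring
    have hterm : ∀ x y : ℝ, 0 ≤ x → 0 < y →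
        x * Real.log (x / ((x + 3 * y) / 4)) ≤ 3 / 4 * (x * Real.log (x / y)) := by
      intro x y hx hy
      rcases hx.eq_or_lt with rfl | hx
      · simp
      · rw [Real.log_div hx.ne' (by positivity), Real.log_div hx.ne' hy.ne']
        nlinarith [hlog x y hx hy]
    have t1 := hterm p q hp hq0
    have t2 := hterm (1 - p) (1 - q) (by linarith) (by linarith)
    rw [show (1 - p + 3 * (1 - q)) / 4 = 1 - w by rw [hw]; ring] at t2
    rw [← hw] at t1
    rw [klReal, klReal]
    linarith
  have hL : 3 * (klReal m q - klReal m w) = (klReal p q - klReal p w) + 2 * (klReal w q) := by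
    rw [e1, e2]
    have : klReal w q = w * Real.log (w / q) + (1 - w) * Real.log ((1 - w) / (1 - q)) := by
      rw [← e3, sub_zero]
    rw [this, show m = (p + 2 * w) / 3 by rw [hm, hw]; ring]
    ring
  linarith

/-- Upper bound of the relative entropy by the chi-square divergence. -/
theorem klReal_le_sq_div {p q : ℝ} (hp : 0 ≤ p) (hp1 : p ≤ 1) (hq : 0 < q) (hq1 : q < 1) :
    klReal p q ≤ (q - p) ^ 2 / (q * (1 - q)) := by
  have h1 := mul_log_div_le hp hq
  have h2 := mul_log_div_le (sub_nonneg.2 hp1) (sub_pos.2 hq1)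
  have hq' : 1 - q ≠ 0 := by linarith
  rw [klReal]
  calc _ ≤ p * (p / q - 1) + (1 - p) * ((1 - p) / (1 - q) - 1) := add_le_add h1 h2
    _ = _ := by
      field_simp
      ring

theorem klReal_le_mul_log {p q : ℝ} (hp : 0 ≤ p) (hpq : p ≤ q) (hq : 0 < q) :
    klReal p q ≤ (1 - p) * Real.log ((1 - p) / (1 - q)) := by
  have : Real.log (p / q) ≤ 0 := Real.log_nonpos (by positivity) ((div_le_one hq).2 hpq)
  rw [klReal]
  nlinarith

/-- Lower bound of the relative entropy by the squared Hellinger distance, made explicit. -/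
theorem sq_div_le_klReal {r p : ℝ} (hp : 0 < p) (hpr : p ≤ r) (hr : r < 1) :
    (r - p) ^ 2 / (4 * (r * (1 - p))) ≤ klReal r p := by
  -- This is `log s ≥ 1 - 1 / s` at `s = √(x / y)`. The linear parts cancel when the two terms of
  -- the entropy are added.
  have key : ∀ x y : ℝ, 0 < x → 0 < y → x - y + (√x - √y) ^ 2 ≤ x * Real.log (x / y) := by
    intro x y hx hy
    have h := Real.one_sub_inv_le_log_of_pos (Real.sqrt_pos.2 (div_pos hx hy))
    rw [Real.log_sqrt (by positivity), Real.sqrt_div hx.le, inv_div] at h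
    have hsx := Real.sqrt_pos.2 hx
    have h' : x * (2 * (1 - √y / √x)) ≤ x * Real.log (x / y) :=
      mul_le_mul_of_nonneg_left (by linarith) hx.le
    refine le_trans (le_of_eq ?_) h'
    have e : x * (√y / √x) = √x * √y := by
      nth_rewrite 1 [← Real.mul_self_sqrt hx.le]
      field_simp
    linear_combination (Real.sq_sqrt hx.le) + (Real.sq_sqrt hy.le) + 2 * e
  have hsq : ∀ x y z : ℝ, 0 ≤ x → 0 ≤ y → 0 < z → x ≤ z → y ≤ z →
      (x - y) ^ 2 / (4 * z) ≤ (√x - √y) ^ 2 := by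
    intro x y z hx hy hz hxz hyz
    rw [div_le_iff₀ (by positivity)]
    have e : (x - y) ^ 2 = (√x - √y) ^ 2 * (√x + √y) ^ 2 := by
      rw [← mul_pow]
      congr 1
      linear_combination -(Real.sq_sqrt hx) + Real.sq_sqrt hy
    rw [e]
    refine mul_le_mul_of_nonneg_left ?_ (sq_nonneg _)
    nlinarith [Real.sq_sqrt hx, Real.sq_sqrt hy, sq_nonneg (√x - √y)]
  have hr0 : 0 < r := hp.trans_le hpr
  have hp1 : 0 < 1 - p := by linarith
  have a1 := key r p hr0 hp
  have a2 := key (1 - r) (1 - p) (by linarith) hp1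
  have b1 := hsq r p r hr0.le hp.le hr0 le_rfl hpr
  have b2 := hsq (1 - r) (1 - p) (1 - p) (by linarith) hp1.le hp1 (by linarith) le_rfl
  -- After clearing denominators this is `r + (1 - p) ≥ 1`, which is where `p ≤ r` enters.
  have : (r - p) ^ 2 / (4 * (r * (1 - p))) ≤
      (r - p) ^ 2 / (4 * r) + (1 - r - (1 - p)) ^ 2 / (4 * (1 - p)) := by
    rw [div_add_div _ _ (by positivity) (by positivity),
      div_le_div_iff₀ (by positivity) (by positivity)]
    have : 0 ≤ (r - p) ^ 2 * r * (1 - p) * (r - p) := by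
      have := sub_nonneg.2 hpr
      positivity
    nlinarith
  rw [klReal]
  linarith

/-! ### The index -/

theorem clip_mem (x : ℝ) : clip x ∈ Set.Icc (0 : ℝ) 1 :=
  ⟨le_min (le_max_left _ _) zero_le_one, min_le_right _ _⟩

theorem clip_mono : Monotone clip := fun _ _ h => min_le_min_right _ (max_le_max_left _ h)

theorem clip_of_mem {x : ℝ} (hx : x ∈ Set.Icc (0 : ℝ) 1) : clip x = x := by
  rw [clip, max_eq_right hx.1, min_eq_left hx.2]

theorem clip_le_of_nonneg {x : ℝ} (hx : 0 ≤ x) : clip x ≤ x := by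
  rw [clip, max_eq_right hx]
  exact min_le_left _ _

/-- The largest `q` whose relative entropy from `p` is at most `b`. -/
def klUpper (p b : ℝ) : ℝ := sSup {q : ℝ | q ∈ Set.Icc (0 : ℝ) 1 ∧ klBer p q ≤ (b : EReal)}

theorem bddAbove_klUpper (p b : ℝ) :
    BddAbove {q : ℝ | q ∈ Set.Icc (0 : ℝ) 1 ∧ klBer p q ≤ (b : EReal)} :=
  ⟨1, fun _ hq => hq.1.2⟩

theorem mem_klUpper_self {p b : ℝ} (hp : p ∈ Set.Icc (0 : ℝ) 1) (hb : 0 ≤ b) :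
    p ∈ {q : ℝ | q ∈ Set.Icc (0 : ℝ) 1 ∧ klBer p q ≤ (b : EReal)} :=
  ⟨hp, by rw [klBer_self]; exact_mod_cast hb⟩

theorem lt_klBer_of_klUpper_lt {p b q : ℝ} (hp : p ∈ Set.Icc (0 : ℝ) 1) (hb : 0 ≤ b)
    (hq : q ∈ Set.Icc (0 : ℝ) 1) (h : klUpper p b < q) : p < q ∧ (b : EReal) < klBer p q := by
  refine ⟨(le_csSup (bddAbove_klUpper p b) (mem_klUpper_self hp hb)).trans_lt h, ?_⟩
  by_contra! hc
  exact absurd (le_csSup (bddAbove_klUpper p b) ⟨hq, hc⟩) (not_le.2 h)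

/-- Every point strictly between `p` and `q` lies below a member of the defining set, so
monotonicity bounds the entropy there; `klBer_le_of_forall_lt` passes to `q`. -/
theorem klBer_le_of_le_klUpper {p b q : ℝ} (hp : p ∈ Set.Icc (0 : ℝ) 1) (hb : 0 ≤ b)
    (hq : q ∈ Set.Icc (0 : ℝ) 1) (h : q ≤ klUpper p b) : q ≤ p ∨ klBer p q ≤ (b : EReal) := by
  rcases le_or_gt q p with hqp | hpq
  · exact Or.inl hqp
  · refine Or.inr (klBer_le_of_forall_lt hp.1 hpq hq.2 fun q' hq' => ?_)
    obtain ⟨q'', hq'', hlt⟩ := exists_lt_of_lt_csSup ⟨p, mem_klUpper_self hp hb⟩ (hq'.2.trans_le h)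
    exact (klBer_mono_right hp.1 hq'.1.le hlt.le hq''.1.2).trans hq''.2

theorem klUpper_mono {p p' b : ℝ} (hp : p ∈ Set.Icc (0 : ℝ) 1) (hp' : p' ∈ Set.Icc (0 : ℝ) 1)
    (hb : 0 ≤ b) (h : p ≤ p') : klUpper p b ≤ klUpper p' b := by
  refine csSup_le ⟨p, mem_klUpper_self hp hb⟩ fun q hq => ?_
  rcases le_or_gt q p' with hqp | hpq
  · exact hqp.trans (le_csSup (bddAbove_klUpper _ _) (mem_klUpper_self hp' hb))
  · exact le_csSup (bddAbove_klUpper _ _)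
      ⟨hq.1, (klBer_anti_left hp.1 h hpq.le hq.1.2).trans hq.2⟩

theorem klIndex_eq (ε α : ℝ) (t N : ℕ) (m : ℝ) :
    klIndex ε α t N m = klUpper (clip (m + α * Real.log t / (ε * (1 / 2 * N))))
      (α * Real.log t / (1 / 2 * N)) := rfl

/-- Monotone real functions are measurable, which is how the choice of an arm becomes a measurable
function of the noise. -/
theorem monotone_klIndex {ε α : ℝ} (hα : 0 < α) (t N : ℕ) : Monotone (klIndex ε α t N) := by
  intro m m' h
  rw [klIndex_eq, klIndex_eq]
  exact klUpper_mono (clip_mem _) (clip_mem _)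
    (div_nonneg (mul_nonneg hα.le (Real.log_natCast_nonneg t)) (by positivity))
    (clip_mono (by linarith))

/-! ### Laplace noise -/

theorem laplace_real_Ioi {b s : ℝ} (hb : 0 < b) (hs : 0 ≤ s) :
    (laplace b).real (Set.Ioi s) = Real.exp (-s / b) / 2 := by
  have hcongr : Set.EqOn (fun x : ℝ => Real.exp (-|x| / b) / (2 * b))
      (fun x : ℝ => Real.exp (-b⁻¹ * x) / (2 * b)) (Set.Ioi s) := by
    intro x hx
    have : 0 ≤ x := hs.trans (le_of_lt hx)
    simp only [abs_of_nonneg this]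
    congr 2
    ring
  have hneg : -b⁻¹ < 0 := neg_lt_zero.mpr (inv_pos.mpr hb)
  have hint : IntegrableOn (fun x : ℝ => Real.exp (-|x| / b) / (2 * b)) (Set.Ioi s) :=
    IntegrableOn.congr_fun ((integrableOn_exp_mul_Ioi hneg s).div_const _) hcongr.symm
      measurableSet_Ioi
  rw [measureReal_def, laplace, withDensity_apply _ measurableSet_Ioi,
    ← ofReal_integral_eq_lintegral_ofReal hint (Filter.Eventually.of_forall fun x => by positivity),
    ENNReal.toReal_ofReal (integral_nonneg fun x => by positivity),
    setIntegral_congr_fun measurableSet_Ioi hcongr, integral_div, integral_exp_mul_Ioi hneg]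
  rw [show -b⁻¹ * s = -s / b by ring]
  field_simp

theorem laplace_real_Iio {b s : ℝ} (hb : 0 < b) (hs : 0 ≤ s) :
    (laplace b).real (Set.Iio (-s)) = Real.exp (-s / b) / 2 := by
  rw [← laplace_real_Ioi hb hs, measureReal_def, measureReal_def, laplace,
    withDensity_apply _ measurableSet_Iio, withDensity_apply _ measurableSet_Ioi]
  congr 1
  have h := (Measure.measurePreserving_neg (volume : Measure ℝ)).setLIntegral_comp_preimage
    (s := Set.Ioi s) (f := fun x => ENNReal.ofReal (Real.exp (-|x| / b) / (2 * b)))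
    measurableSet_Ioi (by fun_prop)
  rw [← h]
  simp

/-- Privacy of the Laplace mechanism for one real-valued query. -/
theorem laplace_le_map_add {b : ℝ} (hb : 0 < b) (δ : ℝ) :
    laplace b ≤ ENNReal.ofReal (Real.exp (|δ| / b)) • (laplace b).map (fun x => x + δ) := by
  refine Measure.le_iff.2 fun S hS => ?_
  have hm : Measurable fun x : ℝ => x + δ := by fun_prop
  rw [Measure.smul_apply, Measure.map_apply hm hS, laplace, withDensity_apply _ hS,
    withDensity_apply _ (hm hS), smul_eq_mul]
  have h := (measurePreserving_add_right (volume : Measure ℝ) δ).setLIntegral_comp_preimage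
    (s := S) (f := fun x => ENNReal.ofReal (Real.exp (-|x - δ| / b) / (2 * b))) hS (by fun_prop)
  simp only [add_sub_cancel_right] at h
  rw [h, ← lintegral_const_mul _ (by fun_prop)]
  refine lintegral_mono fun x => ?_
  rw [← ENNReal.ofReal_mul (Real.exp_pos _).le]
  refine ENNReal.ofReal_le_ofReal ?_
  rw [← mul_div_assoc, ← Real.exp_add, ← add_div]
  gcongr
  have := abs_add_le x (-δ)
  rw [abs_neg, ← sub_eq_add_neg] at this
  linarith

/-- A product measure, with one factor split off. -/
theorem infinitePi_eq_map_update {ι : Type*} [DecidableEq ι] {X : ι → Type*}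
    [∀ i, MeasurableSpace (X i)] (μ ν : ∀ i, Measure (X i)) [∀ i, IsProbabilityMeasure (μ i)]
    [∀ i, IsProbabilityMeasure (ν i)] (p : ι) (h : ∀ i, i ≠ p → μ i = ν i) :
    Measure.infinitePi μ = ((μ p).prod (Measure.infinitePi ν)).map
      (fun x => Function.update x.2 p x.1) := by
  refine (Measure.eq_infinitePi μ fun s t ht => ?_).symm
  have hm : Measurable fun x : X p × (∀ i, X i) => Function.update x.2 p x.1 := by
    refine measurable_pi_lambda _ fun i => ?_
    rcases eq_or_ne i p with rfl | hi
    · simpa using measurable_fst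
    · simp only [Function.update_of_ne hi]
      fun_prop
  rw [Measure.map_apply hm (.pi s.countable_toSet fun _ _ => ht _)]
  have hpre : (fun x : X p × (∀ i, X i) => Function.update x.2 p x.1) ⁻¹' ((s : Set ι).pi t) =
      (if p ∈ s then t p else Set.univ) ×ˢ ((s.erase p : Finset ι) : Set ι).pi t := by
    ext x
    simp only [Set.mem_preimage, Set.mem_pi, Set.mem_prod, Finset.mem_coe, Finset.mem_erase]
    constructor
    · intro hx
      refine ⟨?_, fun i hi => by simpa [Function.update_of_ne hi.1] using hx i hi.2⟩
      split_ifs with hp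
      · simpa using hx p hp
      · trivial
    · rintro ⟨h1, h2⟩ i hi
      rcases eq_or_ne i p with rfl | hip
      · simpa [hi] using h1
      · simpa [Function.update_of_ne hip] using h2 i ⟨hip, hi⟩
  rw [hpre, Measure.prod_prod, Measure.infinitePi_pi _ (fun i _ => ht i)]
  have hprod : ∏ i ∈ s.erase p, ν i (t i) = ∏ i ∈ s.erase p, μ i (t i) :=
    Finset.prod_congr rfl fun i hi => by rw [h i (Finset.ne_of_mem_erase hi)]
  rw [hprod]
  by_cases hp : p ∈ s
  · rw [if_pos hp, Finset.mul_prod_erase s (fun i => μ i (t i)) hp]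
  · rw [if_neg hp, measure_univ, one_mul, Finset.erase_eq_of_notMem hp]

theorem noise_scale_pos {ε : ℝ} (hε : 0 < ε) (k : ℕ) : 0 < 2 / (ε * 2 ^ k) := by positivity

theorem isProbabilityMeasure_noise {ε : ℝ} (hε : 0 < ε) (K : ℕ) (p : Fin K × ℕ) :
    IsProbabilityMeasure (laplace (2 / (ε * 2 ^ p.2))) :=
  isProbabilityMeasure_laplace (noise_scale_pos hε _)

theorem isProbabilityMeasure_noiseLaw {ε : ℝ} (hε : 0 < ε) (K : ℕ) :
    IsProbabilityMeasure (noiseLaw K ε) := by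
  have := isProbabilityMeasure_noise hε K
  rw [noiseLaw]
  infer_instance

/-- Shifting one noise variable `Z (a, k)` by at most `2 / 2 ^ k` changes probabilities by a factor
of at most `exp ε`. -/
theorem noiseLaw_real_le_shift {K : ℕ} {ε : ℝ} (hε : 0 < ε) (p : Fin K × ℕ) {δ : ℝ}
    (hδ : |δ| ≤ 2 / 2 ^ p.2) {S : Set (Fin K × ℕ → ℝ)} (hS : MeasurableSet S) :
    (noiseLaw K ε).real S ≤ Real.exp ε * (noiseLaw K ε).real {Z | Z + Pi.single p δ ∈ S} := by
  have := isProbabilityMeasure_noise hε K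
  have := isProbabilityMeasure_noiseLaw hε K
  set lap : Fin K × ℕ → Measure ℝ := fun q => laplace (2 / (ε * 2 ^ q.2)) with hlap
  set ν : Fin K × ℕ → Measure ℝ :=
    fun q => (lap q).map (fun x => x + (Pi.single p δ : Fin K × ℕ → ℝ) q) with hν
  have : ∀ q, IsProbabilityMeasure (ν q) := fun q =>
    Measure.isProbabilityMeasure_map (by fun_prop)
  have hmap : (noiseLaw K ε).map (fun Z => Z + Pi.single p δ) = Measure.infinitePi ν := by
    have := Measure.infinitePi_map_pi lap
      (f := fun q x => x + (Pi.single p δ : Fin K × ℕ → ℝ) q) (fun q => by fun_prop)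
    exact this
  have hone : ∀ q, q ≠ p → lap q = ν q := by
    intro q hq
    simp [hν, Pi.single_eq_of_ne hq]
  have hle : lap p ≤ ENNReal.ofReal (Real.exp ε) • ν p := by
    refine (laplace_le_map_add (noise_scale_pos hε p.2) δ).trans ?_
    simp only [hν, Pi.single_eq_same, hlap]
    refine Measure.le_iff.2 fun A _ => ?_
    rw [Measure.smul_apply, Measure.smul_apply, smul_eq_mul, smul_eq_mul]
    gcongr
    rw [div_div_eq_mul_div, div_le_iff₀ (by norm_num)]
    rw [le_div_iff₀ (by positivity)] at hδ
    nlinarith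
  have key : noiseLaw K ε ≤
      ENNReal.ofReal (Real.exp ε) • (noiseLaw K ε).map (fun Z => Z + Pi.single p δ) := by
    have hm : Measurable fun x : ℝ × (Fin K × ℕ → ℝ) => Function.update x.2 p x.1 := by
      refine measurable_pi_lambda _ fun i => ?_
      rcases eq_or_ne i p with rfl | hi
      · simpa using measurable_fst
      · simp only [Function.update_of_ne hi]
        fun_prop
    -- The original and the shifted law differ only in factor `p`, so both are images, under the
    -- same map, of a product with the same second factor. The one-dimensional comparison of the
    -- first factors then carries over.
    have e1 := infinitePi_eq_map_update lap ν p hone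
    have e2 := infinitePi_eq_map_update ν ν p (fun _ _ => rfl)
    rw [hmap, e2, show noiseLaw K ε = Measure.infinitePi lap from rfl, e1, ← Measure.map_smul,
      ← Measure.prod_smul_left]
    exact Measure.map_mono (Measure.prod_mono hle le_rfl) hm
  have h := key S
  have hshift : Measurable fun Z : Fin K × ℕ → ℝ => Z + Pi.single p δ := by fun_prop
  rw [Measure.smul_apply, smul_eq_mul, Measure.map_apply hshift hS] at h
  have h' := ENNReal.toReal_mono (by finiteness) h
  rwa [ENNReal.toReal_mul, ENNReal.toReal_ofReal (Real.exp_pos _).le] at h'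

theorem noiseLaw_real_gt {K : ℕ} {ε : ℝ} (hε : 0 < ε) (p : Fin K × ℕ) {s : ℝ} (hs : 0 ≤ s) :
    (noiseLaw K ε).real {Z | s < Z p} = Real.exp (-(s * (ε * 2 ^ p.2 / 2))) / 2 := by
  have := isProbabilityMeasure_noise hε K
  have h := (measurePreserving_eval_infinitePi
    (fun q : Fin K × ℕ => laplace (2 / (ε * 2 ^ q.2))) p).measureReal_preimage
    (s := Set.Ioi s) measurableSet_Ioi.nullMeasurableSet
  rw [laplace_real_Ioi (noise_scale_pos hε _) hs] at h
  refine h.trans ?_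
  congr 2
  field_simp

theorem noiseLaw_real_lt {K : ℕ} {ε : ℝ} (hε : 0 < ε) (p : Fin K × ℕ) {s : ℝ} (hs : 0 ≤ s) :
    (noiseLaw K ε).real {Z | Z p < -s} = Real.exp (-(s * (ε * 2 ^ p.2 / 2))) / 2 := by
  have := isProbabilityMeasure_noise hε K
  have h := (measurePreserving_eval_infinitePi
    (fun q : Fin K × ℕ => laplace (2 / (ε * 2 ^ q.2))) p).measureReal_preimage
    (s := Set.Iio (-s)) measurableSet_Iio.nullMeasurableSet
  rw [laplace_real_Iio (noise_scale_pos hε _) hs] at h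
  refine h.trans ?_
  congr 2
  field_simp

/-! ### Independent Bernoulli rewards -/

/-- The Bernoulli distribution of mean `p`. -/
def bernoulliLaw (p : ℝ) : Measure Bool :=
  ENNReal.ofReal p • Measure.dirac true + ENNReal.ofReal (1 - p) • Measure.dirac false

theorem bernoulliLaw_singleton (p : ℝ) (b : Bool) :
    bernoulliLaw p {b} = ENNReal.ofReal (bernoulliMass p b) := by
  cases b <;> simp [bernoulliLaw, bernoulliMass]

theorem isProbabilityMeasure_bernoulliLaw {p : ℝ} (hp : p ∈ Set.Icc (0 : ℝ) 1) :
    IsProbabilityMeasure (bernoulliLaw p) := by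
  refine ⟨?_⟩
  simp [bernoulliLaw, ← ENNReal.ofReal_add hp.1 (sub_nonneg.2 hp.2)]

theorem bernoulliMass_nonneg {p : ℝ} (hp : p ∈ Set.Icc (0 : ℝ) 1) (b : Bool) :
    0 ≤ bernoulliMass p b := by
  cases b
  · simpa [bernoulliMass] using hp.2
  · simpa [bernoulliMass] using hp.1

theorem rewardValue_mem (b : Bool) : rewardValue b ∈ Set.Icc (0 : ℝ) 1 := by
  cases b <;> simp [rewardValue]

theorem integral_bernoulliLaw {p : ℝ} (hp : p ∈ Set.Icc (0 : ℝ) 1) (f : Bool → ℝ) :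
    ∫ b, f b ∂(bernoulliLaw p) = p * f true + (1 - p) * f false := by
  have h := isProbabilityMeasure_bernoulliLaw hp
  rw [integral_fintype Integrable.of_finite]
  simp [measureReal_def, bernoulliLaw_singleton, bernoulliMass, ENNReal.toReal_ofReal hp.1,
    ENNReal.toReal_ofReal (sub_nonneg.2 hp.2)]

/-! ### Chernoff bounds for sums of independent Bernoulli variables. -/

section Chernoff

variable {ι : Type*} {μ : ι → ℝ} {s : Finset ι} {p : ℝ}

/-- Law of independent Bernoulli variables of means `μ i`. -/
def bernoulliPi (μ : ι → ℝ) : Measure (ι → Bool) := Measure.infinitePi fun i => bernoulliLaw (μ i)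

theorem isProbabilityMeasure_bernoulliPi (hμ : ∀ i, μ i ∈ Set.Icc (0 : ℝ) 1) :
    IsProbabilityMeasure (bernoulliPi μ) := by
  have := fun i => isProbabilityMeasure_bernoulliLaw (hμ i)
  rw [bernoulliPi]
  infer_instance

theorem bernoulliPi_real_forall (hμ : ∀ i, μ i ∈ Set.Icc (0 : ℝ) 1) (s : Finset ι) (b : ι → Bool) :
    (bernoulliPi μ).real {ω | ∀ i ∈ s, ω i = b i} = ∏ i ∈ s, bernoulliMass (μ i) (b i) := by
  have := fun i => isProbabilityMeasure_bernoulliLaw (hμ i)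
  have h : {ω : ι → Bool | ∀ i ∈ s, ω i = b i} = (s : Set ι).pi fun i => {b i} := by
    ext ω
    simp
  rw [h, measureReal_def, bernoulliPi, Measure.infinitePi_pi _ (fun i _ => measurableSet_singleton _),
    ENNReal.toReal_prod]
  refine Finset.prod_congr rfl fun i _ => ?_
  rw [bernoulliLaw_singleton, ENNReal.toReal_ofReal (bernoulliMass_nonneg (hμ i) _)]

theorem mgf_sum_rewardValue (hμ : ∀ i, μ i ∈ Set.Icc (0 : ℝ) 1) (hs : ∀ i ∈ s, μ i = p) (t : ℝ) :
    ProbabilityTheory.mgf (fun ω => ∑ i ∈ s, rewardValue (ω i)) (bernoulliPi μ) t =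
      (1 - p + p * Real.exp t) ^ s.card := by
  have := fun i => isProbabilityMeasure_bernoulliLaw (hμ i)
  have hind : ProbabilityTheory.iIndepFun (fun i (ω : ι → Bool) => rewardValue (ω i))
      (bernoulliPi μ) :=
    ProbabilityTheory.iIndepFun_infinitePi (P := fun i => bernoulliLaw (μ i))
      (X := fun _ b => rewardValue b) fun _ => measurable_of_finite _
  have hmeas : ∀ i, Measurable fun ω : ι → Bool => rewardValue (ω i) := fun i =>
    (measurable_of_finite rewardValue).comp (measurable_pi_apply i)
  have h := hind.mgf_sum (t := t) hmeas s
  have e : (∑ i ∈ s, fun ω : ι → Bool => rewardValue (ω i)) =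
      fun ω => ∑ i ∈ s, rewardValue (ω i) := by
    ext ω
    simp
  rw [← e, h]
  refine Finset.prod_eq_pow_card fun i hi => ?_
  rw [ProbabilityTheory.mgf]
  have h2 := (measurePreserving_eval_infinitePi (fun i => bernoulliLaw (μ i)) i)
  have h3 := integral_map (μ := bernoulliPi μ) (φ := fun ω => ω i)
    (measurable_pi_apply i).aemeasurable (f := fun b : Bool => Real.exp (t * rewardValue b))
    (measurable_of_finite _).aestronglyMeasurable
  rw [← h3, show (bernoulliPi μ).map (fun ω => ω i) = bernoulliLaw (μ i) from h2.map_eq,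
    integral_bernoulliLaw (hμ i), hs i hi]
  simp [rewardValue]
  ring

theorem sum_rewardValue_mem (ω : ι → Bool) (s : Finset ι) :
    ∑ i ∈ s, rewardValue (ω i) ∈ Set.Icc (0 : ℝ) s.card := by
  refine ⟨Finset.sum_nonneg fun i _ => (rewardValue_mem _).1, ?_⟩
  simpa using Finset.sum_le_card_nsmul s (fun i => rewardValue (ω i)) 1
    fun i _ => (rewardValue_mem _).2

theorem measurable_sum_rewardValue (s : Finset ι) :
    Measurable fun ω : ι → Bool => ∑ i ∈ s, rewardValue (ω i) :=
  Finset.measurable_sum s fun i _ =>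
    (measurable_of_finite rewardValue).comp (measurable_pi_apply i)

theorem integrable_exp_sum_rewardValue (hμ : ∀ i, μ i ∈ Set.Icc (0 : ℝ) 1) (s : Finset ι) (t : ℝ) :
    Integrable (fun ω => Real.exp (t * ∑ i ∈ s, rewardValue (ω i))) (bernoulliPi μ) := by
  have := isProbabilityMeasure_bernoulliPi hμ
  exact ProbabilityTheory.integrable_exp_mul_of_mem_Icc (measurable_sum_rewardValue s).aemeasurable
    (Filter.Eventually.of_forall fun ω => sum_rewardValue_mem ω s)

/-- The value of the Chernoff bound at its optimal parameter. -/
theorem exp_mul_pow_eq_exp_klReal {m q : ℝ} (hm : 0 < m) (hm1 : m < 1) (hq : 0 < q) (hq1 : q < 1)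
    (n : ℕ) :
    Real.exp (-Real.log (m * (1 - q) / (q * (1 - m))) * (n * m)) *
      (1 - q + q * Real.exp (Real.log (m * (1 - q) / (q * (1 - m))))) ^ n =
      Real.exp (-(n * klReal m q)) := by
  have h1 : 0 < 1 - q := by linarith
  have h2 : 0 < 1 - m := by linarith
  rw [Real.exp_log (by positivity)]
  have e : 1 - q + q * (m * (1 - q) / (q * (1 - m))) = Real.exp (Real.log ((1 - q) / (1 - m))) := by
    rw [Real.exp_log (by positivity)]
    field_simp
    ring
  rw [e, ← Real.exp_nat_mul, ← Real.exp_add]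
  congr 1
  rw [klReal, Real.log_div (by positivity) (by positivity), Real.log_mul hm.ne' h1.ne',
    Real.log_mul hq.ne' h2.ne', Real.log_div h1.ne' h2.ne', Real.log_div hm.ne' hq.ne',
    Real.log_div h2.ne' h1.ne']
  ring

/-- Chernoff bound for the lower tail. -/
theorem bernoulliPi_real_sum_le {m : ℝ} (hμ : ∀ i, μ i ∈ Set.Icc (0 : ℝ) 1)
    (hs : ∀ i ∈ s, μ i = p) (hm : 0 ≤ m) (hmp : m < p) (hp1 : p < 1) :
    (bernoulliPi μ).real {ω | ∑ i ∈ s, rewardValue (ω i) ≤ s.card * m} ≤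
      Real.exp (-(s.card * klReal m p)) := by
  have hprob := isProbabilityMeasure_bernoulliPi hμ
  have hp0 : 0 < p := hm.trans_lt hmp
  rcases hm.eq_or_lt with rfl | hm
  -- At `m = 0` the optimal Chernoff parameter is infinite, but the event says that all rewards
  -- vanish and its probability is explicit.
  · have hsub : {ω : ι → Bool | ∑ i ∈ s, rewardValue (ω i) ≤ s.card * (0 : ℝ)} ⊆
        {ω | ∀ i ∈ s, ω i = (fun _ => false) i} := by
      intro ω hω i hi
      have h1 : ∑ i ∈ s, rewardValue (ω i) ≤ 0 := by simpa using hω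
      have h2 := (Finset.sum_eq_zero_iff_of_nonneg fun j _ => (rewardValue_mem (ω j)).1).1
        (le_antisymm h1 (sum_rewardValue_mem ω s).1) i hi
      by_contra hne
      simp [rewardValue, Bool.eq_true_of_not_eq_false hne] at h2
    refine (measureReal_mono hsub).trans (le_of_eq ?_)
    rw [bernoulliPi_real_forall hμ, Finset.prod_congr rfl fun i hi => by rw [hs i hi]]
    have h1 : 0 < 1 - p := by linarith
    have : klReal 0 p = -Real.log (1 - p) := by simp [klReal]
    rw [this, mul_neg, neg_neg, Real.exp_nat_mul, Real.exp_log h1]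
    simp [bernoulliMass]
  · have hm1 : m < 1 := hmp.trans hp1
    have ht : Real.log (m * (1 - p) / (p * (1 - m))) ≤ 0 := by
      refine Real.log_nonpos ?_ ?_
      · exact div_nonneg (mul_nonneg hm.le (by linarith)) (mul_nonneg hp0.le (by linarith))
      · rw [div_le_one (mul_pos hp0 (by linarith))]
        nlinarith
    refine (ProbabilityTheory.measure_le_le_exp_mul_mgf (s.card * m) ht
      (integrable_exp_sum_rewardValue hμ s _)).trans (le_of_eq ?_)
    rw [mgf_sum_rewardValue hμ hs]
    exact exp_mul_pow_eq_exp_klReal hm hm1 hp0 hp1 _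

/-- Bernstein-type bound for the upper tail. -/
theorem bernoulliPi_real_le_sum {r : ℝ} (hμ : ∀ i, μ i ∈ Set.Icc (0 : ℝ) 1)
    (hs : ∀ i ∈ s, μ i = p) (hs0 : s.Nonempty) (hpr : p < r) (hr : r < 1) :
    (bernoulliPi μ).real {ω | s.card * r ≤ ∑ i ∈ s, rewardValue (ω i)} ≤
      Real.exp (-(s.card * ((r - p) ^ 2 / (4 * (r * (1 - p)))))) := by
  have hprob := isProbabilityMeasure_bernoulliPi hμ
  obtain ⟨i₀, hi₀⟩ := hs0
  have hp0 : 0 ≤ p := hs i₀ hi₀ ▸ (hμ i₀).1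
  rcases hp0.eq_or_lt with rfl | hp
  · have hsub : {ω : ι → Bool | s.card * r ≤ ∑ i ∈ s, rewardValue (ω i)} ⊆
        ⋃ i ∈ s, {ω | ∀ j ∈ ({i} : Finset ι), ω j = (fun _ => true) j} := by
      intro ω hω
      by_contra hne
      simp only [Finset.mem_singleton, forall_eq, Set.mem_iUnion, exists_prop, not_exists,
        not_and, Set.mem_ofPred_eq, Bool.not_eq_true] at hne
      have : ∑ i ∈ s, rewardValue (ω i) = 0 :=
        Finset.sum_eq_zero fun i hi => by simp [rewardValue, hne i hi]
      have hω' : s.card * r ≤ ∑ i ∈ s, rewardValue (ω i) := hω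
      rw [this] at hω'
      have : (0 : ℝ) < s.card := by exact_mod_cast Finset.card_pos.2 ⟨i₀, hi₀⟩
      nlinarith
    refine (measureReal_mono hsub (measure_ne_top _ _)).trans
      ((measureReal_biUnion_finset_le _ _).trans ?_)
    rw [Finset.sum_eq_zero]
    · exact (Real.exp_pos _).le
    · intro i hi
      rw [bernoulliPi_real_forall hμ, Finset.prod_singleton, hs i hi]
      simp [bernoulliMass]
  · have hp1 : p < 1 := hpr.trans hr
    have hr0 : 0 < r := hp.trans hpr
    have ht : 0 ≤ Real.log (r * (1 - p) / (p * (1 - r))) := by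
      refine Real.log_nonneg ?_
      rw [one_le_div (mul_pos hp (by linarith))]
      nlinarith
    refine (ProbabilityTheory.measure_ge_le_exp_mul_mgf (s.card * r) ht
      (integrable_exp_sum_rewardValue hμ s _)).trans ?_
    rw [mgf_sum_rewardValue hμ hs, exp_mul_pow_eq_exp_klReal hr0 hr hp hp1]
    have := sq_div_le_klReal hp hpr.le hr
    gcongr

/-- Chernoff bound in terms of the relative entropy of the empirical mean. -/
theorem bernoulliPi_real_klBer_gt {b : ℝ} (hμ : ∀ i, μ i ∈ Set.Icc (0 : ℝ) 1)
    (hs : ∀ i ∈ s, μ i = p) (hs0 : s.Nonempty) :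
    (bernoulliPi μ).real {ω | (∑ i ∈ s, rewardValue (ω i)) / s.card < p ∧
      (b : EReal) < klBer ((∑ i ∈ s, rewardValue (ω i)) / s.card) p} ≤
      Real.exp (-(s.card * b)) := by
  have hprob := isProbabilityMeasure_bernoulliPi hμ
  have hn : (0 : ℝ) < s.card := by exact_mod_cast Finset.card_pos.2 hs0
  obtain ⟨i₀, hi₀⟩ := hs0
  have hp : p ∈ Set.Icc (0 : ℝ) 1 := hs i₀ hi₀ ▸ hμ i₀
  set A := {ω : ι → Bool | (∑ i ∈ s, rewardValue (ω i)) / s.card < p ∧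
      (b : EReal) < klBer ((∑ i ∈ s, rewardValue (ω i)) / s.card) p} with hA
  have hcount : ∀ ω : ι → Bool, ∃ j : ℕ, j ≤ s.card ∧ ∑ i ∈ s, rewardValue (ω i) = j := by
    intro ω
    refine ⟨(s.filter fun i => ω i = true).card, Finset.card_filter_le _ _, ?_⟩
    simp only [rewardValue]
    rw [Finset.sum_ite]
    simp
  rcases hp.2.eq_or_lt with rfl | hp1
  · have hsub : A ⊆ ⋃ i ∈ s, {ω | ∀ j ∈ ({i} : Finset ι), ω j = (fun _ => false) j} := by
      intro ω hω
      by_contra hne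
      simp only [Finset.mem_singleton, forall_eq, Set.mem_iUnion, exists_prop, not_exists,
        not_and, Set.mem_ofPred_eq, Bool.not_eq_false] at hne
      have : ∑ i ∈ s, rewardValue (ω i) = s.card := by
        rw [Finset.sum_congr rfl fun i hi => by rw [hne i hi]]
        simp [rewardValue]
      have hω' := hω.1
      rw [this, div_self hn.ne'] at hω'
      exact lt_irrefl _ hω'
    refine (measureReal_mono hsub (measure_ne_top _ _)).trans
      ((measureReal_biUnion_finset_le _ _).trans ?_)
    rw [Finset.sum_eq_zero]
    · exact (Real.exp_pos _).le
    · intro i hi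
      rw [bernoulliPi_real_forall hμ, Finset.prod_singleton, hs i hi]
      simp [bernoulliMass]
  classical
  -- The sum takes finitely many values. The event is contained in a lower tail at the largest
  -- admissible value, where the entropy still exceeds `b`; one application of the Chernoff bound
  -- suffices, with no union bound.
  set J := (Finset.range (s.card + 1)).filter fun j : ℕ =>
    (j : ℝ) / s.card < p ∧ (b : EReal) < klBer ((j : ℝ) / s.card) p with hJ
  have hmem : ∀ ω ∈ A, ∃ j ∈ J, ∑ i ∈ s, rewardValue (ω i) = (j : ℝ) := by
    intro ω hω
    obtain ⟨j, hj, he⟩ := hcount ω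
    refine ⟨j, Finset.mem_filter.2 ⟨Finset.mem_range.2 (by omega), ?_⟩, he⟩
    rw [← he]
    exact hω
  rcases J.eq_empty_or_nonempty with hJ0 | hJ0
  · have : A = ∅ := by
      refine Set.eq_empty_of_forall_notMem fun ω hω => ?_
      obtain ⟨j, hj, _⟩ := hmem ω hω
      simp [hJ0] at hj
    rw [this]
    simpa using (Real.exp_pos _).le
  · set j₀ := J.max' hJ0 with hj₀
    have hj₀J := (Finset.mem_filter.1 (J.max'_mem hJ0)).2
    rw [← hj₀] at hj₀J
    have hp0 : 0 < p := lt_of_le_of_lt (by positivity) hj₀J.1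
    have hsub : A ⊆ {ω | ∑ i ∈ s, rewardValue (ω i) ≤ s.card * ((j₀ : ℝ) / s.card)} := by
      intro ω hω
      obtain ⟨j, hj, he⟩ := hmem ω hω
      have := J.le_max' j hj
      rw [Set.mem_ofPred_eq, he, mul_div_cancel₀ _ hn.ne']
      exact_mod_cast this
    refine (measureReal_mono hsub).trans
      ((bernoulliPi_real_sum_le hμ hs (by positivity) hj₀J.1 hp1).trans ?_)
    have h2 := hj₀J.2
    rw [klBer_eq_klReal hp0 hp1, EReal.coe_lt_coe_iff] at h2
    gcongr

end Chernoff

/-! ### The memory of the algorithm along a sequence of actions -/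

section Run

variable {K : ℕ}

/-- The memory after `t` rounds in which the arms `a 0, …, a (t - 1)` were played. -/
def stateAlong (a : ℕ → Fin K) (r : ℕ → ℝ) : ℕ → State K
  | 0 => initialState K
  | t + 1 => updateState (stateAlong a r t) (a t) (r t)

theorem stateAlong_congr {a a' : ℕ → Fin K} {r r' : ℕ → ℝ} {t : ℕ} (ha : ∀ s < t, a s = a' s)
    (hr : ∀ s < t, r s = r' s) : stateAlong a r t = stateAlong a' r' t := by
  induction t with
  | zero => rfl
  | succ t ih =>
    rw [stateAlong, stateAlong, ih (fun s hs => ha s (by omega)) (fun s hs => hr s (by omega)),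
      ha t (by omega), hr t (by omega)]

theorem runState_eq_stateAlong {ε α : ℝ} {sel : (Fin K → ℝ) → Fin K} {Z : Fin K × ℕ → ℝ}
    {r : ℕ → ℝ} {a : ℕ → Fin K} {t : ℕ} (h : ∀ s < t, runAction ε α sel Z r s = a s) :
    runState ε α sel Z r t = stateAlong a r t := by
  induction t with
  | zero => rfl
  | succ t ih =>
    have h1 := ih fun s hs => h s (by omega)
    have h2 : chooseArm ε α sel Z (runState ε α sel Z r t) t = a t := h t (by omega)
    rw [runState, stateAlong, h2, h1]

/-- Along prescribed actions the memory no longer depends on the noise, so the event splits into one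
condition on the noise per round. Measurability and privacy both start from this form. -/
theorem forall_runAction_iff {ε α : ℝ} {sel : (Fin K → ℝ) → Fin K} {Z : Fin K × ℕ → ℝ}
    {r : ℕ → ℝ} {a : ℕ → Fin K} {T : ℕ} :
    (∀ t < T, runAction ε α sel Z r t = a t) ↔
      ∀ t < T, chooseArm ε α sel Z (stateAlong a r t) t = a t := by
  constructor
  · intro h t ht
    rw [← runState_eq_stateAlong fun s hs => h s (by omega)]
    exact h t ht
  · intro h t
    induction t using Nat.strong_induction_on with
    | _ t ih =>
      intro ht
      rw [runAction, runState_eq_stateAlong fun s hs => ih s hs (by omega)]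
      exact h t ht

theorem runState_congr {ε α : ℝ} {sel : (Fin K → ℝ) → Fin K} {Z : Fin K × ℕ → ℝ} {r r' : ℕ → ℝ}
    {t : ℕ} (hr : ∀ s < t, r s = r' s) : runState ε α sel Z r t = runState ε α sel Z r' t := by
  induction t with
  | zero => rfl
  | succ t ih =>
    rw [runState, runState, ih fun s hs => hr s (by omega), hr t (by omega)]

theorem updateState_pulls (s : State K) (b : Fin K) (x : ℝ) :
    (updateState s b x).pulls = Function.update s.pulls b (s.pulls b + 1) := rfl

theorem updateState_start (s : State K) (b : Fin K) (x : ℝ) :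
    (updateState s b x).start =
      if s.current = none then Function.update s.start b (s.pulls b) else s.start := rfl

theorem updateState_sum_of_ne (s : State K) {b c : Fin K} (x : ℝ) (h : c ≠ b) :
    (updateState s b x).sum c = s.sum c := by
  simp only [updateState, Function.update_of_ne h]
  split_ifs
  · exact Function.update_of_ne h _ _
  · rfl

theorem updateState_sum_self (s : State K) (b : Fin K) (x : ℝ) :
    (updateState s b x).sum b = if s.current = none then x else s.sum b + x := by
  simp only [updateState, Function.update_self]
  split_ifs <;> simp

theorem updateState_current (s : State K) (b : Fin K) (x : ℝ) :
    (updateState s b x).current =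
      if s.pulls b + 1 < 2 * (updateState s b x).start b then some b else none := rfl

theorem updateState_pulls_self (s : State K) (b : Fin K) (x : ℝ) :
    (updateState s b x).pulls b = s.pulls b + 1 := by
  simp [updateState_pulls]

theorem updateState_pulls_of_ne (s : State K) {b c : Fin K} (x : ℝ) (h : c ≠ b) :
    (updateState s b x).pulls c = s.pulls c := by
  simp [updateState_pulls, h]

theorem updateState_start_self (s : State K) (b : Fin K) (x : ℝ) :
    (updateState s b x).start b = if s.current = none then s.pulls b else s.start b := by
  rw [updateState_start]
  split_ifs <;> simp

theorem updateState_start_of_ne (s : State K) {b c : Fin K} (x : ℝ) (h : c ≠ b) :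
    (updateState s b x).start c = s.start c := by
  rw [updateState_start]
  split_ifs <;> simp [h]

theorem pulls_le_pulls (a : ℕ → Fin K) (r : ℕ → ℝ) (c : Fin K) :
    Monotone fun t => (stateAlong a r t).pulls c := by
  refine monotone_nat_of_le_succ fun t => ?_
  rw [stateAlong]
  rcases eq_or_ne c (a t) with rfl | h
  · rw [updateState_pulls_self]
    omega
  · rw [updateState_pulls_of_ne _ _ h]

theorem pulls_lt_pulls (a : ℕ → Fin K) (r : ℕ → ℝ) {s t : ℕ} (hst : s < t) :
    (stateAlong a r s).pulls (a s) < (stateAlong a r t).pulls (a s) := by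
  have h := pulls_le_pulls a r (a s) (Nat.succ_le_of_lt hst)
  have h2 : (stateAlong a r (s + 1)).pulls (a s) = (stateAlong a r s).pulls (a s) + 1 := by
    rw [stateAlong, updateState_pulls_self]
  simp only [Nat.succ_eq_add_one, h2] at h
  omega

theorem sum_pulls (a : ℕ → Fin K) (r : ℕ → ℝ) (t : ℕ) :
    ∑ c, (stateAlong a r t).pulls c = t := by
  induction t with
  | zero => simp [stateAlong, initialState]
  | succ t ih =>
    rw [stateAlong, updateState_pulls, Finset.sum_update_of_mem (Finset.mem_univ _)]
    rw [← Finset.add_sum_erase _ _ (Finset.mem_univ (a t)), Finset.erase_eq] at ih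
    omega

theorem pulls_eq_card (a : ℕ → Fin K) (r : ℕ → ℝ) (t : ℕ) (c : Fin K) :
    (stateAlong a r t).pulls c = ((Finset.range t).filter fun s => a s = c).card := by
  induction t with
  | zero => simp [stateAlong, initialState]
  | succ t ih =>
    rw [stateAlong, Finset.range_add_one, Finset.filter_insert]
    rcases eq_or_ne c (a t) with rfl | h
    · rw [updateState_pulls_self, if_pos rfl, Finset.card_insert_of_notMem (by simp), ih]
    · rw [updateState_pulls_of_ne _ _ h, if_neg (Ne.symm h), ih]

theorem pulls_congr (a : ℕ → Fin K) (r r' : ℕ → ℝ) (t : ℕ) :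
    (stateAlong a r t).pulls = (stateAlong a r' t).pulls := by
  ext c
  rw [pulls_eq_card, pulls_eq_card]

/-- Episodes are timed by play counts alone, so only the stored sums can react to a change of
rewards. -/
theorem start_current_congr (a : ℕ → Fin K) (r r' : ℕ → ℝ) (t : ℕ) :
    (stateAlong a r t).start = (stateAlong a r' t).start ∧
      (stateAlong a r t).current = (stateAlong a r' t).current := by
  induction t with
  | zero => exact ⟨rfl, rfl⟩
  | succ t ih =>
    have h : (stateAlong a r (t + 1)).start = (stateAlong a r' (t + 1)).start := by
      rw [stateAlong, stateAlong, updateState_start, updateState_start, ih.1, ih.2,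
        pulls_congr a r r' t]
    refine ⟨h, ?_⟩
    rw [stateAlong, stateAlong] at h ⊢
    rw [updateState_current, updateState_current, h, pulls_congr a r r' t]

/-- Outside a running episode an arm was played `2 ^ j` times, half of them in its last episode;
during an episode that was opened after `2 ^ j` plays, their number is less than `2 ^ (j + 1)`. -/
structure DoublingInvariant (s : State K) : Prop where
  idle : ∀ c, s.current ≠ some c →
    (s.pulls c = 0 ∧ s.start c = 0) ∨ ∃ j, s.pulls c = 2 ^ j ∧ s.start c = 2 ^ j / 2
  busy : ∀ c, s.current = some c → ∃ j, s.start c = 2 ^ j ∧ 2 ^ j < s.pulls c ∧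
    s.pulls c < 2 ^ (j + 1)

theorem DoublingInvariant.start_le_pulls {s : State K} (h : DoublingInvariant s) (c : Fin K) :
    s.start c ≤ s.pulls c := by
  by_cases hc : s.current = some c
  · obtain ⟨j, h1, h2, -⟩ := h.busy c hc
    omega
  · rcases h.idle c hc with h | ⟨j, h1, h2⟩ <;> omega

theorem DoublingInvariant.update {s : State K} (h : DoublingInvariant s) {b : Fin K}
    (hb : s.current = none ∨ s.current = some b) (x : ℝ) :
    DoublingInvariant (updateState s b x) := by
  have hother : ∀ c, c ≠ b → s.current ≠ some c := by
    rintro c hc h'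
    rcases hb with hb | hb
    · simp [hb] at h'
    · rw [hb, Option.some_inj] at h'
      exact hc h'.symm
  have hopen : ∃ n, (updateState s b x).start b = n ∧
      ((n = 0 ∧ s.pulls b = 0) ∨ ∃ j, n = 2 ^ j ∧ 2 ^ j ≤ s.pulls b ∧ s.pulls b < 2 ^ (j + 1)) := by
    refine ⟨_, rfl, ?_⟩
    rw [updateState_start_self]
    rcases hb with hb | hb
    · rw [if_pos hb]
      rcases h.idle b (by simp [hb]) with h | ⟨j, h1, h2⟩
      · exact Or.inl ⟨h.1, h.1⟩
      · exact Or.inr ⟨j, h1, h1.ge, by rw [h1, pow_succ]; have := Nat.two_pow_pos j; omega⟩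
    · rw [if_neg (by simp [hb])]
      obtain ⟨j, h1, h2, h3⟩ := h.busy b hb
      exact Or.inr ⟨j, h1, h2.le, h3⟩
  obtain ⟨n, hn, hcase⟩ := hopen
  have hcur := updateState_current s b x
  rw [hn] at hcur
  constructor
  · intro c hc
    rcases eq_or_ne c b with rfl | hcb
    · rw [updateState_pulls_self, hn]
      have hlt : ¬ s.pulls c + 1 < 2 * n := by
        intro hlt
        rw [if_pos hlt] at hcur
        exact hc hcur
      rcases hcase with ⟨h1, h2⟩ | ⟨j, h1, h2, h3⟩
      -- The very first play has `start = 0`, so the doubling test fails and its episode closes at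
      -- once; natural division makes `2 ^ 0 / 2 = 0` fit the same pattern.
      · exact Or.inr ⟨0, by simp [h2], by simp [h1]⟩
      · refine Or.inr ⟨j + 1, ?_, ?_⟩ <;> rw [pow_succ] at * <;> omega
    · rw [updateState_pulls_of_ne _ _ hcb, updateState_start_of_ne _ _ hcb]
      exact h.idle c (hother c hcb)
  · intro c hc
    rw [hcur] at hc
    split_ifs at hc with hlt
    obtain rfl : b = c := by simpa using hc
    rw [updateState_pulls_self, hn]
    rcases hcase with ⟨h1, h2⟩ | ⟨j, h1, h2, h3⟩
    · omega
    · exact ⟨j, h1, by omega, by rw [pow_succ]; omega⟩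

/-- The action sequence `a` is compatible with the initial phase and with the running episodes. -/
def Admissible (a : ℕ → Fin K) (r : ℕ → ℝ) (T : ℕ) : Prop :=
  ∀ t < T, (∀ h : t < K, a t = ⟨t, h⟩) ∧
    (K ≤ t → ∀ b, (stateAlong a r t).current = some b → a t = b)

theorem Admissible.of_chooseArm {ε α : ℝ} {sel : (Fin K → ℝ) → Fin K} {Z : Fin K × ℕ → ℝ}
    {r : ℕ → ℝ} {a : ℕ → Fin K} {T : ℕ}
    (h : ∀ t < T, chooseArm ε α sel Z (stateAlong a r t) t = a t) : Admissible a r T := by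
  intro t ht
  have h1 := h t ht
  constructor
  · intro hK
    rw [← h1, chooseArm, dif_pos hK]
  · intro hK b hb
    rw [← h1, chooseArm, dif_neg (by omega), hb]

theorem Admissible.initial {r : ℕ → ℝ} {a : ℕ → Fin K} {T : ℕ} (h : Admissible a r T) {t : ℕ}
    (ht : t ≤ T) (htK : t ≤ K) :
    (stateAlong a r t).current = none ∧
      ∀ c, (stateAlong a r t).pulls c = (if (c : ℕ) < t then 1 else 0) ∧
        (stateAlong a r t).start c = 0 := by
  induction t with
  | zero => simp [stateAlong, initialState]
  | succ t ih =>
    obtain ⟨h1, h2⟩ := ih (by omega) (by omega)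
    have ha := (h t (by omega)).1 (by omega)
    have hval : ((a t : Fin K) : ℕ) = t := by rw [ha]
    have hp : (stateAlong a r t).pulls (a t) = 0 := by
      rw [(h2 (a t)).1, if_neg (by omega)]
    have hs : ∀ c, (stateAlong a r (t + 1)).start c = 0 := by
      intro c
      rw [stateAlong]
      rcases eq_or_ne c (a t) with rfl | hc
      · rw [updateState_start_self, if_pos h1, hp]
      · rw [updateState_start_of_ne _ _ hc, (h2 c).2]
    refine ⟨?_, fun c => ⟨?_, hs c⟩⟩
    · have := hs (a t)
      rw [stateAlong] at this ⊢
      rw [updateState_current, this, if_neg (by omega)]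
    · rw [stateAlong]
      rcases eq_or_ne c (a t) with rfl | hc
      · rw [updateState_pulls_self, hp, if_pos (by omega)]
      · have hne : (c : ℕ) ≠ t := fun hct => hc (Fin.ext (hct.trans hval.symm))
        rw [updateState_pulls_of_ne _ _ hc, (h2 c).1]
        by_cases hlt : (c : ℕ) < t
        · rw [if_pos hlt, if_pos (by omega)]
        · rw [if_neg hlt, if_neg (by omega)]

theorem Admissible.current_eq {r : ℕ → ℝ} {a : ℕ → Fin K} {T : ℕ} (h : Admissible a r T) {t : ℕ}
    (ht : t < T) : (stateAlong a r t).current = none ∨ (stateAlong a r t).current = some (a t) := by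
  rcases lt_or_ge t K with hK | hK
  · exact Or.inl (h.initial ht.le hK.le).1
  · rcases hc : (stateAlong a r t).current with _ | b
    · exact Or.inl rfl
    · rw [(h t ht).2 hK b hc]
      exact Or.inr rfl

theorem Admissible.doublingInvariant {r : ℕ → ℝ} {a : ℕ → Fin K} {T : ℕ} (h : Admissible a r T)
    {t : ℕ} (ht : t ≤ T) : DoublingInvariant (stateAlong a r t) := by
  induction t with
  | zero => exact ⟨fun c _ => Or.inl ⟨rfl, rfl⟩, fun c hc => by simp [stateAlong, initialState] at hc⟩
  | succ t ih => exact (ih (by omega)).update (h.current_eq (by omega)) _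

theorem Admissible.pulls_pos {r : ℕ → ℝ} {a : ℕ → Fin K} {T : ℕ} (h : Admissible a r T)
    {t : ℕ} (ht : t ≤ T) (hK : K ≤ t) (c : Fin K) : 0 < (stateAlong a r t).pulls c := by
  have h1 := ((h.initial (hK.trans ht) le_rfl).2 c).1
  rw [if_pos c.2] at h1
  have h2 := pulls_le_pulls a r c hK
  simp only [h1] at h2
  omega

/-- Between two episodes every arm was played a power of two times. -/
theorem Admissible.pulls_eq_two_pow {r : ℕ → ℝ} {a : ℕ → Fin K} {T : ℕ} (h : Admissible a r T)
    {t : ℕ} (ht : t ≤ T) (hK : K ≤ t) (hc : (stateAlong a r t).current = none) (c : Fin K) :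
    ∃ j, (stateAlong a r t).pulls c = 2 ^ j ∧ (stateAlong a r t).start c = 2 ^ j / 2 := by
  rcases (h.doublingInvariant ht).idle c (by simp [hc]) with h' | h'
  · have := h.pulls_pos ht hK c
    omega
  · exact h'

/-- If the rewards of each arm are read off a table, the stored sum is that over the last
episode. -/
theorem Admissible.sum_eq {r : ℕ → ℝ} {a : ℕ → Fin K} {T : ℕ} (h : Admissible a r T)
    {Y : Fin K × ℕ → ℝ} (hY : ∀ t < T, r t = Y (a t, (stateAlong a r t).pulls (a t)))
    {t : ℕ} (ht : t ≤ T) (c : Fin K) :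
    (stateAlong a r t).sum c =
      ∑ i ∈ Finset.Ico ((stateAlong a r t).start c) ((stateAlong a r t).pulls c), Y (c, i) := by
  induction t generalizing c with
  | zero => simp [stateAlong, initialState]
  | succ t ih =>
    have hle := (h.doublingInvariant (t := t) (by omega)).start_le_pulls c
    have hr := hY t (by omega)
    rw [stateAlong]
    rcases eq_or_ne c (a t) with rfl | hc
    · rw [updateState_sum_self, updateState_start_self, updateState_pulls_self]
      split_ifs with hn
      · simp [hr]
      · rw [Finset.sum_Ico_succ_top hle, ih (by omega), hr]
    · rw [updateState_sum_of_ne _ _ hc, updateState_start_of_ne _ _ hc,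
        updateState_pulls_of_ne _ _ hc, ih (by omega)]

end Run

/-! ### Differential privacy: a changed reward acts as a shift of one noise variable. -/

section Privacy

variable {K : ℕ}

theorem measurable_chooseArm {ε α : ℝ} (hα : 0 < α) {sel : (Fin K → ℝ) → Fin K}
    (hsel : Measurable sel) (s : State K) (t : ℕ) :
    Measurable fun Z : Fin K × ℕ → ℝ => chooseArm ε α sel Z s t := by
  by_cases hK : t < K
  · simp only [chooseArm, dif_pos hK, measurable_const]
  · rcases hc : s.current with _ | b
    · simp only [chooseArm, dif_neg hK, hc]
      refine hsel.comp (measurable_pi_lambda _ fun c => ?_)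
      refine (monotone_klIndex hα _ _).measurable.comp ?_
      unfold privateMean
      fun_prop
    · simp only [chooseArm, dif_neg hK, hc, measurable_const]

/-- The noise for which the arms `a 0, …, a (T - 1)` are played. -/
def actionEvent (ε α : ℝ) (sel : (Fin K → ℝ) → Fin K) (a : ℕ → Fin K) (r : ℕ → ℝ) (T : ℕ) :
    Set (Fin K × ℕ → ℝ) := {Z | ∀ t < T, runAction ε α sel Z r t = a t}

theorem measurableSet_actionEvent {ε α : ℝ} (hα : 0 < α) {sel : (Fin K → ℝ) → Fin K}
    (hsel : Measurable sel) (a : ℕ → Fin K) (r : ℕ → ℝ) (T : ℕ) :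
    MeasurableSet (actionEvent ε α sel a r T) := by
  have : actionEvent ε α sel a r T =
      ⋂ t, ⋂ _ : t < T, {Z | chooseArm ε α sel Z (stateAlong a r t) t = a t} := by
    ext Z
    simp only [actionEvent, forall_runAction_iff, Set.mem_ofPred_eq, Set.mem_iInter]
  rw [this]
  exact MeasurableSet.iInter fun t => MeasurableSet.iInter fun _ =>
    measurable_chooseArm hα hsel _ _ (measurableSet_singleton (a t))

/-- Extension of a finite sequence by a default value. -/
def extendFin {β : Type*} {T : ℕ} (d : β) (f : Fin T → β) (n : ℕ) : β :=
  if h : n < T then f ⟨n, h⟩ else d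

theorem extendFin_apply {β : Type*} {T : ℕ} (d : β) (f : Fin T → β) (t : Fin T) :
    extendFin d f t = f t := by
  simp [extendFin]

theorem extendFin_of_lt {β : Type*} {T : ℕ} (d : β) (f : Fin T → β) {n : ℕ} (h : n < T) :
    extendFin d f n = f ⟨n, h⟩ := by
  simp [extendFin, h]

theorem adaPKLUCB_eq {ε α : ℝ} {sel : (Fin K → ℝ) → Fin K} {T : ℕ} (d : Fin K)
    (a : Fin T → Fin K) (r : Fin T → ℝ) :
    adaPKLUCB K ε α sel T a r =
      (noiseLaw K ε).real (actionEvent ε α sel (extendFin d a) (extendFin 0 r) T) := by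
  rw [adaPKLUCB]
  congr 1
  ext Z
  simp only [actionEvent, Set.mem_ofPred_eq]
  constructor
  · intro h t ht
    rw [extendFin_of_lt _ _ ht]
    exact h ⟨t, ht⟩
  · intro h t
    rw [← extendFin_apply d a t]
    exact h t t.2

/-- Changing the reward of round `j` changes only the sum of the episode that contains it. -/
theorem Admissible.sum_of_neighbouring {a : ℕ → Fin K} {r r' : ℕ → ℝ} {T j : ℕ}
    (h : Admissible a r T) (hr : ∀ t, t ≠ j → r t = r' t) {t : ℕ} (ht : t ≤ T) (c : Fin K) :
    (stateAlong a r' t).sum c = (stateAlong a r t).sum c +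
      if c = a j ∧ j < t ∧ (stateAlong a r t).start c ≤ (stateAlong a r j).pulls (a j) then
        r' j - r j else 0 := by
  induction t generalizing c with
  | zero => simp [stateAlong, initialState]
  | succ t ih =>
    have hle := (h.doublingInvariant (t := t) (by omega)).start_le_pulls c
    have ih' := ih (by omega)
    have hcur := (start_current_congr a r r' t).2
    rw [stateAlong, stateAlong]
    rcases eq_or_ne c (a t) with rfl | hc
    · rw [updateState_sum_self, updateState_sum_self, updateState_start_self, ← hcur]
      rcases eq_or_ne t j with rfl | htj
      · split_ifs with h1 h2 h2
        · ring
        · exact absurd ⟨rfl, by omega, le_rfl⟩ h2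
        · rw [ih', if_neg (by omega)]
          ring
        · exact absurd ⟨rfl, by omega, hle⟩ h2
      · rw [hr t htj]
        by_cases hn : (stateAlong a r t).current = none
        -- A new episode resets the sum. If round `j` was an earlier play of this arm, the count
        -- before it is strictly below the new start, so the correction disappears.
        · rw [if_pos hn, if_pos hn, if_pos hn, if_neg, add_zero]
          rintro ⟨h1, h2, h3⟩
          have h4 := pulls_lt_pulls a r (show j < t by omega)
          rw [h1] at h3
          omega
        · rw [if_neg hn, if_neg hn, if_neg hn, ih']
          have hlt : j < t + 1 ↔ j < t := by omega
          simp only [hlt]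
          ring
    · rw [updateState_sum_of_ne _ _ hc, updateState_sum_of_ne _ _ hc,
        updateState_start_of_ne _ _ hc, ih']
      congr 2
      apply propext
      constructor
      · rintro ⟨h1, h2, h3⟩
        exact ⟨h1, by omega, h3⟩
      · rintro ⟨h1, h2, h3⟩
        refine ⟨h1, ?_, h3⟩
        rcases Nat.lt_succ_iff_lt_or_eq.1 h2 with h4 | rfl
        · exact h4
        · exact absurd h1 hc

/-- The intervals `[2 ^ m / 2, 2 ^ m)` partition the play numbers, counted from 0, and the binary
length locates a play. Hence each reward enters exactly one private mean. -/
theorem two_pow_half_le_iff {i m : ℕ} (h : i < 2 ^ m) : 2 ^ m / 2 ≤ i ↔ m = Nat.size i := by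
  rcases m with _ | m
  · obtain rfl : i = 0 := by simpa using h
    simp
  · have h1 : 2 ^ (m + 1) / 2 = 2 ^ m := by
      rw [pow_succ]
      omega
    rw [h1, ← Nat.lt_size]
    have := Nat.size_le.2 h
    omega

/-- A change of one reward has the same effect as a shift of one noise variable. -/
theorem Admissible.chooseArm_of_neighbouring {ε α : ℝ} {sel : (Fin K → ℝ) → Fin K}
    {a : ℕ → Fin K} {r r' : ℕ → ℝ} {T j : ℕ} (h : Admissible a r T)
    (hr : ∀ t, t ≠ j → r t = r' t) (Z : Fin K × ℕ → ℝ) {t : ℕ} (ht : t < T) {k : ℕ}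
    (hk : k = Nat.size ((stateAlong a r j).pulls (a j))) :
    chooseArm ε α sel Z (stateAlong a r' t) t =
      chooseArm ε α sel
        (Z + Pi.single (a j, k) ((r' j - r j) / ((2 ^ k : ℕ) - (2 ^ k / 2 : ℕ) : ℝ)))
        (stateAlong a r t) t := by
  by_cases hK : t < K
  · simp only [chooseArm, dif_pos hK]
  have hcur := (start_current_congr a r r' t).2
  rcases hc : (stateAlong a r t).current with _ | b
  · rw [hc] at hcur
    simp only [chooseArm, dif_neg hK, hc, ← hcur]
    congr 1
    ext c
    rw [pulls_congr a r' r]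
    congr 1
    obtain ⟨m, hm, hm'⟩ := h.pulls_eq_two_pow ht.le (by omega) hc c
    rw [privateMean, privateMean, pulls_congr a r' r, ← (start_current_congr a r r' t).1,
      h.sum_of_neighbouring hr ht.le c, hm, hm', Nat.log_pow one_lt_two, Pi.add_apply]
    have hiff : (c = a j ∧ j < t ∧ 2 ^ m / 2 ≤ (stateAlong a r j).pulls (a j)) ↔
        (c, m) = (a j, k) := by
      rw [Prod.mk.injEq, hk]
      refine and_congr_right ?_
      rintro rfl
      constructor
      · rintro ⟨h1, h2⟩
        have h3 := pulls_lt_pulls a r h1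
        rw [hm] at h3
        exact (two_pow_half_le_iff h3).1 h2
      · intro h1
        have h3 : (stateAlong a r j).pulls (a j) < 2 ^ m := by
          rw [h1]
          exact Nat.lt_size_self _
        refine ⟨?_, (two_pow_half_le_iff h3).2 h1⟩
        by_contra! hjt
        have := pulls_le_pulls a r (a j) hjt
        simp only [hm] at this
        omega
    by_cases hcase : (c, m) = (a j, k)
    · rw [if_pos (hiff.2 hcase), hcase, Pi.single_eq_same]
      obtain ⟨rfl, rfl⟩ := Prod.mk.injEq _ _ _ _ ▸ hcase
      ring
    · rw [if_neg (fun h' => hcase (hiff.1 h')), Pi.single_eq_of_ne hcase]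
      ring
  · rw [hc] at hcur
    simp only [chooseArm, dif_neg hK, hc, ← hcur]

theorem half_le_two_pow_sub_half (k : ℕ) :
    (2 : ℝ) ^ k / 2 ≤ ((2 ^ k : ℕ) : ℝ) - ((2 ^ k / 2 : ℕ) : ℝ) := by
  have : ((2 ^ k / 2 : ℕ) : ℝ) ≤ ((2 ^ k : ℕ) : ℝ) / 2 := Nat.cast_div_le
  push_cast at this ⊢
  linarith

/-- AdaP-KLUCB is differentially private. -/
theorem isGlobalDP_adaPKLUCB {ε α : ℝ} {sel : (Fin K → ℝ) → Fin K} (hε : 0 < ε) (hα : 0 < α)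
    (hsel : Measurable sel) (T : ℕ) : IsGlobalDP ε (adaPKLUCB K ε α sel T) := by
  rintro a r r' hr hr' ⟨j, -, hj⟩
  have hprob := isProbabilityMeasure_noiseLaw hε K
  -- The arm `sel 0` is a mere default beyond the horizon; the existence of `sel` already forces `K
  -- > 0`.
  rw [adaPKLUCB_eq (sel 0), adaPKLUCB_eq (sel 0)]
  set a₁ := extendFin (sel 0) a
  set r₁ := extendFin 0 r with hr₁
  set r₂ := extendFin 0 r' with hr₂
  -- If no noise produces these actions, the left side is zero. Otherwise a single such noise
  -- certifies that the actions respect the episode structure.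
  rcases (actionEvent ε α sel a₁ r₁ T).eq_empty_or_nonempty with h0 | ⟨Z₀, hZ₀⟩
  · rw [h0]
    simpa using mul_nonneg (Real.exp_pos ε).le measureReal_nonneg
  have hadm : Admissible a₁ r₁ T := Admissible.of_chooseArm (forall_runAction_iff.1 hZ₀)
  have hne : ∀ t, t ≠ (j : ℕ) → r₁ t = r₂ t := by
    intro t ht
    simp only [hr₁, hr₂, extendFin]
    split_ifs with h
    · exact hj _ fun h' => ht (by rw [← h'])
    · rfl
  set k := Nat.size ((stateAlong a₁ r₁ j).pulls (a₁ j)) with hk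
  set δ := (r₂ j - r₁ j) / ((2 ^ k : ℕ) - (2 ^ k / 2 : ℕ) : ℝ) with hδ
  have hδ' : |δ| ≤ 2 / 2 ^ k := by
    have h1 := half_le_two_pow_sub_half k
    have h2 : (0 : ℝ) < 2 ^ k / 2 := by positivity
    have h3 : |r₂ j - r₁ j| ≤ 1 := by
      rw [hr₁, hr₂, extendFin_apply, extendFin_apply, abs_le]
      constructor <;> linarith [(hr j).1, (hr j).2, (hr' j).1, (hr' j).2]
    rw [hδ, abs_div, abs_of_pos (h2.trans_le h1), show (2 : ℝ) / 2 ^ k = 1 / (2 ^ k / 2) by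
      field_simp]
    exact div_le_div₀ zero_le_one h3 h2 h1
  have hset : {Z | Z + Pi.single (a₁ j, k) δ ∈ actionEvent ε α sel a₁ r₁ T} =
      actionEvent ε α sel a₁ r₂ T := by
    ext Z
    simp only [actionEvent, Set.mem_ofPred_eq, forall_runAction_iff]
    refine forall₂_congr fun t ht => ?_
    rw [hadm.chooseArm_of_neighbouring hne Z ht hk]
  have := noiseLaw_real_le_shift hε (a₁ j, k) hδ'
    (measurableSet_actionEvent (ε := ε) hα hsel a₁ r₁ T)
  rwa [hset] at this

end Privacy

section Regret

variable {K : ℕ}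

/-! ### Regret as a sum over the numbers of plays -/

/-- The last reward arrives after the last decision and cannot influence it; this is what permits
integrating it out. -/
theorem actionEvent_congr {ε α : ℝ} {sel : (Fin K → ℝ) → Fin K} {a a' : ℕ → Fin K} {r r' : ℕ → ℝ}
    {T : ℕ} (ha : ∀ t < T, a t = a' t) (hr : ∀ t, t + 1 < T → r t = r' t) :
    actionEvent ε α sel a r T = actionEvent ε α sel a' r' T := by
  ext Z
  simp only [actionEvent, Set.mem_ofPred_eq]
  refine forall₂_congr fun t ht => ?_
  rw [runAction, runAction, runState_congr fun s hs => hr s (by omega), ha t ht]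

theorem extendFin_snoc_of_lt {β : Type*} {T : ℕ} (d : β) (f : Fin T → β) (x : β) {n : ℕ}
    (h : n < T) : extendFin d (Fin.snoc f x : Fin (T + 1) → β) n = extendFin d f n := by
  rw [extendFin_of_lt _ _ h, extendFin_of_lt _ _ (Nat.lt_succ_of_lt h)]
  exact Fin.snoc_castSucc (α := fun _ => β) x f ⟨n, h⟩

theorem extendFin_snoc_self {β : Type*} {T : ℕ} (d : β) (f : Fin T → β) (x : β) :
    extendFin d (Fin.snoc f x : Fin (T + 1) → β) T = x := by
  rw [extendFin_of_lt _ _ (Nat.lt_succ_self T)]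
  exact Fin.snoc_last (α := fun _ => β) x f

/-- The default value of `extendFin c a` doubles as the action of the last round. -/
theorem adaPKLUCB_snoc {ε α : ℝ} {sel : (Fin K → ℝ) → Fin K} {T : ℕ}
    (a : Fin T → Fin K) (r : Fin T → ℝ) (c : Fin K) (x : ℝ) :
    adaPKLUCB K ε α sel (T + 1) (Fin.snoc a c) (Fin.snoc r x) =
      (noiseLaw K ε).real (actionEvent ε α sel (extendFin c a) (extendFin 0 r) (T + 1)) := by
  rw [adaPKLUCB_eq c]
  congr 1
  refine actionEvent_congr (fun t ht => ?_) fun t ht => extendFin_snoc_of_lt _ _ _ (by omega)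
  rcases Nat.lt_succ_iff_lt_or_eq.1 ht with h | rfl
  · exact extendFin_snoc_of_lt _ _ _ h
  · rw [extendFin_snoc_self, extendFin, dif_neg (lt_irrefl _)]

theorem sum_adaPKLUCB_snoc {ε α : ℝ} (hε : 0 < ε) (hα : 0 < α) {sel : (Fin K → ℝ) → Fin K}
    (hsel : Measurable sel) {T : ℕ} (a : Fin T → Fin K) (r : Fin T → ℝ) :
    ∑ c, (noiseLaw K ε).real (actionEvent ε α sel (extendFin c a) (extendFin 0 r) (T + 1)) =
      adaPKLUCB K ε α sel T a r := by
  have hprob := isProbabilityMeasure_noiseLaw hε K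
  rw [adaPKLUCB_eq (sel 0), ← measureReal_biUnion_finset]
  · congr 1
    ext Z
    simp only [Finset.mem_univ, Set.iUnion_true, Set.mem_iUnion, actionEvent, Set.mem_ofPred_eq]
    constructor
    · rintro ⟨c, hc⟩ t ht
      rw [hc t (by omega), extendFin_of_lt _ _ ht, extendFin_of_lt _ _ ht]
    · intro h
      refine ⟨runAction ε α sel Z (extendFin 0 r) T, fun t ht => ?_⟩
      rcases Nat.lt_succ_iff_lt_or_eq.1 ht with h' | rfl
      · rw [h t h', extendFin_of_lt _ _ h', extendFin_of_lt _ _ h']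
      · rw [extendFin, dif_neg (lt_irrefl _)]
  · intro c _ c' _ hcc
    refine Set.disjoint_left.2 fun Z hZ hZ' => hcc ?_
    have h1 := hZ T (by omega)
    have h2 := hZ' T (by omega)
    rw [h1] at h2
    simpa [extendFin] using h2
  · exact fun c _ => measurableSet_actionEvent hα hsel _ _ _

theorem rewardValue_snoc {T : ℕ} (b : Fin T → Bool) (β : Bool) :
    (fun t => rewardValue ((Fin.snoc b β : Fin (T + 1) → Bool) t)) =
      (Fin.snoc (fun t => rewardValue (b t)) (rewardValue β) : Fin (T + 1) → ℝ) := by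
  ext t
  refine Fin.lastCases ?_ (fun t => ?_) t <;> simp

/-- Expectations over `T + 1` rounds, with the last round integrated out. -/
theorem sum_historyProb_succ {ε α : ℝ} {sel : (Fin K → ℝ) → Fin K} {T : ℕ} (μ : Fin K → ℝ)
    (F : (Fin (T + 1) → Fin K) → (Fin (T + 1) → Bool) → ℝ) :
    ∑ a, ∑ b, historyProb (adaPKLUCB K ε α sel (T + 1)) μ a b * F a b =
      ∑ a : Fin T → Fin K, ∑ b : Fin T → Bool, ∑ c : Fin K,
        (noiseLaw K ε).real (actionEvent ε α sel (extendFin c a)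
          (extendFin 0 fun t => rewardValue (b t)) (T + 1)) *
        (∏ t, bernoulliMass (μ (a t)) (b t)) *
        ∑ β, bernoulliMass (μ c) β * F (Fin.snoc a c) (Fin.snoc b β) := by
  rw [← (Fin.snocEquiv fun _ : Fin (T + 1) => Fin K).sum_comp, Fintype.sum_prod_type,
    Finset.sum_comm]
  refine Finset.sum_congr rfl fun a _ => ?_
  rw [Finset.sum_comm (s := (Finset.univ : Finset (Fin T → Bool)))]
  refine Finset.sum_congr rfl fun c _ => ?_
  rw [← (Fin.snocEquiv fun _ : Fin (T + 1) => Bool).sum_comp, Fintype.sum_prod_type,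
    Finset.sum_comm]
  refine Finset.sum_congr rfl fun b _ => ?_
  rw [Finset.mul_sum]
  refine Finset.sum_congr rfl fun β _ => ?_
  have e1 : (Fin.snocEquiv fun _ : Fin (T + 1) => Fin K) (c, a) = Fin.snoc a c := rfl
  have e2 : (Fin.snocEquiv fun _ : Fin (T + 1) => Bool) (β, b) = Fin.snoc b β := rfl
  rw [e1, e2, historyProb, rewardValue_snoc, adaPKLUCB_snoc, Fin.prod_univ_castSucc]
  simp only [Fin.snoc_castSucc, Fin.snoc_last]
  ring

/-- Total mass one and the martingale identity for rewards centred at the mean of the played arm. In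
both, summing over the last reward and then over the last action reduces to one round fewer. -/
theorem sum_historyProb {ε α : ℝ} (hε : 0 < ε) (hα : 0 < α) {sel : (Fin K → ℝ) → Fin K}
    (hsel : Measurable sel) (μ : Fin K → ℝ) (T : ℕ) :
    ∑ a, ∑ b, historyProb (adaPKLUCB K ε α sel T) μ a b = 1 ∧
      ∑ a, ∑ b, historyProb (adaPKLUCB K ε α sel T) μ a b *
        ∑ t, (rewardValue (b t) - μ (a t)) = 0 := by
  induction T with
  | zero =>
    have hprob := isProbabilityMeasure_noiseLaw hε K
    simp [historyProb, adaPKLUCB]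
  | succ T ih =>
    have hmass : ∀ p : ℝ, ∑ β, bernoulliMass p β = 1 := fun p => by simp [bernoulliMass]
    constructor
    · have h := sum_historyProb_succ (ε := ε) (α := α) (sel := sel) (T := T) μ fun _ _ => 1
      simp only [mul_one, hmass] at h
      rw [h, ← ih.1]
      refine Finset.sum_congr rfl fun a _ => Finset.sum_congr rfl fun b _ => ?_
      rw [← Finset.sum_mul, sum_adaPKLUCB_snoc hε hα hsel, historyProb]
    · rw [sum_historyProb_succ]
      refine Eq.trans ?_ ih.2
      refine Finset.sum_congr rfl fun a _ => Finset.sum_congr rfl fun b _ => ?_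
      have h : ∀ c, ∑ β, bernoulliMass (μ c) β *
          ∑ t, (rewardValue ((Fin.snoc b β : Fin (T + 1) → Bool) t) -
            μ ((Fin.snoc a c : Fin (T + 1) → Fin K) t)) =
          ∑ t, (rewardValue (b t) - μ (a t)) := by
        intro c
        simp only [Fin.sum_univ_castSucc, Fin.snoc_castSucc, Fin.snoc_last, Fintype.sum_bool,
          bernoulliMass, rewardValue]
        simp
        ring
      simp only [h]
      rw [← Finset.sum_mul, ← Finset.sum_mul, sum_adaPKLUCB_snoc hε hα hsel, historyProb]

/-- The regret is the expected sum of the gaps of the arms that are played. -/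
theorem regret_eq_sum_gap {ε α : ℝ} (hε : 0 < ε) (hα : 0 < α) {sel : (Fin K → ℝ) → Fin K}
    (hsel : Measurable sel) (μ : Fin K → ℝ) (T : ℕ) :
    regret (adaPKLUCB K ε α sel T) μ =
      ∑ c, gap μ c * ∑ a, ∑ b, historyProb (adaPKLUCB K ε α sel T) μ a b *
        (Finset.univ.filter fun t => a t = c).card := by
  obtain ⟨h1, h2⟩ := sum_historyProb hε hα hsel μ T
  have h3 : ∀ a : Fin T → Fin K, ∀ b : Fin T → Bool,
      ∑ c, gap μ c * (historyProb (adaPKLUCB K ε α sel T) μ a b *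
        ((Finset.univ.filter fun t => a t = c).card : ℝ)) =
      historyProb (adaPKLUCB K ε α sel T) μ a b * (T * bestMean μ) -
        historyProb (adaPKLUCB K ε α sel T) μ a b * ∑ t, rewardValue (b t) +
        historyProb (adaPKLUCB K ε α sel T) μ a b * ∑ t, (rewardValue (b t) - μ (a t)) := by
    intro a b
    have h4 : ∑ c, gap μ c * ((Finset.univ.filter fun t => a t = c).card : ℝ) =
        ∑ t, gap μ (a t) := by
      rw [← Finset.sum_fiberwise_of_maps_to (s := Finset.univ) (t := Finset.univ) (g := a)
        (fun _ _ => Finset.mem_univ _)]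
      refine Finset.sum_congr rfl fun c _ => ?_
      rw [Finset.sum_congr rfl (g := fun _ => gap μ c) fun t ht => by
        rw [(Finset.mem_filter.1 ht).2], Finset.sum_const, nsmul_eq_mul, mul_comm]
    have h5 : ∑ t, gap μ (a t) = T * bestMean μ - ∑ t, μ (a t) := by
      simp [gap, Finset.sum_sub_distrib]
    calc _ = historyProb (adaPKLUCB K ε α sel T) μ a b *
          ∑ c, gap μ c * ((Finset.univ.filter fun t => a t = c).card : ℝ) := by
          rw [Finset.mul_sum]
          exact Finset.sum_congr rfl fun c _ => by ring
      _ = _ := by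
        rw [h4, h5, Finset.sum_sub_distrib]
        ring
  have h6 : ∀ c, gap μ c * ∑ a, ∑ b, historyProb (adaPKLUCB K ε α sel T) μ a b *
        ((Finset.univ.filter fun t => a t = c).card : ℝ) =
      ∑ a, ∑ b, gap μ c * (historyProb (adaPKLUCB K ε α sel T) μ a b *
        ((Finset.univ.filter fun t => a t = c).card : ℝ)) := by
    intro c
    rw [Finset.mul_sum]
    exact Finset.sum_congr rfl fun a _ => Finset.mul_sum _ _ _
  have h7 : ∑ a, ∑ b, historyProb (adaPKLUCB K ε α sel T) μ a b * (T * bestMean μ) =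
      T * bestMean μ := by
    rw [Finset.sum_congr rfl fun a _ => (Finset.sum_mul _ _ _).symm, ← Finset.sum_mul, h1, one_mul]
  symm
  calc _ = ∑ a, ∑ b, ∑ c, gap μ c * (historyProb (adaPKLUCB K ε α sel T) μ a b *
        ((Finset.univ.filter fun t => a t = c).card : ℝ)) := by
        rw [Finset.sum_congr rfl fun c _ => h6 c, Finset.sum_comm]
        exact Finset.sum_congr rfl fun a _ => Finset.sum_comm
    _ = _ := by
      simp only [Finset.sum_sub_distrib] at h2
      simp only [h3, Finset.sum_add_distrib, Finset.sum_sub_distrib, h2, h7, regret, add_zero]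

/-! ### The table of rewards -/

/-- Law of the noise and of a table of rewards, in which the reward of the `(i + 1)`-th play of
arm `c` is the entry `(c, i)`. -/
def tableLaw (ε : ℝ) (μ : Fin K → ℝ) : Measure ((Fin K × ℕ → ℝ) × (Fin K × ℕ → Bool)) :=
  (noiseLaw K ε).prod (bernoulliPi fun i => μ i.1)

theorem isProbabilityMeasure_tableLaw {ε : ℝ} (hε : 0 < ε) {μ : Fin K → ℝ}
    (hμ : ∀ a, μ a ∈ Set.Icc (0 : ℝ) 1) : IsProbabilityMeasure (tableLaw ε μ) := by
  have := isProbabilityMeasure_noiseLaw hε K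
  have := isProbabilityMeasure_bernoulliPi (μ := fun i : Fin K × ℕ => μ i.1) fun i => hμ i.1
  rw [tableLaw]
  infer_instance

/-- The memory along actions `a` and binary rewards `b`. -/
abbrev boolState (a : ℕ → Fin K) (b : ℕ → Bool) (t : ℕ) : State K :=
  stateAlong a (fun n => rewardValue (b n)) t

/-- The noise and the tables that lead to the actions `a` and the rewards `b`. -/
def tableEvent (ε α : ℝ) (sel : (Fin K → ℝ) → Fin K) (a : ℕ → Fin K) (b : ℕ → Bool) (T : ℕ) :
    Set ((Fin K × ℕ → ℝ) × (Fin K × ℕ → Bool)) :=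
  actionEvent ε α sel a (fun n => rewardValue (b n)) T ×ˢ
    {X | ∀ t < T, X (a t, (boolState a b t).pulls (a t)) = b t}

theorem measurableSet_tableEvent {ε α : ℝ} (hα : 0 < α) {sel : (Fin K → ℝ) → Fin K}
    (hsel : Measurable sel) (a : ℕ → Fin K) (b : ℕ → Bool) (T : ℕ) :
    MeasurableSet (tableEvent ε α sel a b T) := by
  refine (measurableSet_actionEvent hα hsel _ _ _).prod ?_
  have : {X : Fin K × ℕ → Bool | ∀ t < T, X (a t, (boolState a b t).pulls (a t)) = b t} =
      ⋂ t, ⋂ _ : t < T, (fun X : Fin K × ℕ → Bool =>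
        X (a t, (boolState a b t).pulls (a t))) ⁻¹' {b t} := by
    ext X
    simp
  rw [this]
  exact MeasurableSet.iInter fun t => MeasurableSet.iInter fun _ =>
    measurable_pi_apply _ (measurableSet_singleton _)

/-- Noise and table determine the whole run, so events of different histories are disjoint and their
probabilities may be added. -/
theorem eq_of_mem_tableEvent {ε α : ℝ} {sel : (Fin K → ℝ) → Fin K} {a a' : ℕ → Fin K}
    {b b' : ℕ → Bool} {T : ℕ} {ω : (Fin K × ℕ → ℝ) × (Fin K × ℕ → Bool)}
    (h : ω ∈ tableEvent ε α sel a b T) (h' : ω ∈ tableEvent ε α sel a' b' T) {t : ℕ} (ht : t < T) :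
    a t = a' t ∧ b t = b' t := by
  induction t using Nat.strong_induction_on with
  | _ t ih =>
    have ha : a t = a' t := by
      rw [← h.1 t ht, ← h'.1 t ht, runAction, runAction,
        runState_congr fun s hs => by rw [(ih s hs (by omega)).2]]
    refine ⟨ha, ?_⟩
    rw [← h.2 t ht, ← h'.2 t ht, ha, boolState, boolState,
      stateAlong_congr (a' := a') (r' := fun n => rewardValue (b' n))
        (fun s hs => (ih s hs (by omega)).1) (fun s hs => by rw [(ih s hs (by omega)).2])]

/-- Play counts increase strictly, so different rounds read different table entries. The reward
constraint is therefore a cylinder with one factor per round, independent of the noise. -/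
theorem tableLaw_real_tableEvent {ε α : ℝ} {sel : (Fin K → ℝ) → Fin K} {μ : Fin K → ℝ}
    (hμ : ∀ a, μ a ∈ Set.Icc (0 : ℝ) 1) {T : ℕ} (d : Fin K) (a : Fin T → Fin K) (b : Fin T → Bool) :
    (tableLaw ε μ).real (tableEvent ε α sel (extendFin d a) (extendFin false b) T) =
      historyProb (adaPKLUCB K ε α sel T) μ a b := by
  have := isProbabilityMeasure_bernoulliPi (μ := fun i : Fin K × ℕ => μ i.1) fun i => hμ i.1
  have hb : (fun n => rewardValue (extendFin false b n)) =
      extendFin 0 fun t => rewardValue (b t) := by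
    ext n
    simp only [extendFin]
    split_ifs
    · rfl
    · simp [rewardValue]
  rw [tableLaw, tableEvent, measureReal_prod_prod, historyProb, adaPKLUCB_eq d, hb]
  congr 1
  set i : Fin T → Fin K × ℕ := fun t =>
    (a t, (boolState (extendFin d a) (extendFin false b) t).pulls (a t)) with hi
  have hinj : Function.Injective i := by
    have hlt : ∀ s t : Fin T, s < t → i s ≠ i t := by
      intro s t hst h
      have h1 := congrArg Prod.fst h
      have h2 := congrArg Prod.snd h
      simp only [hi, boolState] at h1 h2
      have h3 := pulls_lt_pulls (extendFin d a)
        (fun n => rewardValue (extendFin false b n)) (s := s) (t := t) hst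
      rw [extendFin_apply] at h3
      rw [← h1] at h2
      omega
    intro s t h
    rcases lt_trichotomy s t with h' | h' | h'
    · exact absurd h (hlt s t h')
    · exact h'
    · exact absurd h.symm (hlt t s h')
  have hset : {X : Fin K × ℕ → Bool | ∀ t < T, X (extendFin d a t,
      (boolState (extendFin d a) (extendFin false b) t).pulls (extendFin d a t)) =
        extendFin false b t} =
      {X | ∀ j ∈ Finset.univ.image i, X j = Function.extend i b (fun _ => false) j} := by
    ext X
    simp only [Set.mem_ofPred_eq, Finset.mem_image, Finset.mem_univ, true_and,
      forall_exists_index, forall_apply_eq_imp_iff, hinj.extend_apply]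
    constructor
    · intro h t
      have := h t t.2
      rwa [extendFin_apply, extendFin_apply] at this
    · intro h t ht
      have := h ⟨t, ht⟩
      rwa [extendFin_of_lt _ _ ht, extendFin_of_lt _ _ ht]
  rw [hset, bernoulliPi_real_forall (μ := fun j : Fin K × ℕ => μ j.1) fun j => hμ j.1,
    Finset.prod_image fun _ _ _ _ h => hinj h]
  exact Finset.prod_congr rfl fun t _ => by rw [hinj.extend_apply]

/-- Probabilities in the canonical bandit model are bounded by those in the table model. -/
theorem sum_historyProb_le {ε α : ℝ} (hε : 0 < ε) (hα : 0 < α) {sel : (Fin K → ℝ) → Fin K}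
    (hsel : Measurable sel) {μ : Fin K → ℝ} (hμ : ∀ a, μ a ∈ Set.Icc (0 : ℝ) 1) {T : ℕ}
    (S : Finset ((Fin T → Fin K) × (Fin T → Bool)))
    (E : Set ((Fin K × ℕ → ℝ) × (Fin K × ℕ → Bool)))
    (hE : ∀ p ∈ S, tableEvent ε α sel (extendFin (sel 0) p.1) (extendFin false p.2) T ⊆ E) :
    ∑ p ∈ S, historyProb (adaPKLUCB K ε α sel T) μ p.1 p.2 ≤ (tableLaw ε μ).real E := by
  have := isProbabilityMeasure_tableLaw hε hμ
  rw [Finset.sum_congr rfl fun p _ => (tableLaw_real_tableEvent hμ (sel 0) p.1 p.2).symm,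
    ← measureReal_biUnion_finset]
  · exact measureReal_mono (Set.iUnion₂_subset hE) (measure_ne_top _ _)
  · intro p _ p' _ hpp
    refine Set.disjoint_left.2 fun ω hω hω' => hpp (Prod.ext ?_ ?_) <;> ext1 t
    · have := (eq_of_mem_tableEvent hω hω' t.2).1
      rwa [extendFin_apply, extendFin_apply] at this
    · have := (eq_of_mem_tableEvent hω hω' t.2).2
      rwa [extendFin_apply, extendFin_apply] at this
  · exact fun p _ => measurableSet_tableEvent hα hsel _ _ _

/-- Round `n` up to a power of two: `2 ^ clog n` is 1 plus the sum of the smaller powers, and these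
are exactly the powers below `n`. -/
theorem le_one_add_sum_two_pow (n T : ℕ) (hn : n ≤ T) :
    n ≤ 1 + ∑ k ∈ (Finset.range T).filter fun k => 2 ^ k < n, 2 ^ k := by
  rcases Nat.lt_or_ge n 2 with h | h
  · omega
  have h1 : Finset.range (Nat.clog 2 n) ⊆ (Finset.range T).filter fun k => 2 ^ k < n := by
    intro k hk
    have h2 : 2 ^ k < n := (Nat.lt_clog_iff_pow_lt one_lt_two).1 (Finset.mem_range.1 hk)
    have h3 : k < 2 ^ k := Nat.lt_two_pow_self
    exact Finset.mem_filter.2 ⟨Finset.mem_range.2 (by omega), h2⟩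
  have h2 := Finset.sum_le_sum_of_subset (f := fun k => 2 ^ k) h1
  have h3 : n ≤ 2 ^ Nat.clog 2 n := Nat.le_pow_clog one_lt_two n
  have h4 : ∑ k ∈ Finset.range (Nat.clog 2 n), 2 ^ k = 2 ^ Nat.clog 2 n - 1 := by
    have := Nat.geomSum_eq (le_refl 2) (Nat.clog 2 n)
    simpa using this
  omega

theorem card_filter_extendFin {T : ℕ} (d : Fin K) (a : Fin T → Fin K) (r : ℕ → ℝ) (c : Fin K) :
    (stateAlong (extendFin d a) r T).pulls c = (Finset.univ.filter fun t => a t = c).card := by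
  rw [pulls_eq_card, Finset.card_filter, Finset.card_filter, Finset.sum_range]
  exact Finset.sum_congr rfl fun t _ => by rw [extendFin_apply]

/-- Bound of the expected number of plays of an arm by the probabilities that it is played more
than `2 ^ k` times. -/
theorem expected_pulls_le {ε α : ℝ} (hε : 0 < ε) (hα : 0 < α) {sel : (Fin K → ℝ) → Fin K}
    (hsel : Measurable sel) {μ : Fin K → ℝ} (hμ : ∀ a, μ a ∈ Set.Icc (0 : ℝ) 1) (T : ℕ)
    (c : Fin K) (E : ℕ → Set ((Fin K × ℕ → ℝ) × (Fin K × ℕ → Bool)))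
    (hE : ∀ k a b, 2 ^ k < T → 2 ^ k < (boolState a b T).pulls c →
      tableEvent ε α sel a b T ⊆ E k) :
    ∑ a, ∑ b, historyProb (adaPKLUCB K ε α sel T) μ a b *
        ((Finset.univ.filter fun t => a t = c).card : ℝ) ≤
      1 + ∑ k ∈ (Finset.range T).filter fun k => 2 ^ k < T, 2 ^ k * (tableLaw ε μ).real (E k) := by
  have hnonneg : ∀ (a : Fin T → Fin K) (b : Fin T → Bool),
      0 ≤ historyProb (adaPKLUCB K ε α sel T) μ a b := fun a b => by
    rw [← tableLaw_real_tableEvent hμ (sel 0)]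
    exact measureReal_nonneg
  have hcard : ∀ a : Fin T → Fin K, (Finset.univ.filter fun t => a t = c).card ≤ T := fun a => by
    simpa using Finset.card_filter_le (Finset.univ : Finset (Fin T)) fun t => a t = c
  set R := (Finset.range T).filter fun k => 2 ^ k < T with hR
  set n : (Fin T → Fin K) → ℕ := fun a => (Finset.univ.filter fun t => a t = c).card with hn
  have hcount : ∀ a : Fin T → Fin K,
      (n a : ℝ) ≤ 1 + ∑ k ∈ R, if 2 ^ k < n a then (2 : ℝ) ^ k else 0 := by
    intro a
    have h := le_one_add_sum_two_pow (n a) T (hcard a)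
    have h2 : (Finset.range T).filter (fun k => 2 ^ k < n a) =
        R.filter fun k => 2 ^ k < n a := by
      ext k
      have := hcard a
      simp only [hR, Finset.mem_filter]
      constructor
      · rintro ⟨h1, h2⟩
        exact ⟨⟨h1, h2.trans_le this⟩, h2⟩
      · rintro ⟨⟨h1, -⟩, h2⟩
        exact ⟨h1, h2⟩
    rw [h2, Finset.sum_filter] at h
    exact_mod_cast h
  calc _ ≤ ∑ a, ∑ b, historyProb (adaPKLUCB K ε α sel T) μ a b *
        (1 + ∑ k ∈ R, if 2 ^ k < n a then (2 : ℝ) ^ k else 0) :=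
        Finset.sum_le_sum fun a _ => Finset.sum_le_sum fun b _ =>
          mul_le_mul_of_nonneg_left (hcount a) (hnonneg a b)
    _ = 1 + ∑ k ∈ R, 2 ^ k * ∑ p ∈ Finset.univ.filter
          (fun p : (Fin T → Fin K) × (Fin T → Bool) => 2 ^ k < n p.1),
          historyProb (adaPKLUCB K ε α sel T) μ p.1 p.2 := by
      simp only [mul_add, mul_one, Finset.sum_add_distrib, (sum_historyProb hε hα hsel μ T).1]
      congr 1
      rw [← Fintype.sum_prod_type' fun (a : Fin T → Fin K) (b : Fin T → Bool) =>
        historyProb (adaPKLUCB K ε α sel T) μ a b *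
          ∑ k ∈ R, if 2 ^ k < n a then (2 : ℝ) ^ k else 0]
      simp only [Finset.mul_sum]
      rw [Finset.sum_comm]
      refine Finset.sum_congr rfl fun k _ => ?_
      rw [Finset.sum_filter]
      refine Finset.sum_congr rfl fun p _ => ?_
      split_ifs <;> ring
    _ ≤ _ := by
      gcongr with k hk
      refine sum_historyProb_le hε hα hsel hμ _ _ fun p hp => ?_
      refine hE k _ _ (Finset.mem_filter.1 hk).2 ?_
      rw [boolState, card_filter_extendFin]
      exact (Finset.mem_filter.1 hp).2

end Regret

section Episodes

variable {K : ℕ}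

/-! ### Why a suboptimal arm is played -/

/-- The plays of an arm in its episode that ends after `2 ^ k` plays. -/
def episode (k : ℕ) : Finset ℕ := Finset.Ico (2 ^ k / 2) (2 ^ k)

/-- Mean reward of arm `c` over the episode that ends after `2 ^ k` plays. -/
def episodeMean (X : Fin K × ℕ → Bool) (c : Fin K) (k : ℕ) : ℝ :=
  (∑ i ∈ episode k, rewardValue (X (c, i))) / (((2 ^ k : ℕ) : ℝ) - ((2 ^ k / 2 : ℕ) : ℝ))

theorem card_episode (k : ℕ) :
    ((episode k).card : ℝ) = ((2 ^ k : ℕ) : ℝ) - ((2 ^ k / 2 : ℕ) : ℝ) := by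
  rw [episode, Nat.card_Ico, Nat.cast_sub (Nat.div_le_self _ _)]

theorem half_le_card_episode (k : ℕ) : (2 : ℝ) ^ k / 2 ≤ (episode k).card := by
  rw [card_episode]
  exact half_le_two_pow_sub_half k

theorem card_episode_pos (k : ℕ) : (0 : ℝ) < (episode k).card :=
  lt_of_lt_of_le (by positivity) (half_le_card_episode k)

theorem card_episode_le (k : ℕ) : ((episode k).card : ℝ) ≤ 2 ^ k := by
  rw [card_episode]
  push_cast
  have : (0 : ℝ) ≤ ((2 ^ k / 2 : ℕ) : ℝ) := Nat.cast_nonneg _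
  linarith

/-- The table entries of an episode. -/
def episodeEntries (c : Fin K) (k : ℕ) : Finset (Fin K × ℕ) := {c} ×ˢ episode k

theorem card_episodeEntries (c : Fin K) (k : ℕ) : (episodeEntries c k).card = (episode k).card := by
  simp [episodeEntries]

theorem episodeEntries_nonempty (c : Fin K) (k : ℕ) : (episodeEntries c k).Nonempty := by
  rw [← Finset.card_pos, card_episodeEntries]
  exact_mod_cast card_episode_pos k

theorem episodeMean_eq (X : Fin K × ℕ → Bool) (c : Fin K) (k : ℕ) :
    episodeMean X c k = (∑ i ∈ episodeEntries c k, rewardValue (X i)) /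
      (episodeEntries c k).card := by
  rw [card_episodeEntries, card_episode, episodeMean, episodeEntries, Finset.sum_product,
    Finset.sum_singleton]

theorem episodeMean_mem (X : Fin K × ℕ → Bool) (c : Fin K) (k : ℕ) :
    episodeMean X c k ∈ Set.Icc (0 : ℝ) 1 := by
  rw [episodeMean_eq]
  have h := sum_rewardValue_mem X (episodeEntries c k)
  exact ⟨div_nonneg h.1 (Nat.cast_nonneg _), div_le_one_of_le₀ h.2 (Nat.cast_nonneg _)⟩

/-- The index of arm `o` may be below its mean, in round `n` or later, when it was played `2 ^ j`
times. -/
def underEvent (ε α : ℝ) (μ : Fin K → ℝ) (o : Fin K) (j n : ℕ) :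
    Set ((Fin K × ℕ → ℝ) × (Fin K × ℕ → Bool)) :=
  {ω | ω.1 (o, j) < -(α * Real.log n / (ε * (1 / 2 * (2 ^ j : ℕ))))} ∪
    {ω | episodeMean ω.2 o j < μ o ∧
      ((α * Real.log n / (1 / 2 * (2 ^ j : ℕ)) : ℝ) : EReal) < klBer (episodeMean ω.2 o j) (μ o)}

/-- The index of arm `c` is at least `m`, in some round up to `T`, when it was played `2 ^ k`
times. -/
def overEvent (ε α : ℝ) (m : ℝ) (T : ℕ) (c : Fin K) (k : ℕ) :
    Set ((Fin K × ℕ → ℝ) × (Fin K × ℕ → Bool)) :=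
  {ω | ∃ n, 1 ≤ n ∧ n ≤ T ∧ m ≤ klIndex ε α n (2 ^ k) (episodeMean ω.2 c k + ω.1 (c, k))}

theorem tableLaw_real_fst {ε : ℝ} {μ : Fin K → ℝ} (hμ : ∀ a, μ a ∈ Set.Icc (0 : ℝ) 1)
    (S : Set (Fin K × ℕ → ℝ)) :
    (tableLaw ε μ).real {ω | ω.1 ∈ S} = (noiseLaw K ε).real S := by
  have := isProbabilityMeasure_bernoulliPi (μ := fun i : Fin K × ℕ => μ i.1) fun i => hμ i.1
  have h : {ω : (Fin K × ℕ → ℝ) × (Fin K × ℕ → Bool) | ω.1 ∈ S} = S ×ˢ Set.univ := by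
    ext
    simp
  rw [h, tableLaw, measureReal_prod_prod, probReal_univ, mul_one]

theorem tableLaw_real_snd {ε : ℝ} (hε : 0 < ε) {μ : Fin K → ℝ}
    (hμ : ∀ a, μ a ∈ Set.Icc (0 : ℝ) 1) (S : Set (Fin K × ℕ → Bool)) :
    (tableLaw ε μ).real {ω | ω.2 ∈ S} = (bernoulliPi fun i : Fin K × ℕ => μ i.1).real S := by
  have := isProbabilityMeasure_bernoulliPi (μ := fun i : Fin K × ℕ => μ i.1) fun i => hμ i.1
  have := isProbabilityMeasure_noiseLaw hε K
  have h : {ω : (Fin K × ℕ → ℝ) × (Fin K × ℕ → Bool) | ω.2 ∈ S} = Set.univ ×ˢ S := by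
    ext
    simp
  rw [h, tableLaw, measureReal_prod_prod, probReal_univ, one_mul]

/-- The two bonuses in the index are calibrated so that each tail has exponent `α log n`: the
Laplace tail contributes with factor `1 / 2`, the Chernoff bound over at least `2 ^ j / 2` rewards
with factor 1. -/
theorem tableLaw_real_underEvent {ε α : ℝ} (hε : 0 < ε) (hα : 0 < α) {μ : Fin K → ℝ}
    (hμ : ∀ a, μ a ∈ Set.Icc (0 : ℝ) 1) (o : Fin K) (j n : ℕ) :
    (tableLaw ε μ).real (underEvent ε α μ o j n) ≤ 3 / 2 * Real.exp (-(α * Real.log n)) := by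
  have := isProbabilityMeasure_tableLaw hε hμ
  have hlog : 0 ≤ α * Real.log n := mul_nonneg hα.le (Real.log_natCast_nonneg n)
  have h1 : (tableLaw ε μ).real {ω | ω.1 (o, j) < -(α * Real.log n / (ε * (1 / 2 * (2 ^ j : ℕ))))} ≤
      1 / 2 * Real.exp (-(α * Real.log n)) := by
    have h := tableLaw_real_fst (ε := ε) hμ
      {Z | Z (o, j) < -(α * Real.log n / (ε * (1 / 2 * (2 ^ j : ℕ))))}
    rw [noiseLaw_real_lt hε (o, j) (by positivity)] at h
    refine h.le.trans (le_of_eq ?_)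
    rw [div_eq_inv_mul, one_div]
    congr 3
    push_cast
    field_simp
  have h2 : (tableLaw ε μ).real {ω | episodeMean ω.2 o j < μ o ∧
      ((α * Real.log n / (1 / 2 * (2 ^ j : ℕ)) : ℝ) : EReal) < klBer (episodeMean ω.2 o j) (μ o)} ≤
      Real.exp (-(α * Real.log n)) := by
    have h := tableLaw_real_snd hε hμ {X | episodeMean X o j < μ o ∧
      ((α * Real.log n / (1 / 2 * (2 ^ j : ℕ)) : ℝ) : EReal) < klBer (episodeMean X o j) (μ o)}
    refine h.le.trans ?_
    simp only [episodeMean_eq]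
    refine (bernoulliPi_real_klBer_gt (μ := fun i : Fin K × ℕ => μ i.1) (fun i => hμ i.1)
      (fun i hi => ?_) (episodeEntries_nonempty o j)).trans ?_
    · rw [episodeEntries, Finset.mem_product, Finset.mem_singleton] at hi
      rw [hi.1]
    · rw [card_episodeEntries]
      refine Real.exp_le_exp.2 (neg_le_neg ?_)
      have h3 := half_le_card_episode j
      rw [← mul_div_assoc, le_div_iff₀ (by positivity), mul_comm _ (α * Real.log n)]
      refine mul_le_mul_of_nonneg_left ?_ hlog
      push_cast
      linarith
  refine (measureReal_union_le _ _).trans ?_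
  linarith

/-- If a suboptimal arm is played more than `2 ^ k` times, then either the index of the optimal arm
was too small at some time, or that of the suboptimal arm was too large after `2 ^ k` plays. -/
theorem mem_underEvent_or_overEvent {ε α : ℝ} (hε : 0 < ε) (hα : 0 < α)
    {sel : (Fin K → ℝ) → Fin K} (hsel : ∀ (x : Fin K → ℝ) (a : Fin K), x a ≤ x (sel x))
    {μ : Fin K → ℝ} (hμ : ∀ a, μ a ∈ Set.Icc (0 : ℝ) 1) {o c : Fin K} (hoc : o ≠ c)
    {a : ℕ → Fin K} {b : ℕ → Bool} {T k : ℕ} (hk : 2 ^ k < (boolState a b T).pulls c)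
    {ω : (Fin K × ℕ → ℝ) × (Fin K × ℕ → Bool)} (hω : ω ∈ tableEvent ε α sel a b T) :
    (∃ j < T, ω ∈ underEvent ε α μ o j (2 ^ j + 2 ^ k + 1)) ∨ ω ∈ overEvent ε α (μ o) T c k := by
  obtain ⟨hZ, hX⟩ := hω
  have hch := forall_runAction_iff.1 hZ
  have hadm := Admissible.of_chooseArm hch
  set r : ℕ → ℝ := fun n => rewardValue (b n) with hr
  -- This is the round of play number `2 ^ k + 1` of the arm.
  obtain ⟨t, htT, ht1, ht2⟩ : ∃ t < T, (stateAlong a r t).pulls c ≤ 2 ^ k ∧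
      2 ^ k < (stateAlong a r (t + 1)).pulls c := by
    have hex : ∃ t, 2 ^ k < (stateAlong a r t).pulls c := ⟨T, hk⟩
    classical
    have h1 := Nat.find_spec hex
    have h2 := Nat.find_min' hex hk
    rcases hf : Nat.find hex with _ | t
    · rw [hf] at h1
      simp [stateAlong, initialState] at h1
    · rw [hf] at h1 h2
      exact ⟨t, by omega, not_lt.1 (Nat.find_min hex (m := t) (by omega)), h1⟩
  have hat : c = a t := by
    by_contra hne
    rw [stateAlong, updateState_pulls_of_ne _ _ hne] at ht2
    omega
  have hp : (stateAlong a r t).pulls c = 2 ^ k := by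
    rw [stateAlong, hat, updateState_pulls_self, ← hat] at ht2
    omega
  have hpow : ∀ m : ℕ, 0 < 2 ^ m := fun m => Nat.two_pow_pos m
  have hKt : K ≤ t := by
    by_contra! hlt
    have h1 := ((hadm.initial htT.le hlt.le).2 c).1
    have h2 : (c : ℕ) = t := by rw [hat, (hadm t htT).1 hlt]
    rw [if_neg (by omega)] at h1
    have := hpow k
    omega
  -- In a running episode of the played arm its count would lie strictly between consecutive powers
  -- of two.
  have hcur : (stateAlong a r t).current = none := by
    rcases hadm.current_eq htT with h | h
    · exact h
    · obtain ⟨i, h1, h2, h3⟩ := (hadm.doublingInvariant htT.le).busy (a t) h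
      rw [← hat, hp] at h2 h3
      have h4 := (Nat.pow_lt_pow_iff_right one_lt_two).1 h2
      have h5 := (Nat.pow_lt_pow_iff_right one_lt_two).1 h3
      omega
  have hmean : ∀ d, ∃ j, (stateAlong a r t).pulls d = 2 ^ j ∧
      privateMean ω.1 (stateAlong a r t) d = episodeMean ω.2 d j + ω.1 (d, j) := by
    intro d
    obtain ⟨j, hj, hj'⟩ := hadm.pulls_eq_two_pow htT.le hKt hcur d
    refine ⟨j, hj, ?_⟩
    have hsum := hadm.sum_eq (Y := fun i => rewardValue (ω.2 i))
      (fun s hs => by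
        have := hX s hs
        simp only [boolState] at this
        rw [hr, this]) htT.le d
    rw [privateMean, hsum, hj, hj', Nat.log_pow one_lt_two, episodeMean, episode]
  obtain ⟨j, hj, hjm⟩ := hmean o
  obtain ⟨k', hk', hkm⟩ := hmean c
  obtain rfl : k = k' := by
    rw [hp] at hk'
    exact Nat.pow_right_injective le_rfl hk'
  have htime : 2 ^ j + 2 ^ k ≤ t := by
    have h1 := Finset.sum_le_sum_of_subset (f := (stateAlong a r t).pulls)
      (Finset.subset_univ {o, c})
    rw [Finset.sum_pair hoc, sum_pulls, hj, hp] at h1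
    exact h1
  have harg : klIndex ε α (t + 1) (2 ^ j) (episodeMean ω.2 o j + ω.1 (o, j)) ≤
      klIndex ε α (t + 1) (2 ^ k) (episodeMean ω.2 c k + ω.1 (c, k)) := by
    have h1 := hch t htT
    simp only [chooseArm, dif_neg (not_lt.2 hKt), hcur] at h1
    have h2 := hsel (fun d => klIndex ε α (t + 1) ((stateAlong a r t).pulls d)
      (privateMean ω.1 (stateAlong a r t) d)) o
    rw [h1, ← hat] at h2
    simpa only [hj, hp, hjm, hkm] using h2
  rcases le_or_gt (μ o) (klIndex ε α (t + 1) (2 ^ j) (episodeMean ω.2 o j + ω.1 (o, j)))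
    with hge | hlt
  · exact Or.inr ⟨t + 1, by omega, by omega, hge.trans harg⟩
  · refine Or.inl ⟨j, ?_, ?_⟩
    · have : j < 2 ^ j := Nat.lt_two_pow_self
      omega
    rw [klIndex_eq] at hlt
    -- Bonuses grow with time, so a failure at time `t + 1` is covered by the event at the earliest
    -- possible time. Thus one event per pair `(j, k)` replaces a union over rounds.
    have hlog : Real.log ((2 ^ j + 2 ^ k + 1 : ℕ) : ℝ) ≤ Real.log ((t + 1 : ℕ) : ℝ) :=
      Real.log_le_log (by positivity) (by exact_mod_cast Nat.succ_le_succ htime)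
    have hlog0 : 0 ≤ Real.log ((t + 1 : ℕ) : ℝ) := Real.log_natCast_nonneg _
    obtain ⟨h1, h2⟩ := lt_klBer_of_klUpper_lt (clip_mem _)
      (div_nonneg (mul_nonneg hα.le hlog0) (by positivity)) (hμ o) hlt
    rcases lt_or_ge (ω.1 (o, j))
      (-(α * Real.log ((2 ^ j + 2 ^ k + 1 : ℕ) : ℝ) / (ε * (1 / 2 * (2 ^ j : ℕ))))) with h3 | h3
    · exact Or.inl h3
    · right
      have h4 : α * Real.log ((2 ^ j + 2 ^ k + 1 : ℕ) : ℝ) / (ε * (1 / 2 * (2 ^ j : ℕ))) ≤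
          α * Real.log ((t + 1 : ℕ) : ℝ) / (ε * (1 / 2 * (2 ^ j : ℕ))) := by gcongr
      have hmem := episodeMean_mem ω.2 o j
      have h5 : episodeMean ω.2 o j ≤ clip (episodeMean ω.2 o j + ω.1 (o, j) +
          α * Real.log ((t + 1 : ℕ) : ℝ) / (ε * (1 / 2 * (2 ^ j : ℕ)))) := by
        refine (clip_of_mem hmem).ge.trans (clip_mono ?_)
        linarith
      refine ⟨h5.trans_lt h1, ?_⟩
      refine lt_of_le_of_lt ?_ (h2.trans_le (klBer_anti_left hmem.1 h5 h1.le (hμ o).2))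
      rw [EReal.coe_le_coe_iff]
      gcongr

end Episodes

/-! ### Sums over dyadic scales -/

theorem sum_two_pow_filter_le {N : ℝ} (hN : 0 ≤ N) (n : ℕ) :
    ∑ k ∈ Finset.range n, (if (2 : ℝ) ^ k < N then (2 : ℝ) ^ k else 0) ≤ 2 * N := by
  -- The extra bound `2 ^ n` carries the induction: whenever `2 ^ n < N` is added, the earlier terms
  -- sum to less than `N`.
  suffices h : ∑ k ∈ Finset.range n, (if (2 : ℝ) ^ k < N then (2 : ℝ) ^ k else 0) ≤ 2 * N ∧
      ∑ k ∈ Finset.range n, (if (2 : ℝ) ^ k < N then (2 : ℝ) ^ k else 0) ≤ 2 ^ n from h.1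
  induction n with
  | zero => simpa using hN
  | succ n ih =>
    rw [Finset.sum_range_succ]
    have h2 : (0 : ℝ) < 2 ^ n := by positivity
    split_ifs with h
    · constructor
      · linarith [ih.2]
      · rw [pow_succ]
        linarith [ih.2]
    · rw [pow_succ]
      constructor <;> linarith [ih.1, ih.2]

/-- From `exp (y / 2) ≥ 1 + y / 2` follows `y exp (-y) ≤ 2 (exp (-y / 2) - exp (-y))`. At `y = 2 ^ k
z` the right sides telescope, because `y` doubles with `k`. -/
theorem sum_two_pow_mul_exp_le {z : ℝ} (hz : 0 < z) (n : ℕ) :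
    ∑ k ∈ Finset.range n, (2 : ℝ) ^ k * Real.exp (-(2 ^ k * z)) ≤ 2 / z := by
  have hstep : ∀ k : ℕ, (2 : ℝ) ^ k * Real.exp (-(2 ^ k * z)) ≤
      2 / z * (Real.exp (-(2 ^ k * z / 2)) - Real.exp (-(2 ^ (k + 1) * z / 2))) := by
    intro k
    set y := (2 : ℝ) ^ k * z with hy
    have e1 : Real.exp (-(2 ^ (k + 1) * z / 2)) = Real.exp (-y) := by
      congr 1
      rw [hy, pow_succ]
      ring
    have e2 : Real.exp (-y) = Real.exp (-(y / 2)) * Real.exp (-(y / 2)) := by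
      rw [← Real.exp_add]
      congr 1
      ring
    have e3 : Real.exp (y / 2) * Real.exp (-(y / 2)) = 1 := by
      rw [← Real.exp_add]
      simp
    have h1 := Real.add_one_le_exp (y / 2)
    have h2 := Real.exp_pos (-(y / 2))
    have h3 : y * Real.exp (-y) ≤ 2 * (Real.exp (-(y / 2)) - Real.exp (-y)) := by
      rw [e2]
      nlinarith [mul_le_mul_of_nonneg_right h1 (mul_pos h2 h2).le]
    rw [e1, div_mul_eq_mul_div, le_div_iff₀ hz]
    calc _ = y * Real.exp (-y) := by
          rw [hy]
          ring
      _ ≤ _ := h3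
  refine (Finset.sum_le_sum fun k _ => hstep k).trans ?_
  rw [← Finset.mul_sum, Finset.sum_range_sub']
  have : Real.exp (-(2 ^ 0 * z / 2)) ≤ 1 := Real.exp_le_one_iff.2 (by
    have : 0 ≤ 2 ^ 0 * z / 2 := by positivity
    linarith)
  have h2 := Real.exp_pos (-(2 ^ n * z / 2))
  calc _ ≤ 2 / z * 1 := by
        gcongr
        linarith
    _ = _ := mul_one _

theorem sum_geometric_half_le (n : ℕ) : ∑ j ∈ Finset.range n, (1 : ℝ) / 2 ^ j ≤ 2 := by
  have h := geom_sum_eq (x := (1 / 2 : ℝ)) (by norm_num) n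
  simp only [one_div, inv_pow] at h ⊢
  rw [h]
  have : (0 : ℝ) < (2 ^ n)⁻¹ := by positivity
  norm_num
  linarith

/-- The number of plays in the last two episodes before play number `2 ^ k`. -/
def lastTwo : ℕ → ℕ
  | 0 => 1
  | 1 => 2
  | k + 2 => 3 * 2 ^ k

/-- The telescoping inequality is `(1 - q) a q ^ (2 a) ≤ q ^ a - q ^ (2 a)` with `a = 3 * 2 ^ i`.
The factor 3, due to using two episodes, gives `8 / 3`; this argument with one episode would give 4,
more than the additive constant 3 of the regret bound allows. -/
theorem sum_two_pow_mul_pow_lastTwo_le {q : ℝ} (hq : 0 ≤ q) (hq1 : q ≤ 1) (n : ℕ) :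
    (1 - q) * ∑ k ∈ Finset.range n, (2 : ℝ) ^ k * q ^ lastTwo k ≤
      (1 - q) * (q + 2 * q ^ 2 + 4 * q ^ 3) + 8 / 3 * q ^ 3 := by
  have hx : 0 ≤ 1 - q := by linarith
  have hmono : ∑ k ∈ Finset.range n, (2 : ℝ) ^ k * q ^ lastTwo k ≤
      ∑ k ∈ Finset.range (n + 3), (2 : ℝ) ^ k * q ^ lastTwo k :=
    Finset.sum_le_sum_of_subset_of_nonneg (Finset.range_mono (by omega))
      fun _ _ _ => by positivity
  have hsplit : ∑ k ∈ Finset.range (n + 3), (2 : ℝ) ^ k * q ^ lastTwo k =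
      ∑ i ∈ Finset.range n, (2 : ℝ) ^ (i + 3) * q ^ (3 * 2 ^ (i + 1)) +
        (q + 2 * q ^ 2 + 4 * q ^ 3) := by
    rw [Finset.sum_range_succ', Finset.sum_range_succ', Finset.sum_range_succ']
    simp only [lastTwo]
    norm_num
    ring
  have hstep : ∀ i : ℕ, (1 - q) * ((2 : ℝ) ^ (i + 3) * q ^ (3 * 2 ^ (i + 1))) ≤
      8 / 3 * (q ^ (3 * 2 ^ i) - q ^ (3 * 2 ^ (i + 1))) := by
    intro i
    set a := 3 * 2 ^ i with ha
    have e1 : 3 * 2 ^ (i + 1) = a + a := by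
      rw [ha, pow_succ]
      ring
    have e2 : (2 : ℝ) ^ (i + 3) = 8 / 3 * a := by
      rw [ha, pow_add]
      push_cast
      ring
    have h1 : (a : ℝ) * q ^ a ≤ ∑ i ∈ Finset.range a, q ^ i := by
      have := Finset.card_nsmul_le_sum (Finset.range a) (fun i => q ^ i) (q ^ a)
        fun i hi => pow_le_pow_of_le_one hq hq1 (Finset.mem_range.1 hi).le
      simpa using this
    have h2 := mul_neg_geom_sum q a
    have h3 : 0 ≤ q ^ a := by positivity
    rw [e1, e2, pow_add]
    have h4 : (1 - q) * (a * q ^ a) ≤ 1 - q ^ a := by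
      rw [← h2]
      exact mul_le_mul_of_nonneg_left h1 hx
    nlinarith [mul_le_mul_of_nonneg_right h4 h3]
  have hsum : (1 - q) * ∑ i ∈ Finset.range n, (2 : ℝ) ^ (i + 3) * q ^ (3 * 2 ^ (i + 1)) ≤
      8 / 3 * q ^ 3 := by
    rw [Finset.mul_sum]
    refine (Finset.sum_le_sum fun i _ => hstep i).trans ?_
    rw [← Finset.mul_sum, Finset.sum_range_sub' (fun i => q ^ (3 * 2 ^ i))]
    have : 0 ≤ q ^ (3 * 2 ^ n) := by positivity
    simp only [pow_zero, mul_one]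
    linarith
  calc _ ≤ (1 - q) * ∑ k ∈ Finset.range (n + 3), (2 : ℝ) ^ k * q ^ lastTwo k :=
        mul_le_mul_of_nonneg_left hmono hx
    _ ≤ _ := by
      rw [hsplit, mul_add]
      linarith

section Bounds

variable {K : ℕ}

/-! ### Probability that the index of the optimal arm is too small -/

/-- The index of arm `o` may be too small at some time at which another arm was played `2 ^ k`
times. -/
def underUnion (ε α : ℝ) (μ : Fin K → ℝ) (o : Fin K) (T k : ℕ) :
    Set ((Fin K × ℕ → ℝ) × (Fin K × ℕ → Bool)) :=
  ⋃ j ∈ Finset.range T, underEvent ε α μ o j (2 ^ j + 2 ^ k + 1)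

theorem underEvent_anti {ε α : ℝ} (hε : 0 < ε) (hα : 0 < α) (μ : Fin K → ℝ) (o : Fin K) (j : ℕ)
    {n n' : ℕ} (hn : 0 < n) (h : n ≤ n') : underEvent ε α μ o j n' ⊆ underEvent ε α μ o j n := by
  have hlog : Real.log n ≤ Real.log n' :=
    Real.log_le_log (by exact_mod_cast hn) (by exact_mod_cast h)
  rintro ω (hω | ⟨h1, h2⟩)
  · refine Or.inl ?_
    rw [Set.mem_ofPred_eq] at hω ⊢
    refine lt_of_lt_of_le hω (neg_le_neg ?_)
    gcongr
  · refine Or.inr ⟨h1, lt_of_le_of_lt ?_ h2⟩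
    rw [EReal.coe_le_coe_iff]
    gcongr

theorem underUnion_anti {ε α : ℝ} (hε : 0 < ε) (hα : 0 < α) (μ : Fin K → ℝ) (o : Fin K) (T : ℕ)
    {k k' : ℕ} (h : k ≤ k') : underUnion ε α μ o T k' ⊆ underUnion ε α μ o T k := by
  refine Set.iUnion₂_mono fun j _ => underEvent_anti hε hα μ o j (Nat.succ_pos _) ?_
  have := Nat.pow_le_pow_right two_pos h
  omega

theorem exp_neg_mul_log_le {α : ℝ} (hα : 3 ≤ α) {n : ℕ} (hn : 0 < n) :
    Real.exp (-(α * Real.log n)) ≤ 1 / (n : ℝ) ^ 3 := by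
  have hn' : (0 : ℝ) < n := by exact_mod_cast hn
  have h : Real.exp ((3 : ℕ) * Real.log n) = (n : ℝ) ^ 3 := by
    rw [Real.exp_nat_mul, Real.exp_log hn']
  rw [← h, one_div, ← Real.exp_neg]
  refine Real.exp_le_exp.2 (neg_le_neg ?_)
  push_cast
  exact mul_le_mul_of_nonneg_right hα (Real.log_natCast_nonneg n)

/-- With `A = 2 ^ k + 1` and `B = 2 ^ j`, the arithmetic-geometric inequality `(A + B) ^ 3 ≥ 27 / 4
* A ^ 2 * B` splits the cubic tail into a part summable over `j` and a part that stays summable over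
`k` after multiplication by `2 ^ k`. -/
theorem tableLaw_real_underUnion {ε α : ℝ} (hε : 0 < ε) (hα : 3 ≤ α) {μ : Fin K → ℝ}
    (hμ : ∀ a, μ a ∈ Set.Icc (0 : ℝ) 1) (o : Fin K) (T k : ℕ) :
    (tableLaw ε μ).real (underUnion ε α μ o T k) ≤ 4 / 9 / ((2 : ℝ) ^ k + 1) ^ 2 := by
  have hterm : ∀ j ∈ Finset.range T,
      (tableLaw ε μ).real (underEvent ε α μ o j (2 ^ j + 2 ^ k + 1)) ≤
        2 / 9 / ((2 : ℝ) ^ k + 1) ^ 2 * (1 / 2 ^ j) := by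
    intro j _
    refine (tableLaw_real_underEvent hε (by linarith) hμ o j _).trans ?_
    have h1 := exp_neg_mul_log_le hα (n := 2 ^ j + 2 ^ k + 1) (Nat.succ_pos _)
    push_cast at h1
    set A : ℝ := 2 ^ k + 1 with hA
    set B : ℝ := 2 ^ j with hB
    have hA0 : 0 < A := by positivity
    have hB0 : 0 < B := by positivity
    have h2 : 27 / 4 * (A ^ 2 * B) ≤ (B + 2 ^ k + 1) ^ 3 := by
      have e : B + 2 ^ k + 1 = A + B := by
        rw [hA]
        ring
      rw [e]
      nlinarith [mul_nonneg (sq_nonneg (A - 2 * B)) (show 0 ≤ A + B / 4 by positivity)]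
    calc _ ≤ 3 / 2 * (1 / (B + 2 ^ k + 1) ^ 3) := by
          push_cast
          gcongr
      _ ≤ 3 / 2 * (1 / (27 / 4 * (A ^ 2 * B))) := by gcongr
      _ = _ := by
        field_simp
        norm_num
  refine (measureReal_biUnion_finset_le _ _).trans ((Finset.sum_le_sum hterm).trans ?_)
  rw [← Finset.mul_sum]
  calc _ ≤ 2 / 9 / ((2 : ℝ) ^ k + 1) ^ 2 * 2 := by
        gcongr
        exact sum_geometric_half_le T
    _ = _ := by ring

theorem sum_two_pow_mul_under_le (n : ℕ) :
    ∑ k ∈ Finset.range n, (2 : ℝ) ^ k * (4 / 9 / ((2 : ℝ) ^ k + 1) ^ 2) ≤ 5 / 9 := by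
  rcases n with _ | n
  · norm_num
  rw [Finset.sum_range_succ']
  have hterm : ∀ k ∈ Finset.range n, (2 : ℝ) ^ (k + 1) * (4 / 9 / ((2 : ℝ) ^ (k + 1) + 1) ^ 2) ≤
      2 / 9 * (1 / 2 ^ k) := by
    intro k _
    have h : (0 : ℝ) < 2 ^ k := by positivity
    rw [pow_succ, div_div, mul_one_div, ← mul_div_assoc, div_le_div_iff₀ (by positivity)
      (by positivity)]
    nlinarith
  have h1 := Finset.sum_le_sum hterm
  rw [← Finset.mul_sum] at h1
  have h2 := sum_geometric_half_le n
  norm_num at h1 ⊢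
  norm_num at h2
  linarith

end Bounds

section ArmBound

variable {K : ℕ}

/-! ### Probability that the index of a suboptimal arm is too large -/

theorem klReal_pos {p q : ℝ} (hp : 0 ≤ p) (hpq : p < q) (hq1 : q < 1) : 0 < klReal p q := by
  have h1 := sub_le_mul_log_div hp (hp.trans_lt hpq)
  have hp1 : 0 < 1 - p := by linarith
  have hq1' : 0 < 1 - q := by linarith
  have h2 : Real.log ((1 - q) / (1 - p)) < (1 - q) / (1 - p) - 1 :=
    Real.log_lt_sub_one_of_pos (by positivity) (by
      rw [Ne, div_eq_one_iff_eq hp1.ne']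
      linarith)
  have h3 : Real.log ((1 - p) / (1 - q)) = -Real.log ((1 - q) / (1 - p)) := by
    rw [← Real.log_inv, inv_div]
  have h4 : (1 - p) * ((1 - q) / (1 - p) - 1) = p - q := by
    field_simp
    ring
  have h5 := mul_lt_mul_of_pos_left h2 hp1
  rw [klReal, h3]
  linarith

/-- The denominator of the regret bound. -/
def complexity (ε q m : ℝ) : ℝ := (min (klBer q m) ((6 * ε * (m - q) : ℝ) : EReal)).toReal

/-- The privacy term keeps the minimum finite, so `toReal` loses nothing, even at `m = 1` where the
entropy is infinite. -/
theorem complexity_spec {ε q m : ℝ} (hε : 0 < ε) (hq : 0 ≤ q) (hqm : q < m) (hm : m ≤ 1) :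
    0 < complexity ε q m ∧ complexity ε q m ≤ 6 * ε * (m - q) ∧
      (complexity ε q m : EReal) ≤ klBer q m := by
  have hpos : (0 : EReal) < klBer q m := by
    rcases hm.eq_or_lt with rfl | hm
    · rw [klBer_one hqm.ne]
      exact EReal.zero_lt_top
    · rw [klBer_eq_klReal (hq.trans_lt hqm) hm]
      exact_mod_cast klReal_pos hq hqm hm
  have hpos2 : (0 : EReal) < ((6 * ε * (m - q) : ℝ) : EReal) := by
    have : 0 < 6 * ε * (m - q) := mul_pos (by linarith) (by linarith)
    exact_mod_cast this
  have hmin := lt_min hpos hpos2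
  have hcoe : (complexity ε q m : EReal) = min (klBer q m) ((6 * ε * (m - q) : ℝ) : EReal) := by
    refine EReal.coe_toReal ?_ ?_
    · exact ne_top_of_le_ne_top (EReal.coe_ne_top _) (min_le_right _ _)
    · exact (bot_lt_of_lt hmin).ne'
  refine ⟨?_, ?_, ?_⟩
  · rw [← hcoe] at hmin
    exact_mod_cast hmin
  · have := min_le_right (klBer q m) ((6 * ε * (m - q) : ℝ) : EReal)
    rw [← hcoe] at this
    exact_mod_cast this
  · rw [hcoe]
    exact min_le_left _ _

/-- The witness is the clipped private mean; both bonuses are increased to their values at the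
horizon, which removes the time from the event. The proviso `0 < p` is needed because clipping at
zero may raise the mean. -/
theorem exists_of_mem_overEvent {ε α m : ℝ} (hε : 0 < ε) (hα : 0 < α)
    (hm : m ∈ Set.Icc (0 : ℝ) 1) {T k : ℕ} {c : Fin K}
    {ω : (Fin K × ℕ → ℝ) × (Fin K × ℕ → Bool)} (hω : ω ∈ overEvent ε α m T c k) :
    ∃ p ∈ Set.Icc (0 : ℝ) 1,
      (0 < p → p ≤ episodeMean ω.2 c k + ω.1 (c, k) + 2 * α * Real.log T / (ε * 2 ^ k)) ∧
      (m ≤ p ∨ klBer p m ≤ ((2 * α * Real.log T / 2 ^ k : ℝ) : EReal)) := by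
  obtain ⟨n, hn, hnT, h⟩ := hω
  have hlog0 : 0 ≤ Real.log n := Real.log_natCast_nonneg n
  have hlog : Real.log n ≤ Real.log T :=
    Real.log_le_log (by exact_mod_cast hn) (by exact_mod_cast hnT)
  have hoff : α * Real.log n / (ε * (1 / 2 * ((2 ^ k : ℕ) : ℝ))) ≤
      2 * α * Real.log T / (ε * 2 ^ k) := by
    push_cast
    rw [show α * Real.log n / (ε * (1 / 2 * 2 ^ k)) = 2 * α * Real.log n / (ε * 2 ^ k) by
      field_simp]
    gcongr
  have hbud : α * Real.log n / (1 / 2 * ((2 ^ k : ℕ) : ℝ)) ≤ 2 * α * Real.log T / 2 ^ k := by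
    push_cast
    rw [show α * Real.log n / (1 / 2 * 2 ^ k) = 2 * α * Real.log n / 2 ^ k by field_simp]
    gcongr
  rw [klIndex_eq] at h
  set y := episodeMean ω.2 c k + ω.1 (c, k) + α * Real.log n / (ε * (1 / 2 * ((2 ^ k : ℕ) : ℝ)))
    with hy
  refine ⟨clip y, clip_mem y, fun hp => ?_, ?_⟩
  · refine (clip_le_of_nonneg ?_).trans (by linarith)
    by_contra! hneg
    rw [clip, max_eq_left hneg.le, min_eq_left zero_le_one] at hp
    exact lt_irrefl _ hp
  · rcases klBer_le_of_le_klUpper (clip_mem _) (by positivity) hm h with h | h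
    · exact Or.inl h
    · exact Or.inr (h.trans (by exact_mod_cast hbud))

/-- At this scale the entropy budget is at most `D / 48`, below the `D / 12` guaranteed at the
midpoint, so the clipped mean passes the midpoint. The privacy offset is at most `(m - q) / 8`; the
remaining excess `3 (m - q) / 8` is shared between noise and empirical mean. -/
theorem overEvent_subset_of_le {ε α q m D : ℝ} (hε : 0 < ε) (hα : 0 < α) (hq : 0 ≤ q)
    (hqm : q < m) (hm : m ≤ 1) (hD : 0 < D) (hDε : D ≤ 6 * ε * (m - q))
    (hDk : (D : EReal) ≤ klBer q m) {T k : ℕ} (hk : 96 * α * Real.log T ≤ D * 2 ^ k) (c : Fin K) :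
    overEvent ε α m T c k ⊆ {ω | (m - q) / 8 < ω.1 (c, k)} ∪
      {ω | q + (m - q) / 4 ≤ episodeMean ω.2 c k} := by
  intro ω hω
  obtain ⟨p, hp, h1, h2⟩ := exists_of_mem_overEvent hε hα ⟨by linarith, hm⟩ hω
  have h2k : (0 : ℝ) < 2 ^ k := by positivity
  have hbud : 2 * α * Real.log T / 2 ^ k ≤ D / 48 := by
    rw [div_le_div_iff₀ h2k (by norm_num)]
    linarith
  have hoff : 2 * α * Real.log T / (ε * 2 ^ k) ≤ (m - q) / 8 := by
    rw [div_le_div_iff₀ (by positivity) (by norm_num)]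
    nlinarith
  have hmid : (q + m) / 2 < p := by
    by_contra! hle
    rcases h2 with h2 | h2
    · linarith
    have h3 := (klBer_anti_left hp.1 hle (by linarith) hm).trans h2
    rcases hm.eq_or_lt with rfl | hm
    · rw [klBer_one (by linarith)] at h3
      exact absurd h3 (not_le.2 (EReal.coe_lt_top _))
    · rw [klBer_eq_klReal (by linarith) hm, EReal.coe_le_coe_iff] at h3
      rw [klBer_eq_klReal (by linarith) hm, EReal.coe_le_coe_iff] at hDk
      have h4 := klReal_le_klReal_midpoint hq hqm hm
      linarith
  have h3 := h1 (by linarith)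
  by_contra hne
  simp only [Set.mem_union, Set.mem_ofPred_eq, not_or, not_lt, not_le] at hne
  linarith [hne.1, hne.2]

theorem tableLaw_real_noise_gt {ε : ℝ} (hε : 0 < ε) {μ : Fin K → ℝ}
    (hμ : ∀ a, μ a ∈ Set.Icc (0 : ℝ) 1) (c : Fin K) (k : ℕ) {s : ℝ} (hs : 0 ≤ s) :
    (tableLaw ε μ).real {ω | s < ω.1 (c, k)} = Real.exp (-(s * (ε * 2 ^ k / 2))) / 2 := by
  rw [← noiseLaw_real_gt hε (c, k) hs]
  exact tableLaw_real_fst hμ {Z | s < Z (c, k)}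

theorem tableLaw_real_episodeMean_ge {ε : ℝ} (hε : 0 < ε) {μ : Fin K → ℝ}
    (hμ : ∀ a, μ a ∈ Set.Icc (0 : ℝ) 1) (c : Fin K) (k : ℕ) {r : ℝ} (hr : μ c < r) (hr1 : r < 1) :
    (tableLaw ε μ).real {ω | r ≤ episodeMean ω.2 c k} ≤
      Real.exp (-(2 ^ k * ((r - μ c) ^ 2 / (4 * (r * (1 - μ c))) / 2))) := by
  refine (tableLaw_real_snd hε hμ {X | r ≤ episodeMean X c k}).le.trans ?_
  have hcard : (0 : ℝ) < (episodeEntries c k).card := by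
    rw [card_episodeEntries]
    exact card_episode_pos k
  have hset : {X : Fin K × ℕ → Bool | r ≤ episodeMean X c k} =
      {X | (episodeEntries c k).card * r ≤ ∑ i ∈ episodeEntries c k, rewardValue (X i)} := by
    ext X
    rw [Set.mem_ofPred_eq, Set.mem_ofPred_eq, episodeMean_eq, le_div_iff₀' hcard]
  rw [hset]
  refine (bernoulliPi_real_le_sum (μ := fun i : Fin K × ℕ => μ i.1) (fun i => hμ i.1)
    (fun i hi => ?_) (episodeEntries_nonempty c k) hr hr1).trans ?_
  · rw [episodeEntries, Finset.mem_product, Finset.mem_singleton] at hi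
    rw [hi.1]
  · rw [card_episodeEntries]
    refine Real.exp_le_exp.2 (neg_le_neg ?_)
    have h1 := half_le_card_episode k
    have h2 : 0 ≤ (r - μ c) ^ 2 / (4 * (r * (1 - μ c))) := by
      have h3 := (hμ c).1
      have h4 : 0 ≤ 1 - μ c := by linarith
      have h5 : 0 ≤ r := by linarith
      positivity
    calc _ = 2 ^ k / 2 * ((r - μ c) ^ 2 / (4 * (r * (1 - μ c)))) := by ring
      _ ≤ _ := mul_le_mul_of_nonneg_right h1 h2

/-- Either the complexity or the distance of `q` to one is controlled by the large deviation rate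
of the suboptimal arm. -/
theorem rate_lower_bound {q m D : ℝ} (hq : 0 ≤ q) (hqm : q < m) (hm : m ≤ 1)
    (hDk : (D : EReal) ≤ klBer q m) {d : ℝ}
    (hd : d = (q + (m - q) / 4 - q) ^ 2 / (4 * ((q + (m - q) / 4) * (1 - q)))) :
    0 < d ∧ (D ≤ 128 * d ∨ 1 - q ≤ 256 * d) := by
  have hx : 0 < 1 - q := by linarith
  have hm0 : 0 < m := by linarith
  have hΔ : 0 < m - q := by linarith
  have hr : 0 < q + (m - q) / 4 := by linarith
  have hd0 : 0 < d := by
    rw [hd, add_sub_cancel_left]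
    positivity
  have hlow : (m - q) ^ 2 / (64 * (m * (1 - q))) ≤ d := by
    have : (m - q) ^ 2 / (64 * (m * (1 - q))) =
        ((m - q) / 4) ^ 2 / (4 * (m * (1 - q))) := by
      field_simp
      ring
    rw [hd, this, add_sub_cancel_left]
    gcongr
    linarith
  refine ⟨hd0, ?_⟩
  rcases le_or_gt (1 - q) (2 * (1 - m)) with h | h
  -- While `1 - m` is comparable with `1 - q`, the chi-square bound on the entropy matches the rate.
  · left
    have hm1 : m < 1 := by linarith
    rw [klBer_eq_klReal hm0 hm1, EReal.coe_le_coe_iff] at hDk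
    have h1 := klReal_le_sq_div hq (by linarith) hm0 hm1
    have h2 : (m - q) ^ 2 / (m * (1 - m)) ≤ 128 * ((m - q) ^ 2 / (64 * (m * (1 - q)))) := by
      have : 128 * ((m - q) ^ 2 / (64 * (m * (1 - q)))) = (m - q) ^ 2 / (m * ((1 - q) / 2)) := by
        field_simp
        norm_num
      rw [this]
      have : 0 < 1 - m := by linarith
      gcongr
      linarith
    linarith
  -- Now `m - q` exceeds half of `1 - q`. The entropy may be arbitrarily large, and the rate is
  -- bounded below only through `1 - q`.
  · right
    have h1 : (1 - q) / 256 ≤ (m - q) ^ 2 / (64 * (m * (1 - q))) := by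
      rw [div_le_div_iff₀ (by norm_num) (by positivity)]
      have h2 : (1 - q) ^ 2 ≤ 4 * (m - q) ^ 2 := by nlinarith
      nlinarith [mul_nonneg (sq_nonneg (1 - q)) (sub_nonneg.2 hm)]
    linarith

/-- Bound of the number of plays when the complexity is not too large. -/
theorem expected_pulls_le_of_complexity_le {ε α : ℝ} (hε : 0 < ε) (hα : 3 ≤ α)
    {sel : (Fin K → ℝ) → Fin K} (hsel : IsArgmaxRule sel) {μ : Fin K → ℝ}
    (hμ : ∀ a, μ a ∈ Set.Icc (0 : ℝ) 1) {o c : Fin K} (hoc : μ c < μ o) {T : ℕ} (hT : 2 ≤ T)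
    (hcase : complexity ε (μ c) (μ o) ≤ 96 * α * (1 - μ c) * Real.log T) :
    ∑ a, ∑ b, historyProb (adaPKLUCB K ε α sel T) μ a b *
        ((Finset.univ.filter fun t => a t = c).card : ℝ) ≤
      17 / 9 + 100000 * α * Real.log T / complexity ε (μ c) (μ o) := by
  have hα0 : 0 < α := by linarith
  have hprob := isProbabilityMeasure_tableLaw hε hμ
  obtain ⟨hD, hDε, hDk⟩ := complexity_spec hε (hμ c).1 hoc (hμ o).2
  set D := complexity ε (μ c) (μ o) with hDdef
  set L := Real.log T with hL
  set Δ := μ o - μ c with hΔ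
  have hΔ0 : 0 < Δ := by linarith
  have hL2 : 1 / 2 ≤ L := by
    have h1 : Real.log 2 ≤ L := Real.log_le_log two_pos (by exact_mod_cast hT)
    linarith [Real.log_two_gt_d9]
  set d := (μ c + Δ / 4 - μ c) ^ 2 / (4 * ((μ c + Δ / 4) * (1 - μ c))) with hd
  obtain ⟨hd0, hdcase⟩ := rate_lower_bound (hμ c).1 hoc (hμ o).2 hDk hd
  -- Below this threshold probabilities are bounded by 1, which costs at most `2 * N` plays.
  set N := 96 * α * L / D with hN
  set z := Δ / 8 * (ε / 2) with hz
  have hz0 : 0 < z := by positivity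
  have hN0 : 0 ≤ N := by positivity
  have hE : ∀ k a b, 2 ^ k < T → 2 ^ k < (boolState a b T).pulls c →
      tableEvent ε α sel a b T ⊆ underUnion ε α μ o T k ∪ overEvent ε α (μ o) T c k := by
    intro k a b _ hk ω hω
    rcases mem_underEvent_or_overEvent hε hα0 hsel.2 hμ (o := o) (c := c)
      (fun h => by rw [h] at hoc; exact lt_irrefl _ hoc) hk hω with ⟨j, hj, h⟩ | h
    · exact Or.inl (Set.mem_biUnion (Finset.mem_range.2 hj) h)
    · exact Or.inr h
  have hP : ∀ k : ℕ, (2 : ℝ) ^ k *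
      (tableLaw ε μ).real (underUnion ε α μ o T k ∪ overEvent ε α (μ o) T c k) ≤
      2 ^ k * (4 / 9 / ((2 : ℝ) ^ k + 1) ^ 2) + (if (2 : ℝ) ^ k < N then (2 : ℝ) ^ k else 0) +
        1 / 2 * (2 ^ k * Real.exp (-(2 ^ k * z))) + 2 ^ k * Real.exp (-(2 ^ k * (d / 2))) := by
    intro k
    have h2k : (0 : ℝ) < 2 ^ k := by positivity
    have h1 := tableLaw_real_underUnion hε hα hμ o T k
    have e1 := Real.exp_pos (-(2 ^ k * z))
    have e2 := Real.exp_pos (-(2 ^ k * (d / 2)))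
    have hun := measureReal_union_le (μ := tableLaw ε μ) (underUnion ε α μ o T k)
      (overEvent ε α (μ o) T c k)
    have h2 : (tableLaw ε μ).real (overEvent ε α (μ o) T c k) ≤
        (if (2 : ℝ) ^ k < N then 1 else 0) + 1 / 2 * Real.exp (-(2 ^ k * z)) +
          Real.exp (-(2 ^ k * (d / 2))) := by
      split_ifs with hk
      · have : (tableLaw ε μ).real (overEvent ε α (μ o) T c k) ≤ 1 := measureReal_le_one
        linarith
      · rw [not_lt, hN, div_le_iff₀' hD] at hk
        have hsub := overEvent_subset_of_le hε hα0 (hμ c).1 hoc (hμ o).2 hD hDε hDk hk c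
        refine (measureReal_mono hsub (measure_ne_top _ _)).trans
          ((measureReal_union_le _ _).trans ?_)
        rw [tableLaw_real_noise_gt hε hμ c k (by linarith)]
        have h3 := tableLaw_real_episodeMean_ge hε hμ c k (r := μ c + Δ / 4) (by linarith)
          (by linarith [(hμ o).2])
        rw [← hd] at h3
        have h4 : Δ / 8 * (ε * 2 ^ k / 2) = 2 ^ k * z := by
          rw [hz]
          ring
        rw [h4]
        linarith
    calc _ ≤ 2 ^ k * (4 / 9 / ((2 : ℝ) ^ k + 1) ^ 2 + ((if (2 : ℝ) ^ k < N then 1 else 0) +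
          1 / 2 * Real.exp (-(2 ^ k * z)) + Real.exp (-(2 ^ k * (d / 2))))) := by
          gcongr
          linarith
      _ = _ := by split_ifs <;> ring
  refine (expected_pulls_le hε hα0 hsel.1 hμ T c _ hE).trans ?_
  have hsum : ∑ k ∈ (Finset.range T).filter (fun k => 2 ^ k < T), (2 : ℝ) ^ k *
      (tableLaw ε μ).real (underUnion ε α μ o T k ∪ overEvent ε α (μ o) T c k) ≤
      5 / 9 + 2 * N + 1 / 2 * (2 / z) + 2 / (d / 2) := by
    refine (Finset.sum_le_sum_of_subset_of_nonneg (Finset.filter_subset _ _)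
      fun _ _ _ => by positivity).trans ?_
    refine (Finset.sum_le_sum fun k _ => hP k).trans ?_
    rw [Finset.sum_add_distrib, Finset.sum_add_distrib, Finset.sum_add_distrib, ← Finset.mul_sum]
    have s1 := sum_two_pow_mul_under_le T
    have s2 := sum_two_pow_filter_le hN0 T
    have s3 := sum_two_pow_mul_exp_le hz0 T
    have s4 := sum_two_pow_mul_exp_le (half_pos hd0) T
    linarith
  have hz' : 1 / 2 * (2 / z) ≤ 192 * L / D := by
    rw [show 1 / 2 * (2 / z) = 96 / (6 * ε * Δ) by rw [hz]; field_simp; norm_num]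
    calc _ ≤ 96 / D := by gcongr
      _ ≤ _ := by
        gcongr
        linarith
  -- Here `98304 = 4 * 96 * 256`: in the second alternative of `rate_lower_bound`, `hcase` converts
  -- `1 - μ c ≤ 256 * d` into a bound of `D` by a multiple of `d`.
  have hd' : 2 / (d / 2) ≤ 98304 * α * L / D := by
    rw [show 2 / (d / 2) = 4 / d by field_simp; norm_num, div_le_div_iff₀ hd0 hD]
    rcases hdcase with h | h
    · have : 1 ≤ α * L := by nlinarith
      nlinarith [mul_le_mul_of_nonneg_left this hd0.le]
    · have h5 : 0 ≤ 96 * α * L := by positivity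
      nlinarith [mul_le_mul_of_nonneg_left h h5]
  have hN' : 2 * N = 192 * α * L / D := by
    rw [hN]
    ring
  have hfin : 192 * α * L / D + 192 * L / D + 98304 * α * L / D ≤ 100000 * α * L / D := by
    rw [← add_div, ← add_div]
    gcongr
    nlinarith
  linarith

end ArmBound

section EasyArms

variable {K : ℕ}

/-! ### Arms of large complexity -/

/-- A single zero reward lowers the mean by the inverse episode length, which is at least `1 / 2 ^
k`. -/
theorem forall_true_of_episodeMean_gt {X : Fin K × ℕ → Bool} {c : Fin K} {k : ℕ}
    (h : 1 - 1 / 2 ^ k < episodeMean X c k) : ∀ i ∈ episodeEntries c k, X i = true := by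
  intro i hi
  by_contra hne
  have hX : X i = false := by simpa using hne
  have hn := card_episode_pos k
  rw [← card_episodeEntries c k] at hn
  have hle := card_episode_le k
  rw [← card_episodeEntries c k] at hle
  have hsum : ∑ j ∈ episodeEntries c k, rewardValue (X j) ≤ (episodeEntries c k).card - 1 := by
    classical
    rw [← Finset.add_sum_erase _ _ hi, hX]
    have h1 := (sum_rewardValue_mem X ((episodeEntries c k).erase i)).2
    rw [Finset.card_erase_of_mem hi, Nat.cast_sub (Finset.card_pos.2 ⟨i, hi⟩)] at h1
    simpa [rewardValue] using h1
  rw [episodeMean_eq, lt_div_iff₀ hn] at h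
  have h2 : (1 : ℝ) / 2 ^ k * (episodeEntries c k).card ≤ 1 := by
    rw [div_mul_eq_mul_div, one_mul]
    exact (div_le_one (by positivity)).2 hle
  nlinarith

/-- The large complexity gives `ε > 16 α log T` and, if `m < 1`, `log (1 / (1 - m)) > 96 α log T`.
Any `p` with `1 - p > 1 / (4 * 2 ^ k)` then has entropy to `m` far above the budget, so the clipped
mean is within `1 / (4 * 2 ^ k)` of 1. A small noise leaves an empirical mean above `1 - 1 / 2 ^ k`.
-/
theorem overEvent_subset_of_lt {ε α q m D : ℝ} (hε : 0 < ε) (hα : 3 ≤ α) (hq : 0 ≤ q)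
    (hqm : q < m) (hm : m ≤ 1) (hDε : D ≤ 6 * ε * (m - q))
    (hDk : (D : EReal) ≤ klBer q m) {T k : ℕ} (hT : 2 ≤ T)
    (hcase : 96 * α * (1 - q) * Real.log T < D) (hk : 2 ^ k < T) (c : Fin K) :
    overEvent ε α m T c k ⊆ {ω | 1 / (4 * 2 ^ k) < ω.1 (c, k)} ∪
      {ω | ∀ i ∈ episodeEntries c k, ω.2 i = true} := by
  intro ω hω
  have hα0 : 0 < α := by linarith
  obtain ⟨p, hp, h1, h2⟩ := exists_of_mem_overEvent hε hα0 ⟨by linarith, hm⟩ hω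
  set L := Real.log T with hL
  have h2k : (0 : ℝ) < 2 ^ k := by positivity
  have hT0 : (0 : ℝ) < T := by
    have : 0 < T := by omega
    exact_mod_cast this
  have hlog2 : Real.log 2 ≤ L := Real.log_le_log two_pos (by exact_mod_cast hT)
  have hL2 : 1 / 2 ≤ L := by linarith [Real.log_two_gt_d9]
  have hx : 0 < 1 - q := by linarith
  have hεL : 16 * α * L < ε := by
    have h3 : 96 * α * (1 - q) * L < 6 * ε * (1 - q) := by nlinarith
    nlinarith
  have hoff : 2 * α * L / (ε * 2 ^ k) ≤ 1 / (8 * 2 ^ k) := by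
    rw [div_le_div_iff₀ (by positivity) (by positivity)]
    nlinarith
  have hu : 1 - p ≤ 1 / (4 * 2 ^ k) := by
    by_contra! hlt
    have hu0 : 0 < 1 - p := lt_trans (by positivity) hlt
    rcases hm.eq_or_lt with rfl | hm
    · rcases h2 with h2 | h2
      · linarith
      · rw [klBer_one (by linarith)] at h2
        exact absurd h2 (not_le.2 (EReal.coe_lt_top _))
    · have hm0 : 0 < m := by linarith
      have hy : 0 < 1 - m := by linarith
      rw [klBer_eq_klReal hm0 hm, EReal.coe_le_coe_iff] at hDk h2
      have h3 := klReal_le_mul_log hq hqm.le hm0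
      have h4 : 96 * α * L < Real.log ((1 - q) / (1 - m)) := by
        have : (1 - q) * (96 * α * L) < (1 - q) * Real.log ((1 - q) / (1 - m)) := by linarith
        exact lt_of_mul_lt_mul_left this hx.le
      rw [Real.log_div hx.ne' hy.ne'] at h4
      have h5 : Real.log (1 - q) ≤ 0 := Real.log_nonpos hx.le (by linarith)
      have h6 : -(3 * L) ≤ Real.log (1 - p) := by
        have h7 : Real.log (1 / (4 * 2 ^ k)) ≤ Real.log (1 - p) :=
          Real.log_le_log (by positivity) hlt.le
        have h8 : Real.log ((2 : ℝ) ^ k) ≤ L :=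
          Real.log_le_log h2k (by exact_mod_cast hk.le)
        have h9 : Real.log (4 : ℝ) = 2 * Real.log 2 := by
          rw [show (4 : ℝ) = 2 ^ 2 by norm_num, Real.log_pow]
          norm_num
        rw [Real.log_div one_ne_zero (by positivity), Real.log_one,
          Real.log_mul (by norm_num) h2k.ne', h9] at h7
        linarith
      have hαL : 3 * L ≤ α * L := by nlinarith
      rcases h2 with h2 | h2
      · have : Real.log (1 - p) ≤ Real.log (1 - m) := Real.log_le_log hu0 (by linarith)
        nlinarith
      · have h7 := sub_le_mul_log_div hp.1 hm0
        rw [klReal, Real.log_div hu0.ne' hy.ne'] at h2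
        have h8 : (1 - p) * (88 * α * L) ≤ (1 - p) * (Real.log (1 - p) - Real.log (1 - m) - 1) := by
          refine mul_le_mul_of_nonneg_left ?_ hu0.le
          nlinarith
        have h9 : (1 - p) * (88 * α * L) ≤ 2 * α * L / 2 ^ k := by linarith
        -- The entropy would be at least 11 times its budget.
        have h10 : 1 / (4 * 2 ^ k) * (88 * α * L) < (1 - p) * (88 * α * L) :=
          mul_lt_mul_of_pos_right hlt (by positivity)
        have h11 : 1 / (4 * (2 : ℝ) ^ k) * (88 * α * L) = 11 * (2 * α * L / 2 ^ k) := by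
          field_simp
          norm_num
        have h12 : 0 < 2 * α * L / 2 ^ k := by positivity
        linarith
  have h2k1 : (1 : ℝ) ≤ 2 ^ k := one_le_pow₀ one_le_two
  have hinv : 1 / (2 : ℝ) ^ k ≤ 1 := (div_le_one h2k).2 h2k1
  have e4 : 1 / (4 * (2 : ℝ) ^ k) = 1 / 2 ^ k / 4 := by field_simp
  have e8 : 1 / (8 * (2 : ℝ) ^ k) = 1 / 2 ^ k / 8 := by field_simp
  have hpos : 0 < 1 / (2 : ℝ) ^ k := by positivity
  have h3 := h1 (by linarith)
  by_cases hZ : 1 / (4 * 2 ^ k) < ω.1 (c, k)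
  · exact Or.inl hZ
  · refine Or.inr (forall_true_of_episodeMean_gt ?_)
    linarith

theorem card_entries_lastTwo (c : Fin K) (k : ℕ) :
    (episodeEntries c k ∪ episodeEntries c (k - 1)).card = lastTwo k := by
  rw [episodeEntries, episodeEntries, ← Finset.product_union, Finset.card_product,
    Finset.card_singleton, one_mul]
  match k with
  | 0 => simp [episode, lastTwo]
  | 1 => decide
  | k + 2 =>
    have h1 : 2 ^ (k + 2) / 2 = 2 ^ (k + 1) := by
      rw [pow_succ 2 (k + 1)]
      omega
    have h2 : 2 ^ (k + 1) / 2 = 2 ^ k := by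
      rw [pow_succ]
      omega
    have h3 : 2 ^ (k + 1) = 2 * 2 ^ k := by ring
    have h4 : 2 ^ (k + 2) = 4 * 2 ^ k := by ring
    rw [episode, episode, show k + 2 - 1 = k + 1 by omega, h1, h2, Finset.union_comm,
      Finset.Ico_union_Ico_eq_Ico (by omega) (by omega), Nat.card_Ico, lastTwo]
    omega

theorem tableLaw_real_forall_true {ε : ℝ} (hε : 0 < ε) {μ : Fin K → ℝ}
    (hμ : ∀ a, μ a ∈ Set.Icc (0 : ℝ) 1) (c : Fin K) (k : ℕ) :
    (tableLaw ε μ).real {ω | ∀ i ∈ episodeEntries c k ∪ episodeEntries c (k - 1), ω.2 i = true} =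
      μ c ^ lastTwo k := by
  refine (tableLaw_real_snd hε hμ
    {X | ∀ i ∈ episodeEntries c k ∪ episodeEntries c (k - 1), X i = true}).trans ?_
  rw [bernoulliPi_real_forall (μ := fun i : Fin K × ℕ => μ i.1) (fun i => hμ i.1) _ fun _ => true,
    ← card_entries_lastTwo c k]
  refine Finset.prod_eq_pow_card fun i hi => ?_
  have : i.1 = c := by
    rw [Finset.mem_union, episodeEntries, episodeEntries, Finset.mem_product, Finset.mem_product,
      Finset.mem_singleton] at hi
    rcases hi with hi | hi <;> exact hi.1
  rw [this]
  simp [bernoulliMass]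

/-- Bound of the regret of an arm whose complexity is large. -/
theorem mul_expected_pulls_le_of_lt_complexity {ε α : ℝ} (hε : 0 < ε) (hα : 3 ≤ α)
    {sel : (Fin K → ℝ) → Fin K} (hsel : IsArgmaxRule sel) {μ : Fin K → ℝ}
    (hμ : ∀ a, μ a ∈ Set.Icc (0 : ℝ) 1) {o c : Fin K} (hoc : μ c < μ o) {T : ℕ} (hT : 2 ≤ T)
    (hcase : 96 * α * (1 - μ c) * Real.log T < complexity ε (μ c) (μ o)) :
    (1 - μ c) * ∑ a, ∑ b, historyProb (adaPKLUCB K ε α sel T) μ a b *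
        ((Finset.univ.filter fun t => a t = c).card : ℝ) ≤ 3 := by
  have hα0 : 0 < α := by linarith
  have hprob := isProbabilityMeasure_tableLaw hε hμ
  obtain ⟨hD, hDε, hDk⟩ := complexity_spec hε (hμ c).1 hoc (hμ o).2
  set D := complexity ε (μ c) (μ o) with hDdef
  have hne : o ≠ c := fun h => by
    rw [h] at hoc
    exact lt_irrefl _ hoc
  have hx : 0 < 1 - μ c := by linarith [(hμ o).2]
  have hT2 : (2 : ℝ) ≤ T := by exact_mod_cast hT
  have hT0 : (0 : ℝ) < T := by linarith
  have hL0 : 0 ≤ Real.log T := Real.log_natCast_nonneg T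
  have hnoise : Real.exp (-(ε / 8)) ≤ 1 / (T : ℝ) ^ 6 := by
    have h1 : Real.exp ((6 : ℕ) * Real.log T) = (T : ℝ) ^ 6 := by
      rw [Real.exp_nat_mul, Real.exp_log hT0]
    rw [← h1, one_div, ← Real.exp_neg]
    refine Real.exp_le_exp.2 (neg_le_neg ?_)
    have h3 : 96 * α * (1 - μ c) * Real.log T < 6 * ε * (1 - μ c) := by
      nlinarith [(hμ o).2]
    have h4 : 16 * α * Real.log T < ε := by nlinarith
    push_cast
    nlinarith
  -- More than `2 ^ k` plays also means more than `2 ^ (k - 1)` plays, so two successive decisions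
  -- must fail. At `k = 0` truncated subtraction makes both the same, in agreement with `lastTwo 0 =
  -- 1`.
  set E : ℕ → Set ((Fin K × ℕ → ℝ) × (Fin K × ℕ → Bool)) := fun k =>
    underUnion ε α μ o T (k - 1) ∪ (overEvent ε α (μ o) T c k ∩ overEvent ε α (μ o) T c (k - 1))
    with hEdef
  have hE : ∀ k a b, 2 ^ k < T → 2 ^ k < (boolState a b T).pulls c →
      tableEvent ε α sel a b T ⊆ E k := by
    intro k a b _ hk ω hω
    have hk' : 2 ^ (k - 1) < (boolState a b T).pulls c :=
      lt_of_le_of_lt (Nat.pow_le_pow_right two_pos (Nat.sub_le k 1)) hk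
    rcases mem_underEvent_or_overEvent hε hα0 hsel.2 hμ hne hk hω with ⟨j, hj, h⟩ | h
    · exact Or.inl (underUnion_anti hε hα0 μ o T (Nat.sub_le k 1)
        (Set.mem_biUnion (Finset.mem_range.2 hj) h))
    rcases mem_underEvent_or_overEvent hε hα0 hsel.2 hμ hne hk' hω with ⟨j, hj, h'⟩ | h'
    · exact Or.inl (Set.mem_biUnion (Finset.mem_range.2 hj) h')
    · exact Or.inr ⟨h, h'⟩
  have hnoiseP : ∀ k : ℕ, (tableLaw ε μ).real {ω | 1 / (4 * 2 ^ k) < ω.1 (c, k)} ≤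
      1 / (T : ℝ) ^ 6 / 2 := by
    intro k
    rw [tableLaw_real_noise_gt hε hμ c k (by positivity)]
    have : 1 / (4 * 2 ^ k) * (ε * 2 ^ k / 2) = ε / 8 := by
      field_simp
      norm_num
    rw [this]
    linarith
  have hP : ∀ k : ℕ, 2 ^ k < T → (tableLaw ε μ).real (E k) ≤
      4 / 9 / ((2 : ℝ) ^ (k - 1) + 1) ^ 2 + μ c ^ lastTwo k + 1 / (T : ℝ) ^ 6 := by
    intro k hk
    have hk' : 2 ^ (k - 1) < T :=
      lt_of_le_of_lt (Nat.pow_le_pow_right two_pos (Nat.sub_le k 1)) hk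
    have h1 := tableLaw_real_underUnion hε hα hμ o T (k - 1)
    have s1 := overEvent_subset_of_lt hε hα (hμ c).1 hoc (hμ o).2 hDε hDk hT hcase hk c
    have s2 := overEvent_subset_of_lt hε hα (hμ c).1 hoc (hμ o).2 hDε hDk hT hcase hk' c
    have hsub : overEvent ε α (μ o) T c k ∩ overEvent ε α (μ o) T c (k - 1) ⊆
        ({ω | 1 / (4 * 2 ^ k) < ω.1 (c, k)} ∪ {ω | 1 / (4 * 2 ^ (k - 1)) < ω.1 (c, k - 1)}) ∪
          {ω | ∀ i ∈ episodeEntries c k ∪ episodeEntries c (k - 1), ω.2 i = true} := by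
      rintro ω ⟨h, h'⟩
      rcases s1 h with h | h
      · exact Or.inl (Or.inl h)
      rcases s2 h' with h' | h'
      · exact Or.inl (Or.inr h')
      · refine Or.inr fun i hi => ?_
        rcases Finset.mem_union.1 hi with hi | hi
        · exact h i hi
        · exact h' i hi
    have h2 := (measureReal_mono hsub (measure_ne_top (tableLaw ε μ) _)).trans
      (measureReal_union_le _ _)
    have h3 := measureReal_union_le (μ := tableLaw ε μ)
      {ω : (Fin K × ℕ → ℝ) × (Fin K × ℕ → Bool) | 1 / (4 * 2 ^ k) < ω.1 (c, k)}
      {ω | 1 / (4 * 2 ^ (k - 1)) < ω.1 (c, k - 1)}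
    rw [tableLaw_real_forall_true hε hμ] at h2
    have h4 := hnoiseP k
    have h5 := hnoiseP (k - 1)
    refine (measureReal_union_le _ _).trans ?_
    linarith
  have hpulls := expected_pulls_le hε hα0 hsel.1 hμ T c E hE
  have hunder : ∑ k ∈ Finset.range T, (2 : ℝ) ^ k * (4 / 9 / ((2 : ℝ) ^ (k - 1) + 1) ^ 2) ≤
      11 / 9 := by
    obtain ⟨T', rfl⟩ : ∃ T', T = T' + 1 := ⟨T - 1, by omega⟩
    rw [Finset.sum_range_succ']
    have h1 := sum_two_pow_mul_under_le T'
    have h2 : ∑ k ∈ Finset.range T', (2 : ℝ) ^ (k + 1) *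
        (4 / 9 / ((2 : ℝ) ^ (k + 1 - 1) + 1) ^ 2) =
        2 * ∑ k ∈ Finset.range T', (2 : ℝ) ^ k * (4 / 9 / ((2 : ℝ) ^ k + 1) ^ 2) := by
      rw [Finset.mul_sum]
      refine Finset.sum_congr rfl fun k _ => ?_
      rw [Nat.add_sub_cancel, pow_succ]
      ring
    rw [h2]
    norm_num
    linarith
  have hnoiseSum : ∑ k ∈ (Finset.range T).filter (fun k => 2 ^ k < T),
      (2 : ℝ) ^ k * (1 / (T : ℝ) ^ 6) ≤ 1 / 16 := by
    have h1 := sum_two_pow_filter_le hT0.le T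
    rw [← Finset.sum_filter] at h1
    have h2 : (Finset.range T).filter (fun k => (2 : ℝ) ^ k < T) =
        (Finset.range T).filter fun k => 2 ^ k < T := by
      refine Finset.filter_congr fun k _ => ?_
      exact_mod_cast Iff.rfl
    rw [h2] at h1
    rw [← Finset.sum_mul]
    calc _ ≤ 2 * (T : ℝ) * (1 / (T : ℝ) ^ 6) := by gcongr
      _ = 2 / (T : ℝ) ^ 5 := by field_simp
      _ ≤ 2 / 2 ^ 5 := by gcongr
      _ = _ := by norm_num
  have hsum : ∑ k ∈ (Finset.range T).filter (fun k => 2 ^ k < T),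
      (2 : ℝ) ^ k * (tableLaw ε μ).real (E k) ≤
      11 / 9 + ∑ k ∈ Finset.range T, (2 : ℝ) ^ k * μ c ^ lastTwo k + 1 / 16 := by
    have hq0 := (hμ c).1
    calc _ ≤ ∑ k ∈ (Finset.range T).filter (fun k => 2 ^ k < T),
          ((2 : ℝ) ^ k * (4 / 9 / ((2 : ℝ) ^ (k - 1) + 1) ^ 2) + (2 : ℝ) ^ k * μ c ^ lastTwo k +
            (2 : ℝ) ^ k * (1 / (T : ℝ) ^ 6)) := by
          refine Finset.sum_le_sum fun k hk => ?_
          rw [← mul_add, ← mul_add]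
          exact mul_le_mul_of_nonneg_left (hP k (Finset.mem_filter.1 hk).2) (by positivity)
      _ ≤ _ := by
        rw [Finset.sum_add_distrib, Finset.sum_add_distrib]
        refine add_le_add (add_le_add ?_ ?_) hnoiseSum
        · exact (Finset.sum_le_sum_of_subset_of_nonneg (Finset.filter_subset _ _)
            fun _ _ _ => by positivity).trans hunder
        · exact Finset.sum_le_sum_of_subset_of_nonneg (Finset.filter_subset _ _)
            fun _ _ _ => by positivity
  have hgeo := sum_two_pow_mul_pow_lastTwo_le (hμ c).1 (hμ c).2 T
  have hq0 := (hμ c).1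
  have hq1 := (hμ c).2
  have hfin : (1 - μ c) * (1 + 11 / 9 + 1 / 16) +
      ((1 - μ c) * (μ c + 2 * μ c ^ 2 + 4 * μ c ^ 3) + 8 / 3 * μ c ^ 3) ≤ 3 := by
    -- The quartic peaks at about 2.72 near `q = 0.9`, whence the squares centred at `7 / 8`.
    generalize μ c = q at hq0 hq1
    nlinarith [mul_nonneg hq0 (sub_nonneg.2 hq1), sq_nonneg (q ^ 2 - q * (3 / 5)),
      sq_nonneg (q - 7 / 8), sq_nonneg (q * (q - 7 / 8)), sq_nonneg (q ^ 2 - 7 / 8 * q),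
      mul_nonneg (mul_nonneg hq0 hq0) (sub_nonneg.2 hq1)]
  calc _ ≤ (1 - μ c) * (1 + (11 / 9 +
        ∑ k ∈ Finset.range T, (2 : ℝ) ^ k * μ c ^ lastTwo k + 1 / 16)) := by
        refine mul_le_mul_of_nonneg_left (hpulls.trans ?_) hx.le
        linarith
    _ ≤ _ := by
      have : (1 - μ c) * (1 + (11 / 9 +
        ∑ k ∈ Finset.range T, (2 : ℝ) ^ k * μ c ^ lastTwo k + 1 / 16)) =
        (1 - μ c) * (1 + 11 / 9 + 1 / 16) +
          (1 - μ c) * ∑ k ∈ Finset.range T, (2 : ℝ) ^ k * μ c ^ lastTwo k := by ring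
      rw [this]
      linarith

end EasyArms

section Main

variable {K : ℕ}

/-! ### The regret bound -/

theorem gap_nonneg (μ : Fin K → ℝ) (c : Fin K) : 0 ≤ gap μ c :=
  sub_nonneg.2 (le_ciSup (Set.finite_range μ).bddAbove c)

theorem gap_mul_expected_pulls_le {ε α : ℝ} (hε : 0 < ε) (hα : 3 ≤ α)
    {sel : (Fin K → ℝ) → Fin K} (hsel : IsArgmaxRule sel) {μ : Fin K → ℝ}
    (hμ : ∀ a, μ a ∈ Set.Icc (0 : ℝ) 1) {c : Fin K} (hc : 0 < gap μ c) (T : ℕ) :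
    gap μ c * ∑ a, ∑ b, historyProb (adaPKLUCB K ε α sel T) μ a b *
        ((Finset.univ.filter fun t => a t = c).card : ℝ) ≤
      100000 * α * gap μ c /
        (min (klBer (μ c) (bestMean μ)) ((6 * ε * gap μ c : ℝ) : EReal)).toReal * Real.log T + 3 := by
  have : Nonempty (Fin K) := ⟨c⟩
  obtain ⟨o, ho⟩ : ∃ o, μ o = bestMean μ := exists_eq_ciSup_of_finite
  have hgap : gap μ c = μ o - μ c := by rw [ho, gap]
  have hoc : μ c < μ o := by linarith
  have hD : (min (klBer (μ c) (bestMean μ)) ((6 * ε * gap μ c : ℝ) : EReal)).toReal =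
      complexity ε (μ c) (μ o) := by
    rw [complexity, ho, gap]
  rw [hD]
  obtain ⟨hD0, -, -⟩ := complexity_spec hε (hμ c).1 hoc (hμ o).2
  have hα0 : 0 < α := by linarith
  have hL0 : 0 ≤ Real.log T := Real.log_natCast_nonneg T
  have hterm : 0 ≤ 100000 * α * gap μ c / complexity ε (μ c) (μ o) * Real.log T := by positivity
  have hgap1 : gap μ c ≤ 1 := by linarith [(hμ o).2, (hμ c).1]
  have hnonneg : 0 ≤ ∑ a, ∑ b, historyProb (adaPKLUCB K ε α sel T) μ a b *
      ((Finset.univ.filter fun t => a t = c).card : ℝ) :=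
    Finset.sum_nonneg fun a _ => Finset.sum_nonneg fun b _ => mul_nonneg
      (by rw [← tableLaw_real_tableEvent hμ (sel 0)]; exact measureReal_nonneg) (Nat.cast_nonneg _)
  rcases lt_or_ge T 2 with hT | hT
  -- For `T < 2` no scale satisfies `2 ^ k < T`, so at most one play is counted.
  · have h := expected_pulls_le hε hα0 hsel.1 hμ T c (fun _ => Set.univ)
      fun _ _ _ _ _ => Set.subset_univ _
    rw [Finset.filter_false_of_mem, Finset.sum_empty, add_zero] at h
    · nlinarith
    · intro k _
      have := Nat.two_pow_pos k
      omega
  · rcases le_or_gt (complexity ε (μ c) (μ o)) (96 * α * (1 - μ c) * Real.log T) with h | h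
    · have h1 := mul_le_mul_of_nonneg_left
        (expected_pulls_le_of_complexity_le hε hα hsel hμ hoc hT h) hc.le
      have e : gap μ c * (17 / 9 + 100000 * α * Real.log T / complexity ε (μ c) (μ o)) =
          gap μ c * (17 / 9) +
            100000 * α * gap μ c / complexity ε (μ c) (μ o) * Real.log T := by ring
      rw [e] at h1
      linarith
    · have h1 := mul_expected_pulls_le_of_lt_complexity hε hα hsel hμ hoc hT h
      have h2 : gap μ c ≤ 1 - μ c := by linarith [(hμ o).2]
      have h3 := mul_le_mul_of_nonneg_right h2 hnonneg
      linarith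

theorem regret_adaPKLUCB_le {ε α : ℝ} (hε : 0 < ε) (hα : 3 < α)
    {sel : (Fin K → ℝ) → Fin K} (hsel : IsArgmaxRule sel) {μ : Fin K → ℝ}
    (hμ : ∀ a, μ a ∈ Set.Icc (0 : ℝ) 1) (T : ℕ) :
    regret (adaPKLUCB K ε α sel T) μ ≤
      ∑ a with 0 < gap μ a,
        (100000 * α * gap μ a /
            (min (klBer (μ a) (bestMean μ)) ((6 * ε * gap μ a : ℝ) : EReal)).toReal
          * Real.log T + 3 * α / (α - 3)) := by
  rw [regret_eq_sum_gap hε (by linarith) hsel.1, Finset.sum_filter]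
  refine Finset.sum_le_sum fun c _ => ?_
  split_ifs with hc
  · refine (gap_mul_expected_pulls_le hε hα.le hsel hμ hc T).trans ?_
    gcongr
    rw [le_div_iff₀ (by linarith)]
    linarith
  · rw [le_antisymm (not_lt.1 hc) (gap_nonneg μ c), zero_mul]

theorem limsup_div_log_le {f : ℕ → ℝ} {A B : ℝ} (h : ∀ T : ℕ, f T ≤ A * Real.log T + B) :
    Filter.limsup (fun T : ℕ => ((f T / Real.log T : ℝ) : EReal)) Filter.atTop ≤ (A : EReal) := by
  have hlog : Filter.Tendsto (fun T : ℕ => Real.log T) Filter.atTop Filter.atTop :=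
    Real.tendsto_log_atTop.comp tendsto_natCast_atTop_atTop
  have hlim : Filter.Tendsto (fun T : ℕ => ((A + B / Real.log T : ℝ) : EReal)) Filter.atTop
      (nhds (A : EReal)) := by
    refine (continuous_coe_real_ereal.tendsto A).comp ?_
    simpa using (tendsto_const_nhds (x := A)).add (hlog.const_div_atTop B)
  rw [← hlim.limsup_eq]
  refine Filter.limsup_le_limsup ?_
  filter_upwards [hlog.eventually_gt_atTop 0] with T hT
  rw [EReal.coe_le_coe_iff, div_le_iff₀ hT, add_mul, div_mul_cancel₀ _ hT.ne']
  exact h T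

end Main

end PrivateBandit

end

open PrivateBandit in
/-- The first part is privacy. In the second, `C₂` is an absolute constant and `C₁`, `C₃` depend
on `α` only; its last clause compares the regret with the expression
`∑ Δ_a / min {d(μ_a, μ*), 6 ε Δ_a}` of the problem-dependent lower bound. -/
theorem mainTheorem1 :
    (∀ (K : ℕ) (ε α : ℝ) (sel : (Fin K → ℝ) → Fin K), 0 < ε → 0 < α → IsArgmaxRule sel →
      ∀ T : ℕ, IsGlobalDP ε (adaPKLUCB K ε α sel T)) ∧
    ∃ C₂ : ℝ, 0 < C₂ ∧ ∀ α : ℝ, 3 < α → ∃ C₁ C₃ : ℝ, 0 < C₁ ∧ 0 < C₃ ∧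
      ∀ (K : ℕ) (ε : ℝ) (sel : (Fin K → ℝ) → Fin K) (μ : Fin K → ℝ),
        0 < ε → IsArgmaxRule sel → (∀ a, μ a ∈ Set.Icc (0 : ℝ) 1) →
        (∀ T : ℕ, regret (adaPKLUCB K ε α sel T) μ ≤
          ∑ a with 0 < gap μ a,
            (C₁ * gap μ a /
                (min (klBer (μ a) (bestMean μ)) ((C₂ * ε * gap μ a : ℝ) : EReal)).toReal
              * Real.log T + 3 * α / (α - 3))) ∧
        Filter.limsup
            (fun T : ℕ => ((regret (adaPKLUCB K ε α sel T) μ / Real.log T : ℝ) : EReal))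
            Filter.atTop ≤
          ((C₃ * ∑ a with 0 < gap μ a,
            gap μ a /
              (min (klBer (μ a) (bestMean μ)) ((6 * ε * gap μ a : ℝ) : EReal)).toReal : ℝ) :
            EReal) := by
  -- Choosing `C₂ = 6` makes the denominators of both regret clauses equal, so the asymptotic clause
  -- follows with `C₃ = C₁`.
  refine ⟨fun K ε α sel hε hα hsel T => isGlobalDP_adaPKLUCB hε hα hsel.1 T, 6, by norm_num,
    fun α hα => ⟨100000 * α, 100000 * α, by linarith, by linarith, fun K ε sel μ hε hsel hμ =>
      ⟨regret_adaPKLUCB_le hε hα hsel hμ, ?_⟩⟩⟩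
  refine limsup_div_log_le (B := ∑ a with 0 < gap μ a, 3 * α / (α - 3)) fun T => ?_
  refine (regret_adaPKLUCB_le hε hα hsel hμ T).trans (le_of_eq ?_)
  rw [Finset.sum_add_distrib, Finset.mul_sum, Finset.sum_mul]
  congr 1
  exact Finset.sum_congr rfl fun a _ => by ring
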